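/- **Setting.** There are $K\ge 1$ arms and a measurable space $\mathcal C$ of contexts (finite or infinite). Contexts $c_1,c_2,\dots$ are drawn i.i.d. from a distribution $\nu$ on $\mathcal C$ that is unknown to the learner. Every context $c$ has a nonempty set $\mathcal A_c\subseteq[K]$ of active arms. An oblivious adversary fixes losses $\ell_{tk}:\mathcal C\to[0,1]$ in advance (all these data are measurable in $c$). In round $t$ the learner sees $c_t$, plays $A_t\in\mathcal A_{c_t}$, suffers $\ell_{t,A_t}(c_t)$ and observes the whole function $\ell_{t,A_t}$. With $\Pi$ the set of measurable maps $\pi:\mathcal C\to[K]$ such that $\pi(c)\in\mathcal A_c$ for all $c$, the regret after $T$ rounds is $$\mathrm{Reg}=\sup_{\pi\in\Pi}\mathbb E\Big[\sum_{t=1}^T \ell_{t,A_t}(c_t)-\ell_{t,\pi(c_t)}(c_t)\Big],$$ the expectation being over the contexts and the randomness of the learner. **Algorithm 1** (parameters $\eta,\gamma>0$ and an even integer $L\ge 2$). The rounds are split into epochs $\mathcal T_1,\mathcal T_2,\dots$ of $L$ consecutive rounds, and each epoch into pairs $(t,t+1)$, $t$ odd. For a pair starting in round $t$ let $$p_{t,c}=\operatorname*{argmin}_{x}\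 \Big\langle x,\sum_{s<t}\widehat\ell_{s,c}\Big\rangle+\frac1\eta\sum_k x_k\log x_k ,$$ where $x$ ranges over the probability vectors supported on $\mathcal A_c$, i.e. $p_{t,c,k}\propto \mathbb 1[k\in\mathcal A_c]\exp(-\eta\sum_{s<t}\widehat\ell_{s,c,k})$. The snapshots are $s_{1,c}=s_{2,c}=$ the uniform distribution on $\mathcal A_c$, and $s_{e+2,c}=p_{t,c}$ with $t$ the start of the last pair of epoch $e$, for $e\ge1$. * In epoch 1, play $A_t\sim s_{1,c_t}$ and make no loss estimates ($\widehat\ell_t=0$). Set $\widehat f_{2,k}=\frac1L\sum_{t\in\mathcal T_1}\frac12 s_{2,c_t,k}$. * In epoch $e\ge 2$, for each pair $(t,t+1)$ and each $t'\in\{t,t+1\}$, let $q_{t',c_{t'}}=p_{t,c_{t'}}$ if $p_{t,c_{t'},k}\ge s_{e,c_{t'},k}/2$ for all $k$, and $q_{t',c_{t'}}=s_{e,c_{t'}}$ otherwise; play $A_{t'}\sim q_{t',c_{t'}}$. Then let $(t_f,t_\ell)$ be a uniformly random ordering of $\{t,t+1\}$, draw $S$ from the Bernoulli distribution with parameter $s_{e,c_{t_\ell},A_{t_\ell}}/(2q_{t_\ell,c_{t_\ell},A_{t_\ell}})$,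 and set, for all $c$ and $k$, $$\widehat\ell_{t_\ell,c,k}=\frac{2\,\ell_{t_\ell,k}(c)}{\widehat f_{e,k}+\frac32\gamma}\,\mathbb 1[A_{t_\ell}=k,\ S=1],\qquad \widehat\ell_{t_f,c,k}=0 .$$ Set $\widehat f_{e+1,k}=\frac{2}{L}\sum_{t_f}\frac12 s_{e+1,c_{t_f},k}$, the sum being over the rounds $t_f$ of epoch $e$. **Theorem.** (i) There is a universal constant $C$ such that for all $K$, $T$, $\mathcal C$, $\nu$, $(\mathcal A_c)$, $(\ell_{tk})$, all even $L\ge2$ and all $\eta,\gamma,\iota>0$ with $$\eta\le\frac{\gamma}{2(2L\gamma+\iota)},\qquad \gamma\ge\frac{16\iota}{L},\qquad \iota\ge\log\frac{8K}{\gamma},$$ Algorithm 1 satisfies $$\mathrm{Reg}\le C\Big(\Big(\gamma+\frac{\iota}{L}+\frac{\gamma^2L}{\iota}+\eta+e^{-\iota}\frac TL\Big)KT+\frac{\log K}{\eta}+L\Big).$$ (ii) There are universal constants $C$ and $m$ such that for all $K\ge2$ and $T\ge1$ and all $\mathcal C$, $\nu$, $(\mathcal A_c)$, $(\ell_{tk})$,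 Algorithm 1 with $\iota=2\log(8KT)$, $L=2\big\lceil\tfrac12\sqrt{\iota KT/\log K}\,\big\rceil$, $\gamma=16\iota/L$ and $\eta=\gamma/(2(2L\gamma+\iota))$ satisfies $\mathrm{Reg}\le C\sqrt{KT}\,\log^m(KT)$, i.e. $\mathrm{Reg}=\widetilde O(\sqrt{KT})$. In particular both bounds do not depend on the number of contexts. -/

import Mathlib

open MeasureTheory ProbabilityTheory

universe u

noncomputable section

namespace CrossLearning

/-! ### The problem -/

/-- A contextual `K`-armed bandit environment with context space `X`: an oblivious loss sequence
with values in `[0,1]`, a context distribution, and a nonempty set of active arms per context.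
Rounds are numbered `0, 1, 2, ...`. -/
structure Environment (X : Type u) [MeasurableSpace X] (K : ℕ) where
  /-- the distribution of the contexts -/
  contextLaw : Measure X
  isProbabilityMeasure_contextLaw : IsProbabilityMeasure contextLaw
  /-- the arms that may be played in a context -/
  active : X → Finset (Fin K)
  active_nonempty : ∀ c, (active c).Nonempty
  measurableSet_active : ∀ k, MeasurableSet {c | k ∈ active c}
  /-- the loss of an arm in a round, as a function of the context -/
  loss : ℕ → Fin K → X → ℝ
  measurable_loss : ∀ t k, Measurable (loss t k)
  loss_nonneg : ∀ t k c, 0 ≤ loss t k c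
  loss_le_one : ∀ t k c, loss t k c ≤ 1

attribute [instance] Environment.isProbabilityMeasure_contextLaw

/-- The parameters of the algorithm: learning rate, confidence parameter, epoch length. -/
structure Params where
  η : ℝ
  γ : ℝ
  L : ℕ

/-! ### Randomness

All randomness of a round: the context, a uniform seed from which the arm is drawn, a fair coin
(that of the first round of a pair of rounds decides the role of the two rounds), and a uniform seed
for the Bernoulli variable of the round. -/

/-- The random data of one round: context, arm seed, coin, acceptance seed. -/
abbrev RoundData (X : Type u) := X × unitInterval × Bool × unitInterval

/-- The joint law of the independent random data of one round. -/
def roundLaw {X : Type u} [MeasurableSpace X] (ν : Measure X) : Measure (RoundData X) :=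
  ν.prod ((volume : Measure unitInterval).prod
    ((PMF.uniformOfFintype Bool).toMeasure.prod (volume : Measure unitInterval)))

instance {X : Type u} [MeasurableSpace X] (ν : Measure X) [IsProbabilityMeasure ν] :
    IsProbabilityMeasure (roundLaw ν) := by
  unfold roundLaw; infer_instance

variable {X : Type u} [MeasurableSpace X] {K : ℕ}

/-- The probability measure under which the rounds' data are i.i.d. -/
def Environment.prob (E : Environment X K) : Measure (ℕ → RoundData X) :=
  Measure.infinitePi fun _ => roundLaw E.contextLaw

instance (E : Environment X K) : IsProbabilityMeasure E.prob := by
  unfold Environment.prob; infer_instance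

/-- The context of round `t`. -/
def context (ω : ℕ → RoundData X) (t : ℕ) : X := (ω t).1

/-- The seed for the draw of the arm in round `t`. -/
def armSeed (ω : ℕ → RoundData X) (t : ℕ) : ℝ := (ω t).2.1

/-- The coin of round `t`. -/
def coin (ω : ℕ → RoundData X) (t : ℕ) : Bool := (ω t).2.2.1

/-- The seed for the Bernoulli variable of round `t`. -/
def acceptSeed (ω : ℕ → RoundData X) (t : ℕ) : ℝ := (ω t).2.2.2

/-- In the `j`-th pair of rounds `{2j, 2j+1}`, the round used for the loss estimate. -/
def lossRound (ω : ℕ → RoundData X) (j : ℕ) : ℕ := if coin ω (2 * j) then 2 * j + 1 else 2 * j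

/-- In the `j`-th pair of rounds `{2j, 2j+1}`, the round used for the frequency estimate. -/
def freqRound (ω : ℕ → RoundData X) (j : ℕ) : ℕ := if coin ω (2 * j) then 2 * j else 2 * j + 1

/-- Sampling by inversion: the first arm `k` with `u < q 0 + ... + q k`. For uniform `u` this arm
has law `q`, see `volume_sample_eq`. -/
def sample [NeZero K] (q : Fin K → ℝ) (u : ℝ) : Fin K :=
  if h : (Finset.univ.filter fun k => u < ∑ i ∈ Finset.Iic k, q i).Nonempty then
    (Finset.univ.filter fun k => u < ∑ i ∈ Finset.Iic k, q i).min' h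
  else 0

theorem sample_eq_iff {K : ℕ} [NeZero K] {q : Fin K → ℝ} (hq : ∀ k, 0 ≤ q k) (hs : ∑ k, q k = 1)
    {u : ℝ} (hu0 : 0 ≤ u) (hu1 : u < 1) (k : Fin K) :
    sample q u = k ↔ ∑ i ∈ Finset.Iio k, q i ≤ u ∧ u < ∑ i ∈ Finset.Iic k, q i := by
  have hne : (Finset.univ.filter fun k => u < ∑ i ∈ Finset.Iic k, q i).Nonempty := by
    refine ⟨⟨K - 1, by have := NeZero.pos K; omega⟩, ?_⟩
    rw [Finset.mem_filter]
    refine ⟨Finset.mem_univ _, ?_⟩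
    have : Finset.Iic (⟨K - 1, by have := NeZero.pos K; omega⟩ : Fin K) = Finset.univ := by
      ext i; simp [Fin.le_def]; omega
    rw [this, hs]; exact hu1
  rw [sample, dif_pos hne]
  constructor
  · rintro rfl
    have hm := Finset.min'_mem _ hne
    set k := Finset.min' _ hne with hk
    refine ⟨?_, (Finset.mem_filter.1 hm).2⟩
    by_contra! hlt
    rcases (Finset.Iio k).eq_empty_or_nonempty with h0 | h0
    · rw [h0] at hlt; simp at hlt; linarith
    · have hmk := Finset.mem_Iio.1 (Finset.max'_mem _ h0)
      have hI : Finset.Iio k = Finset.Iic ((Finset.Iio k).max' h0) := by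
        ext j
        rw [Finset.mem_Iic]
        exact ⟨fun h => Finset.le_max' _ _ h, fun h => Finset.mem_Iio.2 (h.trans_lt hmk)⟩
      rw [hI] at hlt
      have := Finset.min'_le (Finset.univ.filter fun k => u < ∑ i ∈ Finset.Iic k, q i)
        ((Finset.Iio k).max' h0) (Finset.mem_filter.2 ⟨Finset.mem_univ _, hlt⟩)
      exact absurd this (not_le.2 hmk)
  · rintro ⟨h1, h2⟩
    apply le_antisymm
    · exact Finset.min'_le (Finset.univ.filter fun k => u < ∑ i ∈ Finset.Iic k, q i) k
        (Finset.mem_filter.2 ⟨Finset.mem_univ _, h2⟩)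
    · refine Finset.le_min' _ _ _ fun j hj => ?_
      by_contra! hjk
      have h3 := (Finset.mem_filter.1 hj).2
      have : ∑ i ∈ Finset.Iic j, q i ≤ ∑ i ∈ Finset.Iio k, q i :=
        Finset.sum_le_sum_of_subset_of_nonneg
          (fun i hi => Finset.mem_Iio.2 ((Finset.mem_Iic.1 hi).trans_lt hjk)) fun i _ _ => hq i
      linarith

/-- For a uniform seed, `sample q` has law `q`. -/
theorem volume_sample_eq {K : ℕ} [NeZero K] {q : Fin K → ℝ} (hq : ∀ k, 0 ≤ q k)
    (hs : ∑ k, q k = 1) (k : Fin K) :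
    volume {u : unitInterval | sample q u = k} = ENNReal.ofReal (q k) := by
  have hle : ∀ s : Finset (Fin K), ∑ i ∈ s, q i ∈ unitInterval := fun s =>
    ⟨Finset.sum_nonneg fun i _ => hq i,
      hs ▸ Finset.sum_le_sum_of_subset_of_nonneg (Finset.subset_univ s) fun i _ _ => hq i⟩
  have hsplit : ∑ i ∈ Finset.Iic k, q i = ∑ i ∈ Finset.Iio k, q i + q k := by
    rw [← Finset.Iio_insert, Finset.sum_insert (by simp), add_comm]
  have hae : {u : unitInterval | sample q u = k} =ᵐ[volume]
      Set.Ico (⟨_, hle (Finset.Iio k)⟩ : unitInterval) ⟨_, hle (Finset.Iic k)⟩ := by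
    have h1 : ∀ᵐ u : unitInterval, u ≠ 1 := by
      simp [ae_iff]
    filter_upwards [h1] with u hu
    have hu1 : (u : ℝ) < 1 := lt_of_le_of_ne u.2.2 fun h => hu (Subtype.ext h)
    exact propext (sample_eq_iff hq hs u.2.1 hu1 k)
  rw [measure_congr hae, unitInterval.volume_Ico]
  congr 1
  simp [hsplit]

/-! ### The algorithm -/

/-- The uniform distribution on a set of arms. -/
def uniformOnArms (A : Finset (Fin K)) (k : Fin K) : ℝ := if k ∈ A then 1 / (A.card : ℝ) else 0

/-- The FTRL distribution with entropy regularisation over the simplex of the arms `A`, for the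
cumulative loss vector `Λ`; see `isMinOn_ftrlObjective_iff`. -/
def ftrlDist (η : ℝ) (A : Finset (Fin K)) (Λ : Fin K → ℝ) (k : Fin K) : ℝ :=
  if k ∈ A then Real.exp (-η * Λ k) / ∑ i ∈ A, Real.exp (-η * Λ i) else 0

/-- The FTRL objective: cumulative loss plus the scaled negative entropy. -/
def ftrlObjective {K : ℕ} (η : ℝ) (Λ x : Fin K → ℝ) : ℝ :=
  ∑ k, x k * Λ k + η⁻¹ * ∑ k, x k * Real.log (x k)

/-- The probability vectors supported on the arms `A`. -/
def simplexOn {K : ℕ} (A : Finset (Fin K)) : Set (Fin K → ℝ) :=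
  {x | (∀ k, 0 ≤ x k) ∧ ∑ k, x k = 1 ∧ ∀ k ∉ A, x k = 0}

theorem ftrlDist_mem_simplexOn {K : ℕ} (η : ℝ) {A : Finset (Fin K)} (hA : A.Nonempty)
    (Λ : Fin K → ℝ) : ftrlDist η A Λ ∈ simplexOn A := by
  have hZ : 0 < ∑ i ∈ A, Real.exp (-η * Λ i) := Finset.sum_pos (fun i _ => Real.exp_pos _) hA
  refine ⟨fun k => ?_, ?_, fun k hk => by simp [ftrlDist, hk]⟩
  · unfold ftrlDist; split_ifs <;> positivity
  · simp only [ftrlDist]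
    rw [Finset.sum_ite_mem, Finset.univ_inter, ← Finset.sum_div, div_self hZ.ne']

theorem ftrlObjective_sub {K : ℕ} {η : ℝ} (hη : 0 < η) {A : Finset (Fin K)} (hA : A.Nonempty)
    (Λ : Fin K → ℝ) {x : Fin K → ℝ} (hx : x ∈ simplexOn A) :
    ftrlObjective η Λ x = -η⁻¹ * Real.log (∑ i ∈ A, Real.exp (-η * Λ i))
      + η⁻¹ * ∑ k ∈ A, ftrlDist η A Λ k * InformationTheory.klFun (x k / ftrlDist η A Λ k) := by
  have hZ : 0 < ∑ i ∈ A, Real.exp (-η * Λ i) := Finset.sum_pos (fun i _ => Real.exp_pos _) hA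
  set Z := ∑ i ∈ A, Real.exp (-η * Λ i) with hZd
  obtain ⟨hx0, hx1, hxA⟩ := hx
  have hxs : ∑ k ∈ A, x k = 1 := by
    rw [← hx1]; exact Finset.sum_subset (Finset.subset_univ A) fun k _ hk => hxA k hk
  have hps : ∑ k ∈ A, ftrlDist η A Λ k = 1 := by
    rw [← (ftrlDist_mem_simplexOn η hA Λ).2.1]
    exact Finset.sum_subset (Finset.subset_univ A)
      fun k _ hk => (ftrlDist_mem_simplexOn η hA Λ).2.2 k hk
  have hterm : ∀ k ∈ A, ftrlDist η A Λ k * InformationTheory.klFun (x k / ftrlDist η A Λ k)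
      = x k * Real.log (x k) + η * (x k * Λ k) + x k * Real.log Z + ftrlDist η A Λ k - x k := by
    intro k hk
    have hp : ftrlDist η A Λ k = Real.exp (-η * Λ k) / Z := by simp [ftrlDist, hk, hZd]
    have hp0 : 0 < ftrlDist η A Λ k := by rw [hp]; positivity
    have hlp : Real.log (ftrlDist η A Λ k) = -η * Λ k - Real.log Z := by
      rw [hp, Real.log_div (Real.exp_pos _).ne' hZ.ne', Real.log_exp]
    rw [InformationTheory.klFun_apply]
    rcases eq_or_ne (x k) 0 with h0 | h0
    · simp [h0]
    · rw [Real.log_div h0 hp0.ne', hlp]; field_simp; ring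
  rw [Finset.sum_congr rfl hterm]
  simp only [Finset.sum_add_distrib, Finset.sum_sub_distrib, ← Finset.sum_mul, ← Finset.mul_sum,
    hxs, hps]
  have h1 : ∑ k, x k * Λ k = ∑ k ∈ A, x k * Λ k :=
    (Finset.sum_subset (Finset.subset_univ A) fun k _ hk => by simp [hxA k hk]).symm
  have h2 : ∑ k, x k * Real.log (x k) = ∑ k ∈ A, x k * Real.log (x k) :=
    (Finset.sum_subset (Finset.subset_univ A) fun k _ hk => by simp [hxA k hk]).symm
  rw [ftrlObjective, h1, h2]
  field_simp
  ring

/-- `ftrlDist` is the unique minimiser of the FTRL objective over the simplex of the arms `A`. -/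
theorem isMinOn_ftrlObjective_iff {K : ℕ} {η : ℝ} (hη : 0 < η) {A : Finset (Fin K)}
    (hA : A.Nonempty) (Λ : Fin K → ℝ) {x : Fin K → ℝ} (hx : x ∈ simplexOn A) :
    IsMinOn (ftrlObjective η Λ) (simplexOn A) x ↔ x = ftrlDist η A Λ := by
  have hpos : ∀ k ∈ A, 0 < ftrlDist η A Λ k := fun k hk => by
    have hZ : 0 < ∑ i ∈ A, Real.exp (-η * Λ i) := Finset.sum_pos (fun i _ => Real.exp_pos _) hA
    simp only [ftrlDist, hk, if_true]; positivity
  have hnn : ∀ y ∈ simplexOn A, ∀ k ∈ A,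
      0 ≤ ftrlDist η A Λ k * InformationTheory.klFun (y k / ftrlDist η A Λ k) :=
    fun y hy k hk => mul_nonneg (hpos k hk).le
      (InformationTheory.klFun_nonneg (div_nonneg (hy.1 k) (hpos k hk).le))
  have hp := ftrlDist_mem_simplexOn η hA Λ
  have hself : ∑ k ∈ A, ftrlDist η A Λ k *
      InformationTheory.klFun (ftrlDist η A Λ k / ftrlDist η A Λ k) = 0 :=
    Finset.sum_eq_zero fun k hk => by rw [div_self (hpos k hk).ne', InformationTheory.klFun_one, mul_zero]
  constructor
  · intro h
    have h1 := h hp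
    simp only [Set.mem_ofPred_eq, ftrlObjective_sub hη hA Λ hx, ftrlObjective_sub hη hA Λ hp, hself]
      at h1
    have h2 : ∑ k ∈ A, ftrlDist η A Λ k * InformationTheory.klFun (x k / ftrlDist η A Λ k) ≤ 0 := by
      have : 0 < η⁻¹ := by positivity
      by_contra! h3
      nlinarith [mul_pos this h3]
    have h3 := (Finset.sum_eq_zero_iff_of_nonneg (hnn x hx)).1
      (le_antisymm h2 (Finset.sum_nonneg (hnn x hx)))
    funext k
    by_cases hk : k ∈ A
    · have h4 := (mul_eq_zero.1 (h3 k hk)).resolve_left (hpos k hk).ne'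
      rw [InformationTheory.klFun_eq_zero_iff (div_nonneg (hx.1 k) (hpos k hk).le)] at h4
      exact (div_eq_one_iff_eq (hpos k hk).ne').1 h4
    · rw [hx.2.2 k hk, hp.2.2 k hk]
  · rintro rfl y hy
    simp only [Set.mem_ofPred_eq, ftrlObjective_sub hη hA Λ hy, ftrlObjective_sub hη hA Λ hp, hself]
    have : 0 ≤ η⁻¹ := by positivity
    have := mul_nonneg this (Finset.sum_nonneg (hnn y hy))
    linarith

/-- The memory of the learner at the beginning of a pair of rounds in epoch `e`. -/
structure State (X : Type u) (K : ℕ) where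
  /-- the sum of all loss estimates so far, for every context and arm -/
  cumLoss : X → Fin K → ℝ
  /-- the snapshot `s_e` -/
  snap : X → Fin K → ℝ
  /-- the snapshot `s_{e+1}` -/
  nextSnap : X → Fin K → ℝ
  /-- the frequency estimate for epoch `e` -/
  freq : Fin K → ℝ
  /-- the partial sum of the frequency estimate for epoch `e+1` -/
  nextFreq : Fin K → ℝ

variable [NeZero K] (E : Environment X K) (P : Params)

/-- The FTRL distribution `p` in context `c`. -/
def State.ftrl (st : State X K) (c : X) : Fin K → ℝ := ftrlDist P.η (E.active c) (st.cumLoss c)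

/-- The distribution `q` from which the arm of round `t` is drawn in context `c`. In the first epoch
this is the uniform snapshot. -/
def State.play (st : State X K) (t : ℕ) (c : X) : Fin K → ℝ :=
  if P.L ≤ t ∧ ∀ k, st.snap c k / 2 ≤ st.ftrl E P c k then st.ftrl E P c else st.snap c

/-- The arm played in round `t`. -/
def State.arm (st : State X K) (ω : ℕ → RoundData X) (t : ℕ) : Fin K :=
  sample (st.play E P t (context ω t)) (armSeed ω t)

/-- The event `S = 1` that the feedback of round `t` is accepted. -/
def State.Accepts (st : State X K) (ω : ℕ → RoundData X) (t : ℕ) : Prop :=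
  acceptSeed ω t < st.snap (context ω t) (st.arm E P ω t) /
    (2 * st.play E P t (context ω t) (st.arm E P ω t))

open Classical in
/-- The loss estimate made from round `t`, for context `c` and arm `k`. -/
def State.lossEstimate (st : State X K) (ω : ℕ → RoundData X) (t : ℕ) (c : X) (k : Fin K) : ℝ :=
  if st.arm E P ω t = k ∧ st.Accepts E P ω t then
    2 * E.loss t k c / (st.freq k + 3 / 2 * P.γ)
  else 0

/-- The initial memory. -/
def initState : State X K where
  cumLoss _ _ := 0
  snap c := uniformOnArms (E.active c)
  nextSnap c := uniformOnArms (E.active c)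
  freq _ := 0
  nextFreq _ := 0

/-- Update of the sums over the pair of rounds `{2j, 2j+1}`. In the first epoch both contexts are
used for the frequency estimate and no loss is estimated. -/
def State.observe (st : State X K) (ω : ℕ → RoundData X) (j : ℕ) : State X K :=
  if 2 * j < P.L then
    { st with
      nextFreq := fun k => st.nextFreq k
        + st.nextSnap (context ω (2 * j)) k / (2 * (P.L : ℝ))
        + st.nextSnap (context ω (2 * j + 1)) k / (2 * (P.L : ℝ)) }
  else
    { st with
      cumLoss := fun c k => st.cumLoss c k + st.lossEstimate E P ω (lossRound ω j) c k
      nextFreq := fun k => st.nextFreq k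
        + st.nextSnap (context ω (freqRound ω j)) k / (2 * ((P.L : ℝ) / 2)) }

/-- The memory after the pair of rounds `{2j, 2j+1}`. At the end of an epoch the snapshots are
shifted, the new one being the FTRL distribution that was used in that last pair. -/
def State.next (st : State X K) (ω : ℕ → RoundData X) (j : ℕ) : State X K :=
  if P.L ∣ 2 * j + 2 then
    { cumLoss := (st.observe E P ω j).cumLoss
      snap := st.nextSnap
      nextSnap := st.ftrl E P
      freq := (st.observe E P ω j).nextFreq
      nextFreq := fun _ => 0 }
  else st.observe E P ω j

/-- The memory of the learner at the beginning of the pair of rounds `{2j, 2j+1}`. -/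
def state (ω : ℕ → RoundData X) : ℕ → State X K
  | 0 => initState E
  | j + 1 => (state ω j).next E P ω j

/-- The arm `A_t` played by the algorithm in round `t`. -/
def playedArm (ω : ℕ → RoundData X) (t : ℕ) : Fin K := (state E P ω (t / 2)).arm E P ω t

/-! ### Regret -/

/-- The policies: measurable maps from contexts to active arms. -/
def Environment.Policy {X : Type u} [MeasurableSpace X] {K : ℕ} (E : Environment X K) : Type u :=
  {π : X → Fin K // Measurable π ∧ ∀ c, π c ∈ E.active c}

/-- The realised regret against the policy `π` over the rounds `0, ..., T - 1`. -/
def realizedRegret (T : ℕ) (π : E.Policy) (ω : ℕ → RoundData X) : ℝ :=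
  ∑ t ∈ Finset.range T, (E.loss t (playedArm E P ω t) (context ω t)
    - E.loss t (π.1 (context ω t)) (context ω t))

/-- The regret of the algorithm over `T` rounds; the expectation is over the contexts and the
randomness of the algorithm. -/
def regret (T : ℕ) : ℝ := ⨆ π : E.Policy, ∫ ω, realizedRegret E P T π ω ∂E.prob

/-! ### The regret is well defined -/

section Measurability

theorem measurable_sample {K : ℕ} [NeZero K] {Z : Type*} [MeasurableSpace Z] {q : Z → Fin K → ℝ}
    {u : Z → ℝ} (hq : ∀ k, Measurable fun z => q z k) (hu : Measurable u) :
    Measurable fun z => sample (q z) (u z) := by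
  classical
  let g : (Fin K → Prop) → Fin K := fun p =>
    if h : (Finset.univ.filter fun k => p k).Nonempty then
      (Finset.univ.filter fun k => p k).min' h else 0
  have hg : Measurable g := measurable_of_countable g
  have hf : Measurable fun z => fun k => u z < ∑ i ∈ Finset.Iic k, q z i := by
    refine measurable_pi_iff.2 fun k => ?_
    exact Measurable.lt hu (Finset.measurable_sum _ fun i _ => hq i)
  have : (fun z => sample (q z) (u z))
      = g ∘ fun z => fun k => u z < ∑ i ∈ Finset.Iic k, q z i := by
    funext z
    simp only [g, sample, Function.comp]
  rw [this]
  exact hg.comp hf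

variable {X : Type u} [MeasurableSpace X] {K : ℕ} [NeZero K] (E : Environment X K) (P : Params)

theorem measurable_context (t : ℕ) : Measurable fun ω : ℕ → RoundData X => context ω t := by
  unfold context; fun_prop

theorem measurable_armSeed (t : ℕ) : Measurable fun ω : ℕ → RoundData X => armSeed ω t := by
  unfold armSeed; fun_prop

theorem measurable_coin (t : ℕ) : Measurable fun ω : ℕ → RoundData X => coin ω t := by
  unfold coin; fun_prop

theorem measurable_acceptSeed (t : ℕ) : Measurable fun ω : ℕ → RoundData X => acceptSeed ω t := by
  unfold acceptSeed; fun_prop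

/-- The memory after some pairs of rounds is a measurable function of the random data. -/
structure MeasurableState (st : (ℕ → RoundData X) → State X K) : Prop where
  cumLoss : ∀ k, Measurable fun z : (ℕ → RoundData X) × X => (st z.1).cumLoss z.2 k
  snap : ∀ k, Measurable fun z : (ℕ → RoundData X) × X => (st z.1).snap z.2 k
  nextSnap : ∀ k, Measurable fun z : (ℕ → RoundData X) × X => (st z.1).nextSnap z.2 k
  freq : ∀ k, Measurable fun ω => (st ω).freq k
  nextFreq : ∀ k, Measurable fun ω => (st ω).nextFreq k

variable {E P} {st : (ℕ → RoundData X) → State X K}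

theorem MeasurableState.ftrl (h : MeasurableState st) (k : Fin K) :
    Measurable fun z : (ℕ → RoundData X) × X => (st z.1).ftrl E P z.2 k := by
  have hA : ∀ k, MeasurableSet {z : (ℕ → RoundData X) × X | k ∈ E.active z.2} := fun k =>
    measurable_snd (E.measurableSet_active k)
  unfold State.ftrl ftrlDist
  have hc := h.cumLoss
  refine Measurable.ite (hA k) (Measurable.div (by fun_prop) ?_) measurable_const
  have : (fun z : (ℕ → RoundData X) × X =>
      ∑ i ∈ E.active z.2, Real.exp (-P.η * (st z.1).cumLoss z.2 i)) = fun z =>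
      ∑ i, if i ∈ E.active z.2 then Real.exp (-P.η * (st z.1).cumLoss z.2 i) else 0 := by
    funext z; simp
  rw [this]
  exact Finset.measurable_sum _ fun i _ =>
    Measurable.ite (hA i) (by fun_prop) measurable_const

theorem MeasurableState.play (h : MeasurableState st) (t : ℕ) (k : Fin K) :
    Measurable fun z : (ℕ → RoundData X) × X => (st z.1).play E P t z.2 k := by
  have hp := h.ftrl (E := E) (P := P)
  have hs := h.snap
  have : (fun z : (ℕ → RoundData X) × X => (st z.1).play E P t z.2 k) = fun z =>
      if P.L ≤ t ∧ ∀ k, (st z.1).snap z.2 k / 2 ≤ (st z.1).ftrl E P z.2 k then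
        (st z.1).ftrl E P z.2 k else (st z.1).snap z.2 k := by
    funext z; unfold State.play; split_ifs <;> rfl
  rw [this]
  have h2 : {z : (ℕ → RoundData X) × X |
      ∀ k, (st z.1).snap z.2 k / 2 ≤ (st z.1).ftrl E P z.2 k} =
      ⋂ k, {z | (st z.1).snap z.2 k / 2 ≤ (st z.1).ftrl E P z.2 k} := by ext; simp
  have h3 : MeasurableSet {z : (ℕ → RoundData X) × X |
      ∀ k, (st z.1).snap z.2 k / 2 ≤ (st z.1).ftrl E P z.2 k} := by
    rw [h2]
    exact MeasurableSet.iInter fun k => measurableSet_le ((hs k).div_const 2) (hp k)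
  exact Measurable.ite ((MeasurableSet.const (P.L ≤ t)).inter h3) (hp k) (hs k)

theorem measurable_at_context {f : (ℕ → RoundData X) × X → ℝ} (hf : Measurable f) (t : ℕ) :
    Measurable fun ω => f (ω, context ω t) :=
  hf.comp (measurable_id.prodMk (measurable_context t))

theorem MeasurableState.arm (h : MeasurableState st) (t : ℕ) :
    Measurable fun ω => (st ω).arm E P ω t :=
  measurable_sample (fun k => measurable_at_context (h.play t k) t) (measurable_armSeed t)

theorem measurable_at_arm {Z : Type*} [MeasurableSpace Z] {f : Z → Fin K → ℝ}
    (hf : ∀ k, Measurable fun z => f z k) {a : Z → Fin K} (ha : Measurable a) :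
    Measurable fun z => f z (a z) :=
  (measurable_from_prod_countable_left hf : Measurable fun p : Z × Fin K => f p.1 p.2).comp
    (measurable_id.prodMk ha)

theorem MeasurableState.accepts (h : MeasurableState st) (t : ℕ) :
    MeasurableSet {ω | (st ω).Accepts E P ω t} := by
  have h1 : Measurable fun ω => (st ω).snap (context ω t) ((st ω).arm E P ω t) :=
    measurable_at_arm (fun k => measurable_at_context (h.snap k) t) (h.arm t)
  have h2 : Measurable fun ω => (st ω).play E P t (context ω t) ((st ω).arm E P ω t) :=
    measurable_at_arm (fun k => measurable_at_context (h.play t k) t) (h.arm t)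
  exact measurableSet_lt (measurable_acceptSeed t) (h1.div (h2.const_mul 2))

theorem MeasurableState.lossEstimate (h : MeasurableState st) (t : ℕ) (k : Fin K) :
    Measurable fun z : (ℕ → RoundData X) × X => (st z.1).lossEstimate E P z.1 t z.2 k := by
  unfold State.lossEstimate
  refine Measurable.ite (MeasurableSet.inter ?_ ?_) (Measurable.div ?_ ?_) measurable_const
  · exact ((h.arm t).comp measurable_fst) (measurableSet_singleton k)
  · exact measurable_fst (h.accepts t)
  · exact ((E.measurable_loss t k).comp measurable_snd).const_mul 2
  · exact ((h.freq k).comp measurable_fst).add_const _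

theorem MeasurableState.observe (h : MeasurableState st) (j : ℕ) :
    MeasurableState fun ω => (st ω).observe E P ω j := by
  have hn := fun k t => measurable_at_context (h.nextSnap k) t
  have hcoin : MeasurableSet {ω : ℕ → RoundData X | coin ω (2 * j) = true} :=
    measurable_coin (2 * j) (measurableSet_singleton true)
  unfold State.observe
  by_cases hj : 2 * j < P.L
  · simp only [hj, if_true]
    exact ⟨h.cumLoss, h.snap, h.nextSnap, h.freq, fun k =>
      ((h.nextFreq k).add ((hn k _).div_const _)).add ((hn k _).div_const _)⟩
  · simp only [hj, if_false]
    refine ⟨fun k => (h.cumLoss k).add ?_, h.snap, h.nextSnap, h.freq, fun k =>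
      (h.nextFreq k).add (Measurable.div_const ?_ _)⟩
    · have : (fun z : (ℕ → RoundData X) × X =>
          (st z.1).lossEstimate E P z.1 (lossRound z.1 j) z.2 k) = fun z =>
          if coin z.1 (2 * j) = true then (st z.1).lossEstimate E P z.1 (2 * j + 1) z.2 k
          else (st z.1).lossEstimate E P z.1 (2 * j) z.2 k := by
        funext z; unfold lossRound; split_ifs <;> rfl
      rw [this]
      exact Measurable.ite (measurable_fst hcoin) (h.lossEstimate _ k) (h.lossEstimate _ k)
    · have : (fun ω => (st ω).nextSnap (context ω (freqRound ω j)) k) = fun ω =>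
          if coin ω (2 * j) = true then (st ω).nextSnap (context ω (2 * j)) k
          else (st ω).nextSnap (context ω (2 * j + 1)) k := by
        funext z; unfold freqRound; split_ifs <;> rfl
      rw [this]
      exact Measurable.ite hcoin (hn k _) (hn k _)

theorem MeasurableState.next (h : MeasurableState st) (j : ℕ) :
    MeasurableState fun ω => (st ω).next E P ω j := by
  have ho := h.observe (E := E) (P := P) j
  unfold State.next
  by_cases hj : P.L ∣ 2 * j + 2
  · simp only [hj, if_true]
    exact ⟨ho.cumLoss, h.nextSnap, h.ftrl, ho.nextFreq, fun _ => measurable_const⟩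
  · simp only [hj, if_false]
    exact ho

variable (E P)

theorem measurableState_state (j : ℕ) : MeasurableState fun ω => state E P ω j := by
  induction j with
  | zero =>
    have hu : ∀ k, Measurable fun z : (ℕ → RoundData X) × X => uniformOnArms (E.active z.2) k := by
      intro k
      have hA : ∀ k, MeasurableSet {z : (ℕ → RoundData X) × X | k ∈ E.active z.2} := fun k =>
        measurable_snd (E.measurableSet_active k)
      unfold uniformOnArms
      refine Measurable.ite (hA k) (measurable_const.div ?_) measurable_const
      have : (fun z : (ℕ → RoundData X) × X => ((E.active z.2).card : ℝ)) = fun z =>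
          ∑ i, if i ∈ E.active z.2 then (1 : ℝ) else 0 := by
        funext z; simp
      rw [this]
      exact Finset.measurable_sum _ fun i _ => Measurable.ite (hA i) measurable_const
        measurable_const
    exact ⟨fun _ => measurable_const, hu, hu, fun _ => measurable_const, fun _ => measurable_const⟩
  | succ j ih => exact ih.next j

theorem measurable_playedArm (t : ℕ) : Measurable fun ω => playedArm E P ω t :=
  (measurableState_state E P (t / 2)).arm t

theorem abs_realizedRegret_le (T : ℕ) (π : E.Policy) (ω : ℕ → RoundData X) :
    |realizedRegret E P T π ω| ≤ T := by
  refine (Finset.abs_sum_le_sum_abs _ _).trans ?_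
  refine (Finset.sum_le_card_nsmul _ _ 1 fun t _ => ?_).trans (by simp)
  rw [abs_le]
  constructor <;> linarith [E.loss_nonneg t (playedArm E P ω t) (context ω t),
    E.loss_le_one t (playedArm E P ω t) (context ω t),
    E.loss_nonneg t (π.1 (context ω t)) (context ω t),
    E.loss_le_one t (π.1 (context ω t)) (context ω t)]

theorem measurable_realizedRegret (T : ℕ) (π : E.Policy) :
    Measurable (realizedRegret E P T π) := by
  unfold realizedRegret
  have hl : ∀ t k, Measurable fun ω : ℕ → RoundData X => E.loss t k (context ω t) := fun t k =>
    (E.measurable_loss t k).comp (measurable_context t)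
  refine Finset.measurable_sum _ fun t _ => Measurable.sub ?_ ?_
  · exact measurable_at_arm (hl t) (measurable_playedArm E P t)
  · exact measurable_at_arm (hl t) (π.2.1.comp (measurable_context t))

/-- The realised regret is integrable, so that its expectation is meaningful. -/
theorem integrable_realizedRegret (T : ℕ) (π : E.Policy) :
    Integrable (realizedRegret E P T π) E.prob :=
  Integrable.of_bound (measurable_realizedRegret E P T π).aestronglyMeasurable T
    (ae_of_all _ fun ω => abs_realizedRegret_le E P T π ω)

/-- There is a policy. -/
theorem nonempty_policy : Nonempty E.Policy := by
  classical
  have hg : Measurable fun p : Fin K → Prop =>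
      if h : (Finset.univ.filter fun k => p k).Nonempty then
        (Finset.univ.filter fun k => p k).min' h else 0 := measurable_of_countable _
  have hf : Measurable fun c => fun k => k ∈ E.active c :=
    measurable_pi_iff.2 fun k => measurableSet_setOfPred.1 (E.measurableSet_active k)
  refine ⟨⟨_, hg.comp hf, fun c => ?_⟩⟩
  have h : (Finset.univ.filter fun k => k ∈ E.active c).Nonempty := by
    simpa using E.active_nonempty c
  simp only [Function.comp, dif_pos h]
  exact (Finset.mem_filter.1 (Finset.min'_mem _ h)).2

/-- The supremum in the definition of the regret is over a bounded set. -/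
theorem bddAbove_expectedRegret (T : ℕ) :
    BddAbove (Set.range fun π : E.Policy => ∫ ω, realizedRegret E P T π ω ∂E.prob) := by
  refine ⟨T, ?_⟩
  rintro _ ⟨π, rfl⟩
  have := norm_integral_le_of_norm_le_const (μ := E.prob) (f := realizedRegret E P T π)
    (ae_of_all _ fun ω => abs_realizedRegret_le E P T π ω)
  rw [probReal_univ, mul_one] at this
  exact (le_abs_self _).trans this

end Measurability

end CrossLearning

end

/-! The arm of a round is drawn from a distribution `q` that depends on all past estimates. The
acceptance step removes this dependence: arm `k` is drawn and accepted with probability `q k * (s k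
/ (2 * q k)) = s k / 2`, whatever `q` is. The coin of a pair separates the round used for the losses
from the round used for the frequencies. Hence the memory of the learner has the same law as that of
an idealised algorithm, which selects from the snapshot, accepts with probability 1/2, and reads its
frequency contexts from an independent sequence (`State.Valid.lintegral_feedback`,
`integral_state_eq`). The expected regret depends only on the law of the memory and on a fresh
context (`integral_realizedRegret_le`), so the analysis is done for the idealised algorithm, where
one source of randomness can be redrawn while the other is frozen.

Snapshots are fixed an epoch in advance. The frequency contexts of an epoch therefore enter the next
epoch only through the estimate `φ` in the denominators: the next snapshot, the cumulative losses at
the start of the next epoch and all selections made in it do not depend on them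
(`idealState_agree_next`, `selection_agree`). Given everything else, `φ` is an average of `n = L /
2` independent terms whose mean is the true selection probability `f` and whose variance is at most
`f / (2 * n)` (`frequencyEstimate_epoch`).

On the good event no `φ` is much below `f` and no arm is selected much more often than expected.
Estimated losses then grow by O(L) per epoch, and `η * L` is so small that the FTRL distribution `p`
stays within a factor 2 of the snapshot (`Good.ftrl_comparable`). So the algorithm really plays `p`,
and the average of `p k` over the contexts is at most a constant times `f k`. This averaging is what
eliminates the number of contexts: the average of `∑ k, p k / (f k + γ)` is O(K).

With `a = 3 / 2 * γ`, the regret of a pair splits into three parts. The regret of `p` for the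
estimates is bounded by entropy plus second moments (`ftrl_regret`,
`integral_integral_secondMoment_le`). The bias `f / (φ + a) - 1` at the comparator is nonpositive in
expectation, because `a` outweighs the variance (`integral_policy_bias_nonpos`). The bias at the
played distribution is the delicate part: a pointwise bound of order 1/√L is too large, and `p`
itself depends on `φ`. Replacing `φ` by `f` inside `p` costs a product of two relative errors. In
what remains `p` is frozen, so the first order term integrates to zero up to the failure of the good
event, and the second order terms average to O(K(γ + 1/L)) (`ftrl_bias_le`,
`FrequencyEstimate.setIntegral_ftrl_bias_le`, `integral_play_bias_le`,
`integral_integral_play_bias_le`). Summing gives `integral_realizedRegret_le_of_regime`, and the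
tuned bound is arithmetic. -/

noncomputable section

namespace CrossLearning

/-! ### Redrawing coordinates of an i.i.d. sequence. -/

section Resampling

variable {Y : Type*} [MeasurableSpace Y] (μ : Measure Y) [IsProbabilityMeasure μ]

/-- The law of an i.i.d. sequence. -/
abbrev iidLaw : Measure (ℕ → Y) := Measure.infinitePi fun _ => μ

/-- Replacing finitely many coordinates of an i.i.d. sequence by those of an independent copy
does not change its law. -/
theorem measurePreserving_piecewise (S : Finset ℕ) :
    MeasurePreserving (fun p : (ℕ → Y) × (ℕ → Y) => S.piecewise p.2 p.1)
      ((iidLaw μ).prod (iidLaw μ)) (iidLaw μ) := by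
  classical
  have hm : Measurable fun p : (ℕ → Y) × (ℕ → Y) => S.piecewise p.2 p.1 := by
    refine measurable_pi_iff.2 fun i => ?_
    by_cases hi : i ∈ S
    · simp only [Finset.piecewise, hi, if_true]; fun_prop
    · simp only [Finset.piecewise, hi, if_false]; fun_prop
  -- A product measure is determined by finite boxes. The preimage of a box is a product of two
  -- boxes, one over the kept and one over the redrawn coordinates.
  refine ⟨hm, Measure.eq_infinitePi _ fun s t ht => ?_⟩
  rw [Measure.map_apply hm (.pi s.countable_toSet fun _ _ => ht _)]
  have : (fun p : (ℕ → Y) × (ℕ → Y) => S.piecewise p.2 p.1) ⁻¹' ((s : Set ℕ).pi t) =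
      (Set.pi ↑(s.filter (· ∉ S)) t) ×ˢ (Set.pi ↑(s.filter (· ∈ S)) t) := by
    ext p
    simp only [Set.mem_preimage, Set.mem_pi, Finset.mem_coe, Set.mem_prod, Finset.mem_filter,
      Finset.piecewise]
    constructor
    · intro h
      refine ⟨fun i hi => ?_, fun i hi => ?_⟩
      · simpa [hi.2] using h i hi.1
      · simpa [hi.2] using h i hi.1
    · rintro ⟨h1, h2⟩ i hi
      by_cases hS : i ∈ S
      · simpa [hS] using h2 i ⟨hi, hS⟩
      · simpa [hS] using h1 i ⟨hi, hS⟩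
  rw [this, Measure.prod_prod, Measure.infinitePi_pi _ (fun i _ => ht i),
    Measure.infinitePi_pi _ (fun i _ => ht i), mul_comm]
  exact Finset.prod_filter_mul_prod_filter_not s (· ∈ S) _

/-- Replacing one coordinate of an i.i.d. sequence by an independent copy does not change its
law. -/
theorem measurePreserving_update (t : ℕ) :
    MeasurePreserving (fun p : (ℕ → Y) × Y => Function.update p.1 t p.2)
      ((iidLaw μ).prod μ) (iidLaw μ) := by
  classical
  have hm : Measurable fun p : (ℕ → Y) × Y => Function.update p.1 t p.2 := by
    refine measurable_pi_iff.2 fun i => ?_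
    by_cases hi : i = t
    · subst hi; simp only [Function.update_self]; fun_prop
    · simp only [Function.update_of_ne hi]; fun_prop
  refine ⟨hm, ?_⟩
  have h := (measurePreserving_piecewise μ {t}).map_eq
  -- A single draw from `μ` is realised as coordinate `t` of a second sequence, which reduces the
  -- claim to the case of the set `{t}`.
  have h2 : ((iidLaw μ).prod μ) = ((iidLaw μ).prod (iidLaw μ)).map (Prod.map id fun ω => ω t) := by
    rw [← Measure.map_prod_map _ _ measurable_id (measurable_pi_apply t), Measure.map_id]
    congr 1
    exact (Measure.infinitePi_map_eval (fun _ => μ) t).symm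
  rw [h2, Measure.map_map hm (by fun_prop)]
  refine Eq.trans ?_ h
  congr 1
  funext p
  simp only [Function.comp, Prod.map, id]
  funext i
  by_cases hi : i = t
  · subst hi; simp
  · simp [hi, Finset.piecewise]

theorem lintegral_update {F : (ℕ → Y) → ENNReal} (hF : Measurable F) (t : ℕ) :
    ∫⁻ ω, F ω ∂(iidLaw μ) = ∫⁻ ω, ∫⁻ y, F (Function.update ω t y) ∂μ ∂(iidLaw μ) := by
  have h := measurePreserving_update μ t
  rw [← h.lintegral_comp hF, lintegral_prod (fun p : (ℕ → Y) × Y => F (Function.update p.1 t p.2))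
    (hF.comp h.measurable).aemeasurable]

theorem integral_update {F : (ℕ → Y) → ℝ} (hF : Integrable F (iidLaw μ)) (t : ℕ) :
    ∫ ω, F ω ∂(iidLaw μ) = ∫ ω, ∫ y, F (Function.update ω t y) ∂μ ∂(iidLaw μ) := by
  have h := measurePreserving_update μ t
  have h1 : Integrable (fun p : (ℕ → Y) × Y => F (Function.update p.1 t p.2))
      ((iidLaw μ).prod μ) := h.integrable_comp_of_integrable hF
  rw [← integral_prod _ h1]
  conv_lhs => rw [← h.map_eq]
  rw [integral_map h.measurable.aemeasurable]
  rw [h.map_eq]; exact hF.aestronglyMeasurable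

/-- The integral of a function bounded by a nonnegative constant, no measurability needed. -/
theorem integral_le_of_le_const {Ω : Type*} [MeasurableSpace Ω] {P : Measure Ω}
    [IsProbabilityMeasure P] {f : Ω → ℝ} {C : ℝ} (hC : 0 ≤ C) (h : ∀ ω, f ω ≤ C) :
    ∫ ω, f ω ∂P ≤ C := by
  by_cases hf : Integrable f P
  · calc ∫ ω, f ω ∂P ≤ ∫ _, C ∂P := integral_mono hf (integrable_const C) h
      _ = C := by simp
  · rw [integral_undef hf]; exact hC

end Resampling

/-! ### Tail and variance bounds for sums of independent variables. -/

section IidSums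

variable {Y : Type*} [MeasurableSpace Y] (μ : Measure Y) [IsProbabilityMeasure μ]

theorem integral_eval {h : Y → ℝ} (hm : Measurable h) (i : ℕ) :
    ∫ ω, h (ω i) ∂(iidLaw μ) = ∫ y, h y ∂μ := by
  have := (measurePreserving_eval_infinitePi (fun _ : ℕ => μ) i)
  conv_rhs => rw [← this.map_eq]
  rw [integral_map this.measurable.aemeasurable hm.aestronglyMeasurable]

theorem integrable_of_mem_Icc {Ω : Type*} [MeasurableSpace Ω] {P : Measure Ω}
    [IsProbabilityMeasure P] {f : Ω → ℝ} (hf : Measurable f) {a b : ℝ}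
    (h : ∀ ω, a ≤ f ω ∧ f ω ≤ b) : Integrable f P :=
  Integrable.of_mem_Icc a b hf.aemeasurable (ae_of_all _ fun ω => ⟨(h ω).1, (h ω).2⟩)

theorem integral_exp_sum {h : ℕ → Y → ℝ} (hm : ∀ i, Measurable (h i)) (S : Finset ℕ) :
    ∫ ω, Real.exp (∑ i ∈ S, h i (ω i)) ∂(iidLaw μ) = ∏ i ∈ S, ∫ y, Real.exp (h i y) ∂μ := by
  have hind : iIndepFun (fun i (ω : ℕ → Y) => h i (ω i)) (iidLaw μ) := iIndepFun_infinitePi hm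
  have := hind.mgf_sum (t := 1) (fun i => (by fun_prop)) S
  simp only [mgf, one_mul, Finset.sum_apply] at this
  rw [this]
  refine Finset.prod_congr rfl fun i _ => ?_
  exact integral_eval μ (h := fun y => Real.exp (h i y)) (by fun_prop) i

/-- Exponential Markov inequality for sums of independent variables. -/
theorem measure_sum_ge_le {h : ℕ → Y → ℝ} (hm : ∀ i, Measurable (h i)) {b : ℝ}
    (hb : ∀ i y, |h i y| ≤ b) (S : Finset ℕ) {m r : ℝ}
    (hexp : ∀ i ∈ S, ∫ y, Real.exp (h i y) ∂μ ≤ Real.exp m) :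
    (iidLaw μ).real {ω | r ≤ ∑ i ∈ S, h i (ω i)} ≤ Real.exp (S.card * m - r) := by
  have hs : Measurable fun ω : ℕ → Y => ∑ i ∈ S, h i (ω i) := by fun_prop
  have hint : Integrable (fun ω : ℕ → Y => Real.exp (1 * ∑ i ∈ S, h i (ω i))) (iidLaw μ) := by
    refine integrable_of_mem_Icc (a := 0) (b := Real.exp (S.card * b)) (by fun_prop) fun ω =>
      ⟨(Real.exp_pos _).le, Real.exp_le_exp.2 ?_⟩
    rw [one_mul]
    calc _ ≤ ∑ i ∈ S, b := Finset.sum_le_sum fun i _ => (le_abs_self _).trans (hb i _)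
      _ = _ := by simp
  have := measure_ge_le_exp_mul_mgf (μ := iidLaw μ) (X := fun ω => ∑ i ∈ S, h i (ω i)) (t := 1) r
    zero_le_one hint
  refine this.trans ?_
  simp only [mgf, one_mul]
  rw [integral_exp_sum μ hm S]
  calc _ ≤ Real.exp (-1 * r) * ∏ i ∈ S, Real.exp m := by
        refine mul_le_mul_of_nonneg_left (Finset.prod_le_prod
          (fun i _ => integral_nonneg fun y => (Real.exp_pos _).le) hexp) (Real.exp_pos _).le
    _ = _ := by
        rw [Finset.prod_const, ← Real.exp_nat_mul, ← Real.exp_add]; congr 1; ring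

/-- Chernoff bound at the fixed exponent -1/4. The multiplicative slack 7/8 absorbs the second order
term exactly, and the additive slack `γ / 2` leaves `γ / 8` per summand, so the tail does not depend
on `f`. -/
theorem measure_avg_lower_tail {Z : ℕ → Y → ℝ} (hm : ∀ i, Measurable (Z i))
    (h0 : ∀ i y, 0 ≤ Z i y) (h1 : ∀ i y, Z i y ≤ 1 / 2) {f γ : ℝ} (S : Finset ℕ)
    (hZ : ∀ i ∈ S, ∫ y, Z i y ∂μ = f) (hS : 0 < S.card) :
    (iidLaw μ).real {ω | (∑ i ∈ S, Z i (ω i)) / S.card < 7 / 8 * f - γ / 2} ≤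
      Real.exp (-(S.card * γ / 8)) := by
  have hexp : ∀ i ∈ S, ∫ y, Real.exp (-(1 / 4) * Z i y) ∂μ ≤ Real.exp (-(7 / 32) * f) := by
    intro i hi
    have hle : ∀ y, Real.exp (-(1 / 4) * Z i y) ≤ 1 - 7 / 32 * Z i y := by
      intro y
      have hq := h0 i y
      have hq1 := h1 i y
      set x := (1 / 4) * Z i y with hx
      -- The quadratic term is at most `Z ^ 2 / 16 ≤ Z / 32` since `Z ≤ 1 / 2`, which leaves the
      -- slope 1/4 - 1/32 = 7/32 = (1/4)(7/8).
      have hb := Real.abs_exp_sub_one_sub_id_le (x := -(1 / 4) * Z i y)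
        (by rw [abs_le]; constructor <;> linarith)
      have := (abs_le.1 hb).2
      nlinarith
    have hint : Integrable (Z i) μ := integrable_of_mem_Icc (hm i) fun y => ⟨h0 i y, h1 i y⟩
    calc _ ≤ ∫ y, (1 - 7 / 32 * Z i y) ∂μ := by
          refine integral_mono ?_ ((integrable_const _).sub (hint.const_mul _)) hle
          refine integrable_of_mem_Icc (a := 0) (b := 1) (by have := hm i; fun_prop) fun y =>
            ⟨(Real.exp_pos _).le, Real.exp_le_one_iff.2 ?_⟩
          have := h0 i y; linarith
      _ = 1 - 7 / 32 * f := by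
          rw [integral_sub (integrable_const _) (hint.const_mul _), integral_const_mul, hZ i hi]
          simp
      _ ≤ _ := by have := Real.add_one_le_exp (-(7 / 32) * f); linarith
  have hmain := measure_sum_ge_le μ (h := fun i y => -(1 / 4) * Z i y)
    (fun i => by have := hm i; fun_prop) (b := 1 / 8)
    (fun i y => by rw [abs_le]; constructor <;> linarith [h0 i y, h1 i y]) S
    (m := -(7 / 32) * f) (r := -(1 / 4) * (S.card * (7 / 8 * f - γ / 2))) hexp
  have hc : (0 : ℝ) < S.card := by exact_mod_cast hS
  refine (measureReal_mono (fun ω hω => ?_)).trans (hmain.trans (Real.exp_le_exp.2 ?_))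
  · simp only [Set.mem_ofPred_eq] at hω ⊢
    rw [div_lt_iff₀ hc] at hω
    rw [← Finset.mul_sum]
    nlinarith
  · nlinarith

/-- Chernoff bound at exponent 1/4 for indicators. On {0, 1} the exponential is below its chord,
whose slope is at most 57/200 = (1/4)(57/50). -/
theorem measure_count_upper_tail {B : ℕ → Y → ℝ} (hm : ∀ i, Measurable (B i))
    (h01 : ∀ i y, B i y = 0 ∨ B i y = 1) {f γ : ℝ} (S : Finset ℕ)
    (hB : ∀ i ∈ S, ∫ y, B i y ∂μ = f) :
    (iidLaw μ).real {ω | S.card * (57 / 50 * f + γ / 2) < ∑ i ∈ S, B i (ω i)} ≤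
      Real.exp (-(S.card * γ / 8)) := by
  have hb0 : ∀ i y, 0 ≤ B i y := fun i y => by rcases h01 i y with h | h <;> simp [h]
  have hb1 : ∀ i y, B i y ≤ 1 := fun i y => by rcases h01 i y with h | h <;> simp [h]
  have he : Real.exp (1 / 4) ≤ 1 + 57 / 200 := by
    have hb := Real.exp_bound (x := 1 / 4) (by rw [abs_le]; constructor <;> norm_num) (n := 4)
      (by norm_num)
    have := (abs_le.1 hb).2
    norm_num [Finset.sum_range_succ, Nat.factorial] at this
    linarith
  have hexp : ∀ i ∈ S, ∫ y, Real.exp (1 / 4 * B i y) ∂μ ≤ Real.exp (57 / 200 * f) := by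
    intro i hi
    have hle : ∀ y, Real.exp (1 / 4 * B i y) ≤ 1 + 57 / 200 * B i y := by
      intro y
      rcases h01 i y with h | h
      · simp [h]
      · rw [h, mul_one, mul_one]; exact he
    have hint : Integrable (B i) μ := integrable_of_mem_Icc (hm i) fun y => ⟨hb0 i y, hb1 i y⟩
    calc _ ≤ ∫ y, (1 + 57 / 200 * B i y) ∂μ := by
          refine integral_mono ?_ ((integrable_const _).add (hint.const_mul _)) hle
          refine integrable_of_mem_Icc (a := 0) (b := Real.exp (1 / 4))
            (by have := hm i; fun_prop) fun y =>
            ⟨(Real.exp_pos _).le, Real.exp_le_exp.2 ?_⟩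
          have := hb1 i y; linarith
      _ = 1 + 57 / 200 * f := by
          rw [integral_add (integrable_const _) (hint.const_mul _), integral_const_mul, hB i hi]
          simp
      _ ≤ _ := by have := Real.add_one_le_exp (57 / 200 * f); linarith
  have hmain := measure_sum_ge_le μ (h := fun i y => 1 / 4 * B i y)
    (fun i => by have := hm i; fun_prop) (b := 1 / 4)
    (fun i y => by rw [abs_le]; constructor <;> linarith [hb0 i y, hb1 i y]) S
    (m := 57 / 200 * f) (r := 1 / 4 * (S.card * (57 / 50 * f + γ / 2))) hexp
  refine (measureReal_mono (fun ω hω => ?_)).trans (hmain.trans (Real.exp_le_exp.2 ?_))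
  · simp only [Set.mem_ofPred_eq] at hω ⊢
    rw [← Finset.mul_sum]
    linarith
  · nlinarith

theorem integral_avg {Z : ℕ → Y → ℝ} (hm : ∀ i, Measurable (Z i))
    (h0 : ∀ i y, 0 ≤ Z i y) (h1 : ∀ i y, Z i y ≤ 1 / 2) {f : ℝ} (S : Finset ℕ)
    (hZ : ∀ i ∈ S, ∫ y, Z i y ∂μ = f) (hS : 0 < S.card) :
    ∫ ω, (∑ i ∈ S, Z i (ω i)) / S.card ∂(iidLaw μ) = f := by
  have hc : (0 : ℝ) < S.card := by exact_mod_cast hS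
  rw [integral_div, integral_finsetSum]
  · rw [Finset.sum_congr rfl fun i hi => (integral_eval μ (hm i) i).trans (hZ i hi)]
    simp [hc.ne']
  · exact fun i _ => integrable_of_mem_Icc (by have := hm i; fun_prop) fun ω =>
      ⟨h0 i (ω i), h1 i (ω i)⟩

/-- Since `Z ^ 2 ≤ Z / 2`, each variance is at most `f / 2`. The factor `f` matters: it later
cancels one of the denominators `f + 3 / 2 * γ`. -/
theorem integral_avg_sub_sq_le {Z : ℕ → Y → ℝ} (hm : ∀ i, Measurable (Z i))
    (h0 : ∀ i y, 0 ≤ Z i y) (h1 : ∀ i y, Z i y ≤ 1 / 2) {f : ℝ} (S : Finset ℕ)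
    (hZ : ∀ i ∈ S, ∫ y, Z i y ∂μ = f) (hS : 0 < S.card) :
    ∫ ω, ((∑ i ∈ S, Z i (ω i)) / S.card - f) ^ 2 ∂(iidLaw μ) ≤ f / (2 * S.card) := by
  have hc : (0 : ℝ) < S.card := by exact_mod_cast hS
  have hind : iIndepFun (fun i (ω : ℕ → Y) => Z i (ω i)) (iidLaw μ) := iIndepFun_infinitePi hm
  have hZm : ∀ i, Measurable fun ω : ℕ → Y => Z i (ω i) := fun i => by have := hm i; fun_prop
  have hL : ∀ i, MemLp (fun ω : ℕ → Y => Z i (ω i)) 2 (iidLaw μ) := fun i =>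
    MemLp.of_bound (hZm i).aestronglyMeasurable (1 / 2) (ae_of_all _ fun ω => by
      rw [Real.norm_eq_abs, abs_of_nonneg (h0 i _)]; exact h1 i _)
  have hvar := IndepFun.variance_sum (X := fun i (ω : ℕ → Y) => Z i (ω i)) (s := S)
    (fun i _ => hL i) (fun i _ j _ hij => hind.indepFun hij)
  have hvi : ∀ i ∈ S, Var[fun ω : ℕ → Y => Z i (ω i); iidLaw μ] ≤ f / 2 := by
    intro i hi
    refine (variance_le_expectation_sq (hZm i).aestronglyMeasurable).trans ?_
    rw [← hZ i hi, ← integral_eval μ (hm i) i, ← integral_div]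
    refine integral_mono (hL i).integrable_sq
      (((hL i).integrable (by norm_num)).div_const 2) fun ω => ?_
    simp only [Pi.pow_apply]
    nlinarith [h0 i (ω i), h1 i (ω i)]
  have hmean : ∫ ω, (∑ i ∈ S, fun ω : ℕ → Y => Z i (ω i)) ω ∂(iidLaw μ) = S.card * f := by
    have := integral_avg μ hm h0 h1 S hZ hS
    rw [integral_div, div_eq_iff hc.ne'] at this
    simp only [Finset.sum_apply]
    rw [this]; ring
  have hsm : Measurable (∑ i ∈ S, fun ω : ℕ → Y => Z i (ω i)) := by fun_prop
  rw [variance_eq_integral hsm.aemeasurable, hmean] at hvar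
  have : ∀ ω : ℕ → Y, ((∑ i ∈ S, Z i (ω i)) / S.card - f) ^ 2 =
      ((∑ i ∈ S, fun ω : ℕ → Y => Z i (ω i)) ω - S.card * f) ^ 2 / (S.card : ℝ) ^ 2 := by
    intro ω
    simp only [Finset.sum_apply]
    field_simp
  simp only [this]
  rw [integral_div, hvar, div_le_div_iff₀ (by positivity) (by positivity)]
  have hs : ∑ i ∈ S, Var[fun ω : ℕ → Y => Z i (ω i); iidLaw μ] ≤ S.card * (f / 2) := by
    calc _ ≤ ∑ i ∈ S, f / 2 := Finset.sum_le_sum hvi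
      _ = _ := by simp
  nlinarith

end IidSums

/-! ### Exponential weights: regret bound and stability. -/

section Ftrl

variable {K : ℕ}

/-- Holds because `(1 + x + x ^ 2 / 2) * (1 - x + x ^ 2 / 2) = 1 + x ^ 4 / 4 ≥ 1`, while the first
factor is at most `exp x`. -/
theorem exp_neg_le_quadratic {x : ℝ} (hx : 0 ≤ x) : Real.exp (-x) ≤ 1 - x + x ^ 2 / 2 := by
  have h := Real.quadratic_le_exp_of_nonneg hx
  have h1 : Real.exp (-x) * Real.exp x = 1 := by rw [← Real.exp_add]; simp
  have h2 : 0 < 1 - x + x ^ 2 / 2 := by nlinarith [sq_nonneg (x - 1)]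
  have h3 := Real.exp_pos (-x)
  by_contra! hlt
  nlinarith [mul_le_mul hlt.le h (by positivity) h3.le, sq_nonneg (x ^ 2), mul_pos h3 (Real.exp_pos x)]

theorem ftrlDist_nonneg (η : ℝ) (A : Finset (Fin K)) (Λ : Fin K → ℝ) (k : Fin K) :
    0 ≤ ftrlDist η A Λ k := by
  unfold ftrlDist
  split_ifs
  · exact div_nonneg (Real.exp_pos _).le (Finset.sum_nonneg fun i _ => (Real.exp_pos _).le)
  · exact le_rfl

theorem sum_ftrlDist (η : ℝ) {A : Finset (Fin K)} (hA : A.Nonempty) (Λ : Fin K → ℝ) :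
    ∑ k, ftrlDist η A Λ k = 1 := (ftrlDist_mem_simplexOn η hA Λ).2.1

/-- Reweighting of the FTRL distribution when the cumulative loss changes. -/
theorem ftrlDist_add {η : ℝ} {A : Finset (Fin K)} (hA : A.Nonempty) (Λ D : Fin K → ℝ)
    (k : Fin K) : ftrlDist η A (fun i => Λ i + D i) k =
      ftrlDist η A Λ k * Real.exp (-η * D k) / ∑ i, ftrlDist η A Λ i * Real.exp (-η * D i) := by
  have hZ : 0 < ∑ i ∈ A, Real.exp (-η * Λ i) := Finset.sum_pos (fun i _ => Real.exp_pos _) hA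
  have hsum : ∑ i, ftrlDist η A Λ i * Real.exp (-η * D i) =
      (∑ i ∈ A, Real.exp (-η * (Λ i + D i))) / ∑ i ∈ A, Real.exp (-η * Λ i) := by
    rw [Finset.sum_div, ← Finset.sum_subset (Finset.subset_univ A)]
    · refine Finset.sum_congr rfl fun i hi => ?_
      simp only [ftrlDist, hi, if_true]
      rw [mul_add, Real.exp_add]; ring
    · intro i _ hi; simp [ftrlDist, hi]
  have hZ' : 0 < ∑ i ∈ A, Real.exp (-η * (Λ i + D i)) :=
    Finset.sum_pos (fun i _ => Real.exp_pos _) hA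
  rw [hsum]
  by_cases hk : k ∈ A
  · simp only [ftrlDist, hk, if_true]
    rw [mul_add, Real.exp_add]
    field_simp
  · simp [ftrlDist, hk]

theorem sum_exp_ftrlDist_pos {η : ℝ} {A : Finset (Fin K)} (hA : A.Nonempty) (Λ D : Fin K → ℝ) :
    0 < ∑ i, ftrlDist η A Λ i * Real.exp (-η * D i) := by
  obtain ⟨k, hk⟩ := hA
  refine Finset.sum_pos' (fun i _ => mul_nonneg (ftrlDist_nonneg _ _ _ _) (Real.exp_pos _).le)
    ⟨k, Finset.mem_univ _, mul_pos ?_ (Real.exp_pos _)⟩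
  have hZ : 0 < ∑ i ∈ A, Real.exp (-η * Λ i) := Finset.sum_pos (fun i _ => Real.exp_pos _) ⟨k, hk⟩
  simp only [ftrlDist, hk, if_true]; positivity

/-- The FTRL distributions for close cumulative losses are comparable. -/
theorem ftrlDist_ratio {η M : ℝ} (hη : 0 ≤ η) {A : Finset (Fin K)} (hA : A.Nonempty)
    {Λ Λ' : Fin K → ℝ} (h0 : ∀ k, Λ k ≤ Λ' k) (h1 : ∀ k, η * (Λ' k - Λ k) ≤ M) (k : Fin K) :
    Real.exp (-M) * ftrlDist η A Λ k ≤ ftrlDist η A Λ' k ∧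
      ftrlDist η A Λ' k ≤ Real.exp M * ftrlDist η A Λ k := by
  have h := ftrlDist_add (η := η) hA Λ (fun i => Λ' i - Λ i) k
  simp only [add_sub_cancel] at h
  have hZ0 := sum_exp_ftrlDist_pos (η := η) hA Λ (fun i => Λ' i - Λ i)
  set Z := ∑ i, ftrlDist η A Λ i * Real.exp (-η * (Λ' i - Λ i)) with hZ
  have hp := ftrlDist_nonneg η A Λ
  have hs := sum_ftrlDist η hA Λ
  -- The reweighting factor of each arm and the normaliser `Z`, which is their average, both lie
  -- between `exp (-M)` and 1. Their quotient thus lies between `exp (-M)` and `exp M`.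
  have hZ1 : Z ≤ 1 := by
    rw [← hs]
    refine Finset.sum_le_sum fun i _ => mul_le_of_le_one_right (hp i) (Real.exp_le_one_iff.2 ?_)
    nlinarith [h0 i]
  have hZM : Real.exp (-M) ≤ Z := by
    calc Real.exp (-M) = ∑ i, ftrlDist η A Λ i * Real.exp (-M) := by
          rw [← Finset.sum_mul, hs, one_mul]
      _ ≤ Z := Finset.sum_le_sum fun i _ => mul_le_mul_of_nonneg_left
          (Real.exp_le_exp.2 (by linarith [h1 i])) (hp i)
  have he1 : Real.exp (-M) ≤ Real.exp (-η * (Λ' k - Λ k)) :=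
    Real.exp_le_exp.2 (by linarith [h1 k])
  have he2 : Real.exp (-η * (Λ' k - Λ k)) ≤ 1 :=
    Real.exp_le_one_iff.2 (by nlinarith [h0 k])
  have heM : Real.exp M * Real.exp (-M) = 1 := by rw [← Real.exp_add]; simp
  rw [h]
  constructor
  · rw [le_div_iff₀ hZ0]
    calc _ ≤ Real.exp (-M) * ftrlDist η A Λ k * 1 :=
          mul_le_mul_of_nonneg_left hZ1 (mul_nonneg (Real.exp_pos _).le (hp k))
      _ ≤ _ := by nlinarith [hp k]
  · rw [div_le_iff₀ hZ0]
    calc _ ≤ ftrlDist η A Λ k * 1 := mul_le_mul_of_nonneg_left he2 (hp k)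
      _ = Real.exp M * ftrlDist η A Λ k * Real.exp (-M) := by
          linear_combination (-ftrlDist η A Λ k) * heM
      _ ≤ _ := mul_le_mul_of_nonneg_left hZM (mul_nonneg (Real.exp_pos _).le (hp k))

/-- The potential is the scaled log-partition function. Its drop in one step is minus the logarithm
of the average of `exp (-η * l)` under the FTRL distribution, bounded by the quadratic estimate of
the exponential and by `log y ≤ y - 1`. Only nonnegative losses are needed, not bounded ones. -/
theorem ftrl_step {η : ℝ} (hη : 0 < η) {A : Finset (Fin K)} (hA : A.Nonempty)
    (Λ l : Fin K → ℝ) (hl : ∀ k, 0 ≤ l k) :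
    ∑ k, ftrlDist η A Λ k * l k - η / 2 * ∑ k, ftrlDist η A Λ k * l k ^ 2 ≤
      η⁻¹ * Real.log (∑ i ∈ A, Real.exp (-η * Λ i))
        - η⁻¹ * Real.log (∑ i ∈ A, Real.exp (-η * (Λ i + l i))) := by
  have hZ : 0 < ∑ i ∈ A, Real.exp (-η * Λ i) := Finset.sum_pos (fun i _ => Real.exp_pos _) hA
  have hZ' : 0 < ∑ i ∈ A, Real.exp (-η * (Λ i + l i)) :=
    Finset.sum_pos (fun i _ => Real.exp_pos _) hA
  rw [← mul_sub, ← neg_sub (Real.log _), ← Real.log_div hZ'.ne' hZ.ne']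
  have hsum : (∑ i ∈ A, Real.exp (-η * (Λ i + l i))) / ∑ i ∈ A, Real.exp (-η * Λ i) =
      ∑ i, ftrlDist η A Λ i * Real.exp (-(η * l i)) := by
    rw [Finset.sum_div, ← Finset.sum_subset (Finset.subset_univ A)]
    · refine Finset.sum_congr rfl fun i hi => ?_
      simp only [ftrlDist, hi, if_true]
      rw [mul_add, Real.exp_add]; ring_nf
    · intro i _ hi; simp [ftrlDist, hi]
  have hp := ftrlDist_nonneg η A Λ
  have hle : ∑ i, ftrlDist η A Λ i * Real.exp (-(η * l i)) ≤
      1 - η * ∑ k, ftrlDist η A Λ k * l k + η ^ 2 / 2 * ∑ k, ftrlDist η A Λ k * l k ^ 2 := by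
    rw [← sum_ftrlDist η hA Λ, Finset.mul_sum, Finset.mul_sum, ← Finset.sum_sub_distrib,
      ← Finset.sum_add_distrib]
    refine Finset.sum_le_sum fun i _ => ?_
    have := mul_le_mul_of_nonneg_left
      (exp_neg_le_quadratic (mul_nonneg hη.le (hl i))) (hp i)
    linarith
  have hlog := Real.log_le_sub_one_of_pos (div_pos hZ' hZ)
  rw [hsum] at hlog ⊢
  set W := Real.log (∑ i, ftrlDist η A Λ i * Real.exp (-(η * l i)))
  have : η * (∑ k, ftrlDist η A Λ k * l k - η / 2 * ∑ k, ftrlDist η A Λ k * l k ^ 2) ≤ -W := by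
    nlinarith
  calc _ = η⁻¹ * (η * (∑ k, ftrlDist η A Λ k * l k
        - η / 2 * ∑ k, ftrlDist η A Λ k * l k ^ 2)) := by field_simp
    _ ≤ _ := mul_le_mul_of_nonneg_left this (by positivity)

/-- The regret bound of FTRL with entropy regularisation for nonnegative losses. -/
theorem ftrl_regret {η : ℝ} (hη : 0 < η) {A : Finset (Fin K)} (Λ l : ℕ → Fin K → ℝ)
    (hl : ∀ j k, 0 ≤ l j k) (h0 : ∀ k, Λ 0 k = 0) (hΛ : ∀ j k, Λ (j + 1) k = Λ j k + l j k)
    {m : Fin K} (hm : m ∈ A) (J : ℕ) :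
    ∑ j ∈ Finset.range J, (∑ k, ftrlDist η A (Λ j) k * l j k - l j m) ≤
      Real.log K / η
        + η / 2 * ∑ j ∈ Finset.range J, ∑ k, ftrlDist η A (Λ j) k * l j k ^ 2 := by
  have hA : A.Nonempty := ⟨m, hm⟩
  have htel : ∀ J, ∑ j ∈ Finset.range J, (∑ k, ftrlDist η A (Λ j) k * l j k
      - η / 2 * ∑ k, ftrlDist η A (Λ j) k * l j k ^ 2) ≤
      η⁻¹ * Real.log (∑ i ∈ A, Real.exp (-η * Λ 0 i))
        - η⁻¹ * Real.log (∑ i ∈ A, Real.exp (-η * Λ J i)) := by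
    intro J
    induction J with
    | zero => simp
    | succ J ih =>
      rw [Finset.sum_range_succ]
      have := ftrl_step hη hA (Λ J) (l J) (hl J)
      simp only [hΛ J]
      linarith
  have hΛm : ∀ J, Λ J m = ∑ j ∈ Finset.range J, l j m := by
    intro J
    induction J with
    | zero => simp [h0]
    | succ J ih => rw [Finset.sum_range_succ, hΛ, ih]
  -- Keeping only the comparator's term of the partition function brings in its cumulative loss.
  have hlow : -η * Λ J m ≤ Real.log (∑ i ∈ A, Real.exp (-η * Λ J i)) := by
    rw [Real.le_log_iff_exp_le (Finset.sum_pos (fun i _ => Real.exp_pos _) hA)]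
    exact Finset.single_le_sum (f := fun i => Real.exp (-η * Λ J i))
      (fun i _ => (Real.exp_pos _).le) hm
  have hup : Real.log (∑ i ∈ A, Real.exp (-η * Λ 0 i)) ≤ Real.log K := by
    simp only [h0, mul_zero, Real.exp_zero, Finset.sum_const, nsmul_eq_mul, mul_one]
    refine Real.log_le_log (by exact_mod_cast hA.card_pos) ?_
    exact_mod_cast (Finset.card_le_univ A).trans (by simp)
  have h := htel J
  rw [Finset.sum_sub_distrib, ← Finset.mul_sum] at h
  rw [Finset.sum_sub_distrib, ← hΛm J, div_eq_inv_mul]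
  have hi : 0 < η⁻¹ := by positivity
  have h1 := mul_le_mul_of_nonneg_left hlow hi.le
  have h2 := mul_le_mul_of_nonneg_left hup hi.le
  have h3 : η⁻¹ * (-η * Λ J m) = -Λ J m := by field_simp
  linarith

/-- Lipschitz dependence of the FTRL distribution on the cumulative loss. -/
theorem abs_ftrlDist_sub_le {η : ℝ} {A : Finset (Fin K)} (hA : A.Nonempty)
    {Λ D ε : Fin K → ℝ} (hε : ∀ k, |η * D k| ≤ ε k) (hε1 : ∀ k, ε k ≤ 1 / 2) (k : Fin K) :
    |ftrlDist η A (fun i => Λ i + D i) k - ftrlDist η A Λ k| ≤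
        3 * ftrlDist η A Λ k * (ε k + ∑ i, ftrlDist η A Λ i * ε i) ∧
      ftrlDist η A (fun i => Λ i + D i) k ≤ 3 * ftrlDist η A Λ k := by
  rw [ftrlDist_add hA]
  have hZ0 := sum_exp_ftrlDist_pos (η := η) hA Λ D
  have hp := ftrlDist_nonneg η A Λ
  have hs := sum_ftrlDist η hA Λ
  set p := ftrlDist η A Λ with hpd
  set Z := ∑ i, p i * Real.exp (-η * D i) with hZ
  have hsq : Real.exp (1 / 2) * Real.exp (1 / 2) ≤ 3 := by
    rw [← Real.exp_add]; norm_num; exact Real.exp_one_lt_three.le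
  have hE0 := Real.exp_pos (1 / 2)
  set E := Real.exp (1 / 2) with hE
  have hEinv : Real.exp (-(1 / 2)) * E = 1 := by rw [hE, ← Real.exp_add]; simp
  -- One factor `E = exp (1 / 2)` comes from the Lipschitz bound for the exponential and one from
  -- `Z⁻¹`. Their product e is rounded up to 3.
  have hd : ∀ i, |Real.exp (-η * D i) - 1| ≤ E * ε i := by
    intro i
    have h1 := (hε i)
    have h2 : |η * D i| ≤ 1 / 2 := h1.trans (hε1 i)
    obtain ⟨h3, h4⟩ := abs_le.1 h2
    set x := -η * D i with hx
    have hx' : η * D i = -x := by rw [hx]; ring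
    rw [hx'] at h1 h3 h4
    rw [abs_neg] at h1
    have h5 := Real.add_one_le_exp x
    have h6 := Real.add_one_le_exp (-x)
    have h7 : Real.exp x * Real.exp (-x) = 1 := by rw [← Real.exp_add]; simp
    have h8 : Real.exp x ≤ E := Real.exp_le_exp.2 (by linarith)
    have hE1 : 1 ≤ E := Real.one_le_exp (by norm_num)
    have h9 := abs_nonneg x
    rw [abs_le]
    constructor
    · nlinarith [neg_abs_le x]
    · have : Real.exp x - 1 ≤ x * Real.exp x := by nlinarith [Real.exp_pos x]
      have : x * Real.exp x ≤ |x| * E := by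
        calc _ ≤ |x| * Real.exp x := mul_le_mul_of_nonneg_right (le_abs_self x) (Real.exp_pos x).le
          _ ≤ _ := mul_le_mul_of_nonneg_left h8 h9
      nlinarith
  have hZd : |Z - 1| ≤ E * ∑ i, p i * ε i := by
    have : Z - 1 = ∑ i, p i * (Real.exp (-η * D i) - 1) := by
      simp only [mul_sub, mul_one, Finset.sum_sub_distrib, hs]; rfl
    rw [this, Finset.mul_sum]
    refine (Finset.abs_sum_le_sum_abs _ _).trans (Finset.sum_le_sum fun i _ => ?_)
    rw [abs_mul, abs_of_nonneg (hp i)]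
    nlinarith [hd i, hp i, mul_le_mul_of_nonneg_left (hd i) (hp i)]
  have hZlow : Real.exp (-(1 / 2)) ≤ Z := by
    calc Real.exp (-(1 / 2)) = ∑ i, p i * Real.exp (-(1 / 2)) := by
          rw [← Finset.sum_mul, hs, one_mul]
      _ ≤ Z := Finset.sum_le_sum fun i _ => mul_le_mul_of_nonneg_left
          (Real.exp_le_exp.2 (by have := (abs_le.1 ((hε i).trans (hε1 i))).2; linarith)) (hp i)
  have hEZ : 1 ≤ E * Z := by nlinarith
  have hZinv : Z⁻¹ ≤ E := by
    rw [inv_le_iff_one_le_mul₀ hZ0]; exact hEZ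
  have hup : Real.exp (-η * D k) ≤ E :=
    Real.exp_le_exp.2 (by have := (abs_le.1 ((hε k).trans (hε1 k))).1; linarith)
  constructor
  · have h1 : p k * Real.exp (-η * D k) / Z - p k =
        p k * ((Real.exp (-η * D k) - 1) - (Z - 1)) * Z⁻¹ := by field_simp; ring
    have hb : |(Real.exp (-η * D k) - 1) - (Z - 1)| ≤ E * (ε k + ∑ i, p i * ε i) :=
      (abs_sub _ _).trans (by have := hd k; linarith)
    have hb0 : 0 ≤ ε k + ∑ i, p i * ε i := by
      have := (abs_nonneg _).trans hb
      nlinarith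
    rw [h1, abs_mul, abs_mul, abs_of_nonneg (hp k), abs_of_pos (inv_pos.2 hZ0)]
    calc _ ≤ p k * (E * (ε k + ∑ i, p i * ε i)) * E :=
          mul_le_mul (mul_le_mul_of_nonneg_left hb (hp k)) hZinv (inv_pos.2 hZ0).le
            (mul_nonneg (hp k) (mul_nonneg hE0.le hb0))
      _ = (E * E) * (p k * (ε k + ∑ i, p i * ε i)) := by ring
      _ ≤ 3 * (p k * (ε k + ∑ i, p i * ε i)) :=
          mul_le_mul_of_nonneg_right hsq (mul_nonneg (hp k) hb0)
      _ = _ := by ring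
  · rw [div_eq_mul_inv]
    calc _ ≤ p k * E * E := mul_le_mul (mul_le_mul_of_nonneg_left hup (hp k)) hZinv
          (inv_pos.2 hZ0).le (mul_nonneg (hp k) hE0.le)
      _ = (E * E) * p k := by ring
      _ ≤ _ := mul_le_mul_of_nonneg_right hsq (hp k)

end Ftrl

/-! ### Deterministic expansion of the bias in the frequency error. -/

section Bias

variable {K : ℕ}

/-- Relative bias of the inverse of an estimate `φ` of `f`, second order expansion. -/
theorem div_estimate_sub_one_le {f φ a : ℝ} (hf : 0 ≤ f) (ha : 0 < a)
    (hlow : 2 / 3 * (f + a) ≤ φ + a) :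
    f / (φ + a) - 1 ≤ -(a / (f + a)) - f * (φ - f) / (f + a) ^ 2
      + 3 / 2 * (f * (φ - f) ^ 2 / (f + a) ^ 3) := by
  have hy : 0 < f + a := by linarith
  have hx : 0 < φ + a := by linarith
  -- An exact identity: expansion around `φ = f` with explicit remainder. Only the factor `(φ +
  -- a)⁻¹` of the remainder is estimated.
  have h1 : f / (φ + a) - 1 = -(a / (f + a)) - f * (φ - f) / (f + a) ^ 2
      + f * (φ - f) ^ 2 / (f + a) ^ 2 * (φ + a)⁻¹ := by
    field_simp
    ring
  have h2 : (φ + a)⁻¹ ≤ 3 / 2 * (f + a)⁻¹ := by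
    rw [inv_eq_one_div, inv_eq_one_div, div_le_iff₀ hx]
    have : 3 / 2 * (1 / (f + a)) * (φ + a) = 3 / 2 * ((φ + a) / (f + a)) := by ring
    rw [this]
    have : 2 / 3 ≤ (φ + a) / (f + a) := by rw [le_div_iff₀ hy]; exact hlow
    linarith
  rw [h1]
  have h3 : 0 ≤ f * (φ - f) ^ 2 / (f + a) ^ 2 := by positivity
  have h4 := mul_le_mul_of_nonneg_left h2 h3
  have h5 : f * (φ - f) ^ 2 / (f + a) ^ 2 * (3 / 2 * (f + a)⁻¹) =
      3 / 2 * (f * (φ - f) ^ 2 / (f + a) ^ 3) := by field_simp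
  linarith

/-- Pointwise bound of the bias of the loss estimates for the FTRL distribution, in which the
frequency estimates `φ` are replaced by the true frequencies `f` up to second order terms. -/
theorem ftrl_bias_le {η a : ℝ} (hη : 0 < η) (ha : 0 < a) {A : Finset (Fin K)} (hA : A.Nonempty)
    {Λ N f φ g : Fin K → ℝ} (hf : ∀ k, 0 ≤ f k) (hN : ∀ k, 0 ≤ N k)
    (hN1 : ∀ k, η * (N k / (f k + a)) ≤ 1 / 3)
    (hg0 : ∀ k, 0 ≤ g k) (hg2 : ∀ k, g k ≤ 2)
    (hlow : ∀ k, 2 / 3 * (f k + a) ≤ φ k + a) :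
    ∑ k, ftrlDist η A (fun i => Λ i + N i / (φ i + a)) k * (g k * (1 - f k / (φ k + a))) ≤
      ∑ k, ftrlDist η A (fun i => Λ i + N i / (f i + a)) k *
        (g k * ((φ k - f k) / (f k + a)) + 6 * ((φ k - f k) / (f k + a)) ^ 2
          + 9 * (a / (f k + a))) := by
  have hy : ∀ k, 0 < f k + a := fun k => by linarith [hf k]
  have hx : ∀ k, 0 < φ k + a := fun k => by linarith [hlow k, hy k]
  -- `δ` is the relative error of the regularised frequency, so `φ + a = (f + a) * (1 + δ)`, and
  -- `hlow` says that `δ ≥ -1/3`.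
  set δ : Fin K → ℝ := fun k => (φ k - f k) / (f k + a) with hδ
  have hδx : ∀ k, φ k + a = (f k + a) * (1 + δ k) := fun k => by
    simp only [hδ]; have := hy k; field_simp; ring
  have hδ1 : ∀ k, -(1 / 3) ≤ δ k := fun k => by
    have h1 := hlow k; rw [hδx k] at h1; have := hy k; nlinarith
  have hfg : ∀ k, 0 ≤ 1 + δ k := fun k => by linarith [hδ1 k]
  set D : Fin K → ℝ := fun i => N i / (φ i + a) - N i / (f i + a) with hD
  have hDe : ∀ k, η * D k = -(η * (N k / (f k + a))) * (δ k / (1 + δ k)) := fun k => by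
    have h1 : (1 + δ k) ≠ 0 := by linarith [hδ1 k]
    have h2 := (hy k).ne'
    simp only [hD]; rw [hδx k]; field_simp; ring
  have hΛ : (fun i => Λ i + N i / (φ i + a)) = fun i => (Λ i + N i / (f i + a)) + D i := by
    funext i; simp only [hD]; ring
  -- The change of the exponent is at most 1/3 times `|δ| / (1 + δ)`. This quotient is at most `3 /
  -- 2 * |δ|`, which gives proportionality to `δ`, and at most 1, which covers large overestimates.
  have hDb : ∀ k, |η * D k| ≤ min (|δ k| / 2) (1 / 2) := by
    intro k
    have h1 : 0 < 1 + δ k := by linarith [hδ1 k]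
    have h0 : 0 ≤ η * (N k / (f k + a)) := mul_nonneg hη.le (div_nonneg (hN k) (hy k).le)
    rw [hDe, abs_mul, abs_neg, abs_of_nonneg h0, abs_div, abs_of_pos h1]
    have h2 : |δ k| / (1 + δ k) ≤ 3 / 2 * |δ k| := by
      rw [div_le_iff₀ h1]; nlinarith [abs_nonneg (δ k), hδ1 k]
    have h3 : |δ k| / (1 + δ k) ≤ 1 := by
      rw [div_le_one h1, abs_le]; constructor <;> linarith [hδ1 k]
    have h4 : 0 ≤ |δ k| / (1 + δ k) := by positivity
    refine le_min ?_ ?_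
    · calc _ ≤ 1 / 3 * (3 / 2 * |δ k|) := mul_le_mul (hN1 k) h2 h4 (by norm_num)
        _ ≤ _ := by linarith [abs_nonneg (δ k)]
    · calc _ ≤ 1 / 3 * 1 := mul_le_mul (hN1 k) h3 h4 (by norm_num)
        _ ≤ _ := by norm_num
  have hp0 := ftrlDist_nonneg η A (fun i => Λ i + N i / (f i + a))
  have hs := sum_ftrlDist η hA (fun i => Λ i + N i / (f i + a))
  rw [hΛ]
  have hcmp := fun k => abs_ftrlDist_sub_le hA (Λ := fun i => Λ i + N i / (f i + a))
    hDb (fun k => min_le_right _ _) k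
  have hp'0 := ftrlDist_nonneg η A (fun i => (Λ i + N i / (f i + a)) + D i)
  set p := ftrlDist η A (fun i => Λ i + N i / (f i + a)) with hp
  set p' := ftrlDist η A (fun i => (Λ i + N i / (f i + a)) + D i) with hp'
  set m := ∑ i, p i * |δ i| with hm
  -- Cauchy–Schwarz for the probability vector `p`: the normalisation effect `m` of the perturbation
  -- is also of second order once it is multiplied by `δ`.
  have hmsq : m ^ 2 ≤ ∑ i, p i * δ i ^ 2 := by
    have := Finset.sum_mul_sq_le_sq_mul_sq Finset.univ (fun i => Real.sqrt (p i))
      (fun i => Real.sqrt (p i) * |δ i|)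
    have e1 : ∀ i, Real.sqrt (p i) * (Real.sqrt (p i) * |δ i|) = p i * |δ i| := fun i => by
      rw [← mul_assoc, Real.mul_self_sqrt (hp0 i)]
    have e2 : ∀ i, (Real.sqrt (p i) * |δ i|) ^ 2 = p i * δ i ^ 2 := fun i => by
      rw [mul_pow, Real.sq_sqrt (hp0 i), sq_abs]
    simp only [e1, e2, Real.sq_sqrt (hp0 _), hs, one_mul] at this
    exact this
  have hm0 : 0 ≤ m := Finset.sum_nonneg fun i _ => mul_nonneg (hp0 i) (abs_nonneg _)
  have hmin : ∑ i, p i * min (|δ i| / 2) (1 / 2) ≤ m / 2 := by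
    rw [hm, Finset.sum_div]
    refine Finset.sum_le_sum fun i _ => ?_
    have := mul_le_mul_of_nonneg_left (min_le_left (|δ i| / 2) (1 / 2)) (hp0 i)
    linarith
  have hterm : ∀ k, p' k * (g k * (1 - f k / (φ k + a))) ≤
      p k * (g k * δ k + 3 * δ k ^ 2 + 9 * (a / (f k + a))) + 3 * m * (p k * |δ k|) := by
    intro k
    have hxk := hx k
    have hyk := hy k
    have h1 : 1 - f k / (φ k + a) = (φ k - f k) / (φ k + a) + a / (φ k + a) := by
      field_simp; ring
    have h2 : (φ k - f k) / (φ k + a) ≤ δ k := by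
      have h3 : φ k - f k = (f k + a) * δ k := by simp only [hδ]; field_simp
      rw [div_le_iff₀ hxk, hδx k, h3]
      nlinarith [mul_nonneg hyk.le (sq_nonneg (δ k))]
    have h3 : a / (φ k + a) ≤ 3 / 2 * (a / (f k + a)) := by
      rw [div_le_iff₀ hxk]
      have e : 3 / 2 * (a / (f k + a)) * (φ k + a) = 3 / 2 * ((φ k + a) * (a / (f k + a))) := by
        ring
      have e2 := mul_le_mul_of_nonneg_right (hlow k) (div_pos ha hyk).le
      have e3 : 2 / 3 * (f k + a) * (a / (f k + a)) = 2 / 3 * a := by field_simp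
      linarith
    have hay : 0 ≤ a / (f k + a) := by positivity
    obtain ⟨hc1, hc2⟩ := hcmp k
    have h4 : |p' k - p k| ≤ 3 / 2 * p k * (|δ k| + m) := by
      refine hc1.trans ?_
      have e1 := min_le_left (|δ k| / 2) (1 / 2)
      have e2 := mul_le_mul_of_nonneg_left (add_le_add e1 hmin) (hp0 k)
      linarith
    -- Exchanging `p'` for `p` in the first order term costs a product of two relative errors.
    have h5 : (p' k - p k) * (g k * δ k) ≤ 3 / 2 * p k * (|δ k| + m) * (2 * |δ k|) := by
      refine (le_abs_self _).trans ?_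
      rw [abs_mul]
      refine mul_le_mul h4 ?_ (abs_nonneg _) ((abs_nonneg _).trans h4)
      rw [abs_mul, abs_of_nonneg (hg0 k)]
      exact mul_le_mul_of_nonneg_right (hg2 k) (abs_nonneg _)
    -- The regularisation part needs only `p' ≤ 3 * p`. With `g ≤ 2` and `a / (φ + a) ≤ 3 / 2 * (a /
    -- (f + a))` this gives the constant 3·2·(3/2) = 9.
    have h6 : p' k * (g k * (1 - f k / (φ k + a))) ≤
        p' k * (g k * δ k) + 3 * p k * (2 * (3 / 2 * (a / (f k + a)))) := by
      rw [h1, mul_add (g k), mul_add]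
      refine add_le_add ?_ ?_
      · exact mul_le_mul_of_nonneg_left (mul_le_mul_of_nonneg_left h2 (hg0 k)) (hp'0 k)
      · exact mul_le_mul hc2 (mul_le_mul (hg2 k) h3 (by positivity) (by norm_num))
          (mul_nonneg (hg0 k) (by positivity)) (by have := hp0 k; positivity)
    have h7 : 0 ≤ p k * (a / (f k + a)) := mul_nonneg (hp0 k) hay
    have h8 : |δ k| * |δ k| = δ k ^ 2 := by rw [← sq, sq_abs]
    have h9 : 3 / 2 * p k * (|δ k| + m) * (2 * |δ k|) =
        3 * (p k * δ k ^ 2) + 3 * m * (p k * |δ k|) := by rw [← h8]; ring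
    nlinarith
  calc _ ≤ ∑ k, (p k * (g k * δ k + 3 * δ k ^ 2 + 9 * (a / (f k + a)))
        + 3 * m * (p k * |δ k|)) := Finset.sum_le_sum fun k _ => hterm k
    _ = ∑ k, p k * (g k * δ k + 3 * δ k ^ 2 + 9 * (a / (f k + a))) + 3 * m ^ 2 := by
        rw [Finset.sum_add_distrib, ← Finset.mul_sum, ← hm]; ring
    _ ≤ ∑ k, p k * (g k * δ k + 3 * δ k ^ 2 + 9 * (a / (f k + a)))
        + 3 * ∑ i, p i * δ i ^ 2 := by linarith
    _ = _ := by
        rw [Finset.mul_sum, ← Finset.sum_add_distrib]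
        exact Finset.sum_congr rfl fun k _ => by ring

end Bias

/-! ### The bias averaged over a random frequency estimate. -/

section ExpectedBias

variable {K : ℕ} {Ω : Type*} [MeasurableSpace Ω] {P : Measure Ω} [IsProbabilityMeasure P]

/-- Frequency estimates `φ` of `f` with small variance that are unlikely to underestimate. -/
structure FrequencyEstimate (P : Measure Ω) (φ : Ω → Fin K → ℝ) (f : Fin K → ℝ)
    (γ v θ : ℝ) : Prop where
  measurable : ∀ k, Measurable fun ω => φ ω k
  nonneg : ∀ ω k, 0 ≤ φ ω k
  le_half : ∀ ω k, φ ω k ≤ 1 / 2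
  integral_eq : ∀ k, ∫ ω, φ ω k ∂P = f k
  integral_sq_le : ∀ k, ∫ ω, (φ ω k - f k) ^ 2 ∂P ≤ f k * v
  measure_bad_le : P.real {ω | ∀ k, 7 / 8 * f k - γ / 2 ≤ φ ω k}ᶜ ≤ θ

variable {φ : Ω → Fin K → ℝ} {f : Fin K → ℝ} {γ v θ : ℝ}

namespace FrequencyEstimate

theorem integrable (h : FrequencyEstimate P φ f γ v θ) (k : Fin K) :
    Integrable (fun ω => φ ω k) P :=
  integrable_of_mem_Icc (h.measurable k) fun ω => ⟨h.nonneg ω k, h.le_half ω k⟩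

theorem true_nonneg (h : FrequencyEstimate P φ f γ v θ) (k : Fin K) : 0 ≤ f k := by
  rw [← h.integral_eq k]; exact integral_nonneg fun ω => h.nonneg ω k

theorem true_le_half (h : FrequencyEstimate P φ f γ v θ) (k : Fin K) : f k ≤ 1 / 2 := by
  rw [← h.integral_eq k]
  exact integral_le_of_le_const (by norm_num) fun ω => h.le_half ω k

theorem integrable_sq (h : FrequencyEstimate P φ f γ v θ) (k : Fin K) :
    Integrable (fun ω => (φ ω k - f k) ^ 2) P := by
  have := h.measurable k
  refine integrable_of_mem_Icc (a := 0) (b := 1) (by fun_prop) fun ω => ⟨sq_nonneg _, ?_⟩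
  nlinarith [h.nonneg ω k, h.le_half ω k, h.true_nonneg k, h.true_le_half k]

theorem measurableSet_good (h : FrequencyEstimate P φ f γ v θ) :
    MeasurableSet {ω | ∀ k, 7 / 8 * f k - γ / 2 ≤ φ ω k} := by
  have : {ω | ∀ k, 7 / 8 * f k - γ / 2 ≤ φ ω k} =
      ⋂ k, {ω | 7 / 8 * f k - γ / 2 ≤ φ ω k} := by ext; simp
  rw [this]
  exact MeasurableSet.iInter fun k => measurableSet_le measurable_const (h.measurable k)

/-- Unbiasedness turns the first order term on a set into minus the same term on the complement,
which is small when the complement is the bad event. -/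
theorem setIntegral_sub_eq (h : FrequencyEstimate P φ f γ v θ) (k : Fin K) {G : Set Ω}
    (hG : MeasurableSet G) :
    ∫ ω in G, (φ ω k - f k) ∂P = -∫ ω in Gᶜ, (φ ω k - f k) ∂P := by
  have hi := (h.integrable k).sub (integrable_const (f k))
  have h1 := integral_add_compl hG hi
  have h2 : ∫ ω, (φ ω k - f k) ∂P = 0 := by
    rw [integral_sub (h.integrable k) (integrable_const _), h.integral_eq]; simp
  simp only [Pi.sub_apply] at h1
  linarith

theorem setIntegral_const_le {G : Set Ω} {X : Ω → ℝ} (hX : Integrable X P)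
    {c : ℝ} (h : ∀ ω, X ω ≤ c) : ∫ ω in G, X ω ∂P ≤ c * P.real G := by
  calc _ ≤ ∫ ω in G, c ∂P := setIntegral_mono hX.integrableOn (integrable_const c) h
    _ = _ := by simp [mul_comm]

theorem setIntegral_sq_le (h : FrequencyEstimate P φ f γ v θ) (k : Fin K) (G : Set Ω) :
    ∫ ω in G, (φ ω k - f k) ^ 2 ∂P ≤ f k * v :=
  (setIntegral_le_integral (h.integrable_sq k) (ae_of_all _ fun _ => sq_nonneg _)).trans
    (h.integral_sq_le k)

/-- The loss estimates of a fixed arm are optimistic in expectation. -/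
theorem setIntegral_div_sub_one_nonpos (h : FrequencyEstimate P φ f γ v θ) (hγ : 0 < γ)
    (hγ1 : γ ≤ 1) (hv0 : 0 ≤ v) (hv : v ≤ γ / 32) (hθ : θ ≤ γ / 8) (k : Fin K) :
    ∫ ω in {ω | ∀ k, 7 / 8 * f k - γ / 2 ≤ φ ω k}, (f k / (φ ω k + 3 / 2 * γ) - 1) ∂P ≤ 0 := by
  set G := {ω | ∀ k, 7 / 8 * f k - γ / 2 ≤ φ ω k} with hGd
  have hG : MeasurableSet G := h.measurableSet_good
  have hf := h.true_nonneg k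
  set a := 3 / 2 * γ with ha
  have ha0 : 0 < a := by positivity
  have hy : 0 < f k + a := by linarith
  have hm := h.measurable k
  have hint1 : Integrable (fun ω => f k / (φ ω k + a) - 1) P := by
    refine integrable_of_mem_Icc (a := -1) (b := f k / a) (by fun_prop) fun ω => ?_
    have := h.nonneg ω k
    have h1 : f k / (φ ω k + a) ≤ f k / a :=
      div_le_div_of_nonneg_left hf ha0 (by linarith)
    have h2 : 0 ≤ f k / (φ ω k + a) := by positivity
    constructor <;> linarith
  have hi1 : Integrable (fun ω => f k * (φ ω k - f k) / (f k + a) ^ 2) P :=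
    (((h.integrable k).sub (integrable_const _)).const_mul _).div_const _
  have hi2 : Integrable (fun ω => 3 / 2 * (f k * (φ ω k - f k) ^ 2 / (f k + a) ^ 3)) P :=
    (((h.integrable_sq k).const_mul _).div_const _).const_mul _
  have hle : ∫ ω in G, (f k / (φ ω k + a) - 1) ∂P ≤
      ∫ ω in G, (-(a / (f k + a)) - f k * (φ ω k - f k) / (f k + a) ^ 2
        + 3 / 2 * (f k * (φ ω k - f k) ^ 2 / (f k + a) ^ 3)) ∂P := by
    refine setIntegral_mono_on hint1.integrableOn
      (((integrable_const _).sub hi1).add hi2).integrableOn hG fun ω hω => ?_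
    refine div_estimate_sub_one_le hf ha0 ?_
    have := hω k
    linarith
  refine hle.trans ?_
  have hi0 : Integrable (fun ω => -(a / (f k + a)) - f k * (φ ω k - f k) / (f k + a) ^ 2) P :=
    (integrable_const _).sub hi1
  rw [integral_add hi0.integrableOn hi2.integrableOn,
    integral_sub (integrable_const _) hi1.integrableOn, integral_div, integral_const_mul,
    integral_const_mul, integral_div, integral_const_mul, h.setIntegral_sub_eq k hG]
  have hbad : ∫ ω in Gᶜ, (φ ω k - f k) ∂P ≤ 1 / 2 * θ := by
    refine (setIntegral_const_le ((h.integrable k).sub (integrable_const _))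
      (c := 1 / 2) fun ω => ?_).trans ?_
    · simp only [Pi.sub_apply]; linarith [h.le_half ω k]
    · exact mul_le_mul_of_nonneg_left h.measure_bad_le (by norm_num)
  have hsq := h.setIntegral_sq_le k G
  have hPG : 1 - θ ≤ P.real G := by
    have := probReal_compl_eq_one_sub (μ := P) hG
    have := h.measure_bad_le
    linarith
  simp only [integral_const, smul_eq_mul, measureReal_restrict_apply_univ]
  set y := f k + a with hyd
  have hfy : f k ≤ y := by linarith
  -- On the bad event `φ - f ≤ 1 / 2`, so the first order term contributes at most `θ / (2 * y)`.
  have t1 : f k * -(∫ ω in Gᶜ, (φ ω k - f k) ∂P) / y ^ 2 ≥ -(1 / 2 * θ / y) := by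
    have hθ0 : 0 ≤ θ := measureReal_nonneg.trans h.measure_bad_le
    have e1 : f k * (∫ ω in Gᶜ, (φ ω k - f k) ∂P) / y ^ 2 ≤ y * (1 / 2 * θ) / y ^ 2 := by
      refine div_le_div_of_nonneg_right ?_ (by positivity)
      calc _ ≤ f k * (1 / 2 * θ) := mul_le_mul_of_nonneg_left hbad hf
        _ ≤ _ := mul_le_mul_of_nonneg_right hfy (by positivity)
    have e2 : y * (1 / 2 * θ) / y ^ 2 = 1 / 2 * θ / y := by field_simp
    have e3 : f k * -(∫ ω in Gᶜ, (φ ω k - f k) ∂P) / y ^ 2 =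
      -(f k * (∫ ω in Gᶜ, (φ ω k - f k) ∂P) / y ^ 2) := by ring
    linarith
  have t2 : f k * (∫ ω in G, (φ ω k - f k) ^ 2 ∂P) / y ^ 3 ≤ v / y := by
    have e1 : f k * (∫ ω in G, (φ ω k - f k) ^ 2 ∂P) / y ^ 3 ≤ y * (y * v) / y ^ 3 := by
      refine div_le_div_of_nonneg_right ?_ (by positivity)
      calc _ ≤ f k * (f k * v) := mul_le_mul_of_nonneg_left hsq hf
        _ ≤ _ := mul_le_mul hfy (mul_le_mul_of_nonneg_right hfy hv0) (by positivity) hy.le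
    have e2 : y * (y * v) / y ^ 3 = v / y := by field_simp
    linarith
  have t3 : P.real G * -(a / y) ≤ -((1 - θ) * a / y) := by
    have : (1 - θ) * (a / y) ≤ P.real G * (a / y) :=
      mul_le_mul_of_nonneg_right hPG (by positivity)
    have e : (1 - θ) * a / y = (1 - θ) * (a / y) := by ring
    rw [e]; linarith
  have t4 : -((1 - θ) * a / y) + 1 / 2 * θ / y + 3 / 2 * (v / y) =
      (-((1 - θ) * a) + 1 / 2 * θ + 3 / 2 * v) / y := by ring
  -- Here `(1 - θ) * a ≥ (7/8)(3/2) γ`, whereas the error terms are at most `γ / 16 + 3 * γ / 64`.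
  have t5 : (-((1 - θ) * a) + 1 / 2 * θ + 3 / 2 * v) / y ≤ 0 := by
    refine div_nonpos_of_nonpos_of_nonneg ?_ hy.le
    nlinarith
  linarith

/-- Expected bias of the loss estimates for the FTRL distribution. -/
theorem setIntegral_ftrl_bias_le (h : FrequencyEstimate P φ f γ v θ) {η : ℝ} (hη : 0 < η)
    (hγ : 0 < γ) (hv0 : 0 ≤ v) {A : Finset (Fin K)} (hA : A.Nonempty)
    {Λ N g : Fin K → ℝ} (hN : ∀ k, 0 ≤ N k)
    (hN1 : ∀ k, η * (N k / (f k + 3 / 2 * γ)) ≤ 1 / 3)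
    (hg0 : ∀ k, 0 ≤ g k) (hg2 : ∀ k, g k ≤ 2) :
    ∫ ω in {ω | ∀ k, 7 / 8 * f k - γ / 2 ≤ φ ω k},
        ∑ k, ftrlDist η A (fun i => Λ i + N i / (φ ω i + 3 / 2 * γ)) k *
          (g k * (1 - f k / (φ ω k + 3 / 2 * γ))) ∂P ≤
      ∑ k, ftrlDist η A (fun i => Λ i + N i / (f i + 3 / 2 * γ)) k *
        (2 * θ + (6 * v + 27 / 2 * γ) / (f k + 3 / 2 * γ)) := by
  set G := {ω | ∀ k, 7 / 8 * f k - γ / 2 ≤ φ ω k} with hGd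
  have hG : MeasurableSet G := h.measurableSet_good
  have hf := h.true_nonneg
  have hθ0 : 0 ≤ θ := measureReal_nonneg.trans h.measure_bad_le
  have hp0 := ftrlDist_nonneg η A (fun i => Λ i + N i / (f i + 3 / 2 * γ))
  set p := ftrlDist η A (fun i => Λ i + N i / (f i + 3 / 2 * γ)) with hp
  set a := 3 / 2 * γ with ha
  have ha0 : 0 < a := by positivity
  have hy : ∀ k, 0 < f k + a := fun k => by linarith [hf k]
  have hRHS : 0 ≤ ∑ k, p k * (2 * θ + (6 * v + 27 / 2 * γ) / (f k + a)) :=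
    Finset.sum_nonneg fun k _ => mul_nonneg (hp0 k)
      (add_nonneg (by positivity) (div_nonneg (by positivity) (hy k).le))
  -- If the integrand were not integrable its integral would be 0 by convention, which the
  -- nonnegative right-hand side covers. No measurability of the FTRL term is needed.
  by_cases hint : IntegrableOn (fun ω => ∑ k, ftrlDist η A (fun i => Λ i + N i / (φ ω i + a)) k *
          (g k * (1 - f k / (φ ω k + a)))) G P
  swap
  · rw [integral_undef hint]; exact hRHS
  have hi1 : ∀ k, Integrable (fun ω => g k * ((φ ω k - f k) / (f k + a))) P := fun k =>
    (((h.integrable k).sub (integrable_const _)).div_const _).const_mul _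
  have hi2 : ∀ k, Integrable (fun ω => 6 * ((φ ω k - f k) / (f k + a)) ^ 2) P := fun k => by
    simp only [div_pow]
    exact ((h.integrable_sq k).div_const _).const_mul _
  have hi3 : ∀ k, Integrable (fun ω => p k * (g k * ((φ ω k - f k) / (f k + a))
      + 6 * ((φ ω k - f k) / (f k + a)) ^ 2 + 9 * (a / (f k + a)))) P := fun k =>
    (((hi1 k).add (hi2 k)).add (integrable_const _)).const_mul _
  have hi12 : ∀ k, Integrable (fun ω => g k * ((φ ω k - f k) / (f k + a))
      + 6 * ((φ ω k - f k) / (f k + a)) ^ 2) P := fun k => (hi1 k).add (hi2 k)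
  calc _ ≤ ∫ ω in G, ∑ k, p k * (g k * ((φ ω k - f k) / (f k + a))
        + 6 * ((φ ω k - f k) / (f k + a)) ^ 2 + 9 * (a / (f k + a))) ∂P := by
        refine setIntegral_mono_on hint (integrable_finsetSum _ fun k _ => hi3 k).integrableOn hG
          fun ω hω => ?_
        refine ftrl_bias_le hη ha0 hA hf hN hN1 hg0 hg2 fun k => ?_
        have := hω k
        have := hf k
        linarith
    _ = ∑ k, p k * (g k * ((∫ ω in G, (φ ω k - f k) ∂P) / (f k + a))
        + 6 * ((∫ ω in G, (φ ω k - f k) ^ 2 ∂P) / (f k + a) ^ 2)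
        + P.real G * (9 * (a / (f k + a)))) := by
        rw [integral_finsetSum _ fun k _ => (hi3 k).integrableOn]
        refine Finset.sum_congr rfl fun k _ => ?_
        rw [integral_const_mul, integral_add (hi12 k).integrableOn
          (integrable_const _), integral_add (hi1 k).integrableOn (hi2 k).integrableOn,
          integral_const_mul, integral_div]
        simp only [div_pow]
        rw [integral_const_mul, integral_div]
        simp
    _ ≤ _ := by
        refine Finset.sum_le_sum fun k _ => mul_le_mul_of_nonneg_left ?_ (hp0 k)
        have hyk := hy k
        set y := f k + a with hyd
        have hfy : f k ≤ y := by linarith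
        -- `φ ≥ 0` bounds `f - φ` by `f` on the bad event. The factor `f` cancels the denominator,
        -- so no inverse power of `γ` appears.
        have e1 : ∫ ω in G, (φ ω k - f k) ∂P ≤ f k * θ := by
          rw [h.setIntegral_sub_eq k hG, ← integral_neg]
          refine (setIntegral_const_le ((h.integrable k).sub (integrable_const _)).neg
            (c := f k) fun ω => ?_).trans ?_
          · simp only [Pi.sub_apply, Pi.neg_apply]; linarith [h.nonneg ω k]
          · exact mul_le_mul_of_nonneg_left h.measure_bad_le (hf k)
        have e2 : (∫ ω in G, (φ ω k - f k) ∂P) / y ≤ θ := by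
          rw [div_le_iff₀ hyk]
          nlinarith
        have e3 : g k * ((∫ ω in G, (φ ω k - f k) ∂P) / y) ≤ 2 * θ :=
          (mul_le_mul_of_nonneg_left e2 (hg0 k)).trans
            (mul_le_mul_of_nonneg_right (hg2 k) hθ0)
        have e4 : (∫ ω in G, (φ ω k - f k) ^ 2 ∂P) / y ^ 2 ≤ v / y := by
          have : v / y = y * v / y ^ 2 := by field_simp
          rw [this]
          refine div_le_div_of_nonneg_right ((h.setIntegral_sq_le k G).trans ?_) (by positivity)
          exact mul_le_mul_of_nonneg_right hfy hv0
        have e5 : P.real G * (9 * (a / y)) ≤ 9 * (a / y) :=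
          mul_le_of_le_one_left (by positivity) measureReal_le_one
        have e6 : (6 * v + 27 / 2 * γ) / y = 6 * (v / y) + 9 * (a / y) := by rw [ha]; ring
        rw [e6]; linarith

end FrequencyEstimate

end ExpectedBias

/-! ### Drawing an arm followed by an acceptance test. -/

section Selection

variable {K : ℕ}

instance instMeasurableSpaceOptionFin : MeasurableSpace (Option (Fin K)) := ⊤

instance instDiscreteMeasurableSpaceOptionFin : DiscreteMeasurableSpace (Option (Fin K)) :=
  ⟨fun _ => trivial⟩

variable [NeZero K]

/-- An arm drawn from `q` and then accepted with the probability given by `r`. -/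
def select (q r : Fin K → ℝ) (u v : ℝ) : Option (Fin K) :=
  if v < r (sample q u) then some (sample q u) else none

theorem select_eq_some_iff {q r : Fin K → ℝ} {u v : ℝ} {k : Fin K} :
    select q r u v = some k ↔ sample q u = k ∧ v < r (sample q u) := by
  unfold select
  split_ifs with h <;> simp [h]

theorem measurable_select {Z : Type*} [MeasurableSpace Z] {q r : Z → Fin K → ℝ} {u v : Z → ℝ}
    (hq : ∀ k, Measurable fun z => q z k) (hr : ∀ k, Measurable fun z => r z k)
    (hu : Measurable u) (hv : Measurable v) :
    Measurable fun z => select (q z) (r z) (u z) (v z) := by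
  have hs := measurable_sample hq hu
  unfold select
  exact Measurable.ite (measurableSet_lt hv (measurable_at_arm hr hs))
    ((measurable_of_countable some).comp hs) measurable_const

theorem lintegral_sample {q : Fin K → ℝ} (hq : ∀ k, 0 ≤ q k) (hs : ∑ k, q k = 1)
    (G : Fin K → ENNReal) :
    ∫⁻ u : unitInterval, G (sample q u) = ∑ k, ENNReal.ofReal (q k) * G k := by
  have hm : Measurable fun u : unitInterval => sample q (u : ℝ) :=
    measurable_sample (fun k => measurable_const) measurable_subtype_coe
  rw [← lintegral_map (f := G) (measurable_of_countable G) hm, lintegral_fintype]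
  refine Finset.sum_congr rfl fun k _ => ?_
  rw [Measure.map_apply hm (measurableSet_singleton k), mul_comm, ← volume_sample_eq hq hs k]
  rfl

theorem lintegral_select {q r : Fin K → ℝ} (hq : ∀ k, 0 ≤ q k) (hs : ∑ k, q k = 1)
    (hr0 : ∀ k, 0 ≤ r k) (hr1 : ∀ k, r k ≤ 1) (G : Option (Fin K) → ENNReal) :
    ∫⁻ u : unitInterval, ∫⁻ v : unitInterval, G (select q r u v) =
      ∑ k, (ENNReal.ofReal (q k * r k) * G (some k)
        + ENNReal.ofReal (q k * (1 - r k)) * G none) := by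
  have hv : ∀ k, ∫⁻ v : unitInterval, G (if (v : ℝ) < r k then some k else none) =
      ENNReal.ofReal (r k) * G (some k) + ENNReal.ofReal (1 - r k) * G none := by
    intro k
    set x : unitInterval := ⟨r k, hr0 k, hr1 k⟩ with hx
    have hset : MeasurableSet (Set.Iio x) := measurableSet_Iio
    have h1 : ∀ v : unitInterval, G (if (v : ℝ) < r k then some k else none) =
        (Set.Iio x).indicator (fun _ => G (some k)) v
          + (Set.Iio x)ᶜ.indicator (fun _ => G none) v := by
      intro v
      by_cases hvk : (v : ℝ) < r k
      · have : v ∈ Set.Iio x := hvk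
        simp [hvk, this, -Set.compl_Iio]
      · have : v ∉ Set.Iio x := hvk
        simp [hvk, this, -Set.compl_Iio]
    simp only [h1]
    rw [lintegral_add_left (measurable_const.indicator hset), lintegral_indicator_const hset,
      lintegral_indicator_const hset.compl, Set.compl_Iio, unitInterval.volume_Iio,
      unitInterval.volume_Ici, mul_comm, mul_comm (G none)]
  simp only [select, hv]
  have := lintegral_sample hq hs fun k =>
    ENNReal.ofReal (r k) * G (some k) + ENNReal.ofReal (1 - r k) * G none
  rw [this]
  refine Finset.sum_congr rfl fun k _ => ?_
  rw [mul_add, ← mul_assoc, ← mul_assoc, ENNReal.ofReal_mul (hq k), ENNReal.ofReal_mul (hq k)]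

/-- The law of the selection depends only on the products of the drawing and the acceptance
probabilities. -/
theorem lintegral_select_congr {q r q' r' : Fin K → ℝ} (hq : ∀ k, 0 ≤ q k) (hs : ∑ k, q k = 1)
    (hr0 : ∀ k, 0 ≤ r k) (hr1 : ∀ k, r k ≤ 1) (hq' : ∀ k, 0 ≤ q' k) (hs' : ∑ k, q' k = 1)
    (hr0' : ∀ k, 0 ≤ r' k) (hr1' : ∀ k, r' k ≤ 1) (h : ∀ k, q k * r k = q' k * r' k)
    (G : Option (Fin K) → ENNReal) :
    ∫⁻ u : unitInterval, ∫⁻ v : unitInterval, G (select q r u v) =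
      ∫⁻ u : unitInterval, ∫⁻ v : unitInterval, G (select q' r' u v) := by
  rw [lintegral_select hq hs hr0 hr1, lintegral_select hq' hs' hr0' hr1', Finset.sum_add_distrib,
    Finset.sum_add_distrib, ← Finset.sum_mul, ← Finset.sum_mul,
    ← ENNReal.ofReal_sum_of_nonneg fun k _ => mul_nonneg (hq k) (by linarith [hr1 k]),
    ← ENNReal.ofReal_sum_of_nonneg fun k _ => mul_nonneg (hq' k) (by linarith [hr1' k])]
  simp only [mul_sub, mul_one, Finset.sum_sub_distrib, hs, hs', h]

end Selection

/-! ### Integration over the data of one round. -/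

section RoundLaw

variable {X : Type u} [MeasurableSpace X] (ν : Measure X) [IsProbabilityMeasure ν]

theorem lintegral_coin (G : Bool → ENNReal) :
    ∫⁻ b, G b ∂(PMF.uniformOfFintype Bool).toMeasure = 2⁻¹ * G true + 2⁻¹ * G false := by
  rw [lintegral_fintype]
  simp [PMF.uniformOfFintype_apply, mul_comm]

theorem lintegral_roundLaw {F : RoundData X → ENNReal} (hF : Measurable F) :
    ∫⁻ r, F r ∂(roundLaw ν) = 2⁻¹ * (∫⁻ c, (∫⁻ u : unitInterval, ∫⁻ v : unitInterval,
        F (c, u, true, v)) ∂ν)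
      + 2⁻¹ * ∫⁻ c, (∫⁻ u : unitInterval, ∫⁻ v : unitInterval, F (c, u, false, v)) ∂ν := by
  unfold roundLaw
  rw [lintegral_prod _ hF.aemeasurable]
  have h1 : ∀ c, ∫⁻ y, F (c, y) ∂((volume : Measure unitInterval).prod
      ((PMF.uniformOfFintype Bool).toMeasure.prod (volume : Measure unitInterval))) =
      2⁻¹ * (∫⁻ u : unitInterval, ∫⁻ v : unitInterval, F (c, u, true, v))
      + 2⁻¹ * ∫⁻ u : unitInterval, ∫⁻ v : unitInterval, F (c, u, false, v) := by
    intro c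
    rw [lintegral_prod _ (by fun_prop)]
    have h2 : ∀ u : unitInterval, ∫⁻ y, F (c, u, y) ∂((PMF.uniformOfFintype Bool).toMeasure.prod
        (volume : Measure unitInterval)) =
        2⁻¹ * (∫⁻ v : unitInterval, F (c, u, true, v))
        + 2⁻¹ * ∫⁻ v : unitInterval, F (c, u, false, v) := by
      intro u
      rw [lintegral_prod _ (by fun_prop), lintegral_coin]
    simp only [h2]
    have hm : ∀ b, Measurable fun u : unitInterval => ∫⁻ v : unitInterval, F (c, u, b, v) :=
      fun b => Measurable.lintegral_prod_right' (f := fun p : unitInterval × unitInterval =>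
        F (c, p.1, b, p.2)) (by fun_prop)
    rw [lintegral_add_left ((hm true).const_mul _), lintegral_const_mul _ (hm true),
      lintegral_const_mul _ (hm false)]
  simp only [h1]
  have hm : ∀ b, Measurable fun c => ∫⁻ u : unitInterval, ∫⁻ v : unitInterval,
      F (c, u, b, v) := fun b =>
    Measurable.lintegral_prod_right' (f := fun p : X × unitInterval =>
      ∫⁻ v : unitInterval, F (p.1, p.2, b, v)) (Measurable.lintegral_prod_right'
        (f := fun p : (X × unitInterval) × unitInterval => F (p.1.1, p.1.2, b, p.2))
        (by fun_prop))
  rw [lintegral_add_left ((hm true).const_mul _), lintegral_const_mul _ (hm true),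
    lintegral_const_mul _ (hm false)]

/-- Replace the coin of a round. -/
def setCoin (b : Bool) (r : RoundData X) : RoundData X := (r.1, r.2.1, b, r.2.2.2)

theorem measurable_setCoin (b : Bool) : Measurable (setCoin b : RoundData X → RoundData X) := by
  unfold setCoin; fun_prop

/-- The coin is independent of the other data, so conditioning on it keeps the law of the round and
merely overwrites the coin. -/
theorem lintegral_setCoin {F : RoundData X → ENNReal} (hF : Measurable F) :
    ∫⁻ r, F r ∂(roundLaw ν) = 2⁻¹ * (∫⁻ r, F (setCoin true r) ∂(roundLaw ν))
      + 2⁻¹ * ∫⁻ r, F (setCoin false r) ∂(roundLaw ν) := by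
  have h2 : ∀ x : ENNReal, 2⁻¹ * x + 2⁻¹ * x = x := fun x => by
    rw [← add_mul, ENNReal.inv_two_add_inv_two, one_mul]
  have h (b : Bool) := lintegral_roundLaw ν (F := fun r => F (setCoin b r))
    (hF.comp (measurable_setCoin b))
  rw [lintegral_roundLaw ν hF, h, h]
  simp only [setCoin, h2]

theorem lintegral_roundLaw_context {F : X → ENNReal} (hF : Measurable F) :
    ∫⁻ r, F r.1 ∂(roundLaw ν) = ∫⁻ c, F c ∂ν := by
  unfold roundLaw
  rw [lintegral_prod _ (by fun_prop)]
  simp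

/-- Integral over a round of a function that does not depend on the coin. -/
theorem lintegral_roundLaw_seeds {F : X → unitInterval → unitInterval → ENNReal}
    (hF : Measurable fun p : X × unitInterval × unitInterval => F p.1 p.2.1 p.2.2) :
    ∫⁻ r, F r.1 r.2.1 r.2.2.2 ∂(roundLaw ν) =
      ∫⁻ c, (∫⁻ u : unitInterval, ∫⁻ v : unitInterval, F c u v) ∂ν := by
  have h2 : ∀ x : ENNReal, 2⁻¹ * x + 2⁻¹ * x = x := fun x => by
    rw [← add_mul, ENNReal.inv_two_add_inv_two, one_mul]
  have hm : Measurable fun r : RoundData X => F r.1 r.2.1 r.2.2.2 :=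
    hF.comp (f := fun r : RoundData X => (r.1, r.2.1, r.2.2.2)) (by fun_prop)
  rw [lintegral_roundLaw ν hm, h2]

end RoundLaw

/-! ### What the memory sees of a pair, for the algorithm and its idealisation. -/

section Feedback

variable {X : Type u} {K : ℕ}

/-- What the memory of the learner sees of a pair of rounds: the arm whose loss is estimated, if
any, the coin, and the contexts used for the frequency estimate. -/
abbrev Feedback (X : Type u) (K : ℕ) := Option (Fin K) × Bool × X × X

variable [MeasurableSpace X] [NeZero K] (E : Environment X K) (P : Params)

/-- The losses estimated from a pair of rounds. -/
def State.estimate (st : State X K) (j : ℕ) (h : Feedback X K) (c : X) (k : Fin K) : ℝ :=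
  if h.1 = some k then
    2 * E.loss (if h.2.1 then 2 * j + 1 else 2 * j) k c / (st.freq k + 3 / 2 * P.γ) else 0

/-- The contribution of a pair of rounds to the frequency estimate. -/
def freqTerm (s : X → Fin K → ℝ) (j : ℕ) (z : X × X) (k : Fin K) : ℝ :=
  if 2 * j < P.L then (s z.1 k + s z.2 k) / 4 else s z.1 k / 2

/-- Update of the sums in the memory by the feedback of a pair of rounds. -/
def State.absorb (st : State X K) (j : ℕ) (h : Feedback X K) : State X K :=
  { st with
    cumLoss := fun c k => st.cumLoss c k + if 2 * j < P.L then 0 else st.estimate E P j h c k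
    nextFreq := fun k => st.nextFreq k + freqTerm P st.nextSnap j h.2.2 k / (P.L / 2 : ℝ) }

/-- The memory after a pair of rounds, as a function of the feedback. -/
def State.feed (st : State X K) (j : ℕ) (h : Feedback X K) : State X K :=
  if P.L ∣ 2 * j + 2 then
    { cumLoss := (st.absorb E P j h).cumLoss
      snap := st.nextSnap
      nextSnap := st.ftrl E P
      freq := (st.absorb E P j h).nextFreq
      nextFreq := fun _ => 0 }
  else st.absorb E P j h

/-- The memory at the beginning of a pair of rounds, as a function of the feedback. -/
def stateOf (h : ℕ → Feedback X K) : ℕ → State X K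
  | 0 => initState E
  | j + 1 => (stateOf h j).feed E P j (h j)

/-- The acceptance probabilities. -/
def State.acceptProb (st : State X K) (t : ℕ) (c : X) (k : Fin K) : ℝ :=
  st.snap c k / (2 * st.play E P t c k)

/-- The selection made from one round by the algorithm. -/
def State.pick (st : State X K) (t : ℕ) (r : RoundData X) : Option (Fin K) :=
  select (st.play E P t r.1) (st.acceptProb E P t r.1) r.2.1 r.2.2.2

/-- The feedback of a pair of rounds played by the algorithm. -/
def State.feedback (st : State X K) (j : ℕ) (x y : RoundData X) : Feedback X K :=
  if 2 * j < P.L then (none, true, x.1, y.1)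
  else if x.2.2.1 then (st.pick E P (2 * j) y, true, x.1, x.1)
  else (st.pick E P (2 * j) x, false, y.1, y.1)

/-- An idealised selection from the snapshot with the same law. -/
def idealPick (s : X → Fin K → ℝ) (r : RoundData X) : Option (Fin K) :=
  select (s r.1) (fun _ => 1 / 2) r.2.1 r.2.2.2

/-- The idealised feedback of a pair of rounds, in which the contexts for the frequency estimate are
drawn separately. -/
def State.idealFeedback (st : State X K) (j : ℕ) (a : RoundData X) (b : X × X) : Feedback X K :=
  if 2 * j < P.L then (none, true, b.1, b.2)
  else (idealPick st.snap a, a.2.2.1, b.1, b.1)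

theorem State.play_congr (st : State X K) {t t' : ℕ} (ht : P.L ≤ t ↔ P.L ≤ t') :
    st.play E P t = st.play E P t' := by
  funext c; simp only [State.play, ht]

/-- The played arm influences the memory only if it is accepted, and the contexts only through the
frequency terms. To compare two algorithms it is therefore enough to match the law of this reduced
feedback. -/
theorem State.next_eq_feed (st : State X K) (ω : ℕ → RoundData X) (j : ℕ) :
    st.next E P ω j = st.feed E P j (st.feedback E P j (ω (2 * j)) (ω (2 * j + 1))) := by
  have hobs : st.observe E P ω j =
      st.absorb E P j (st.feedback E P j (ω (2 * j)) (ω (2 * j + 1))) := by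
    classical
    unfold State.observe State.absorb State.feedback freqTerm
    by_cases hj : 2 * j < P.L
    · simp only [hj, if_true, add_zero]
      congr 1
      funext k
      simp only [context]
      ring
    -- `play` depends on the round only through whether the first epoch is over, and both rounds of
    -- this pair are past it.
    · have hp : st.play E P (2 * j + 1) = st.play E P (2 * j) := State.play_congr E P st (by omega)
      simp only [hj, if_false]
      by_cases hb : (ω (2 * j)).2.2.1 = true
      · have hl : lossRound ω j = 2 * j + 1 := by simp [lossRound, coin, hb]
        have hf : freqRound ω j = 2 * j := by simp [freqRound, coin, hb]
        rw [hl, hf]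
        simp only [hb, if_true]
        congr 1
        · funext c k
          congr 1
          unfold State.lossEstimate State.estimate
          refine if_congr ?_ rfl rfl
          rw [State.pick, select_eq_some_iff, State.arm, State.Accepts, State.arm, hp]
          rfl
        · funext k; simp only [context]; ring
      · have hl : lossRound ω j = 2 * j := by simp [lossRound, coin, hb]
        have hf : freqRound ω j = 2 * j + 1 := by simp [freqRound, coin, hb]
        rw [hl, hf]
        simp only [hb]
        congr 1
        · funext c k
          congr 1
          unfold State.lossEstimate State.estimate
          refine if_congr ?_ rfl rfl
          simp only [Bool.false_eq_true, if_false]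
          rw [State.pick, select_eq_some_iff]
          rfl
        · funext k; simp only [context, Bool.false_eq_true, if_false]; ring
  unfold State.next State.feed
  rw [hobs]

end Feedback

/-! ### Measurability of the memory, and equality in law of one step. -/

section MeasurableFamily

variable {X : Type u} [MeasurableSpace X] {K : ℕ}

/-- A family of memories that depends measurably on a parameter. -/
structure MeasurableFamily {Z : Type*} [MeasurableSpace Z] (st : Z → State X K) : Prop where
  cumLoss : ∀ k, Measurable fun z : Z × X => (st z.1).cumLoss z.2 k
  snap : ∀ k, Measurable fun z : Z × X => (st z.1).snap z.2 k
  nextSnap : ∀ k, Measurable fun z : Z × X => (st z.1).nextSnap z.2 k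
  freq : ∀ k, Measurable fun z => (st z).freq k
  nextFreq : ∀ k, Measurable fun z => (st z).nextFreq k

variable {Z : Type*} [MeasurableSpace Z] {st : Z → State X K} {E : Environment X K} {P : Params}

theorem MeasurableFamily.comp (h : MeasurableFamily st) {W : Type*} [MeasurableSpace W]
    {g : W → Z} (hg : Measurable g) : MeasurableFamily fun w => st (g w) where
  cumLoss k := (h.cumLoss k).comp (f := fun z : W × X => (g z.1, z.2)) (by fun_prop)
  snap k := (h.snap k).comp (f := fun z : W × X => (g z.1, z.2)) (by fun_prop)
  nextSnap k := (h.nextSnap k).comp (f := fun z : W × X => (g z.1, z.2)) (by fun_prop)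
  freq k := (h.freq k).comp hg
  nextFreq k := (h.nextFreq k).comp hg

theorem measurable_ftrlDist {η : ℝ} {A : Z → Finset (Fin K)} {Λ : Z → Fin K → ℝ}
    (hA : ∀ k, MeasurableSet {z | k ∈ A z}) (hΛ : ∀ k, Measurable fun z => Λ z k) (k : Fin K) :
    Measurable fun z => ftrlDist η (A z) (Λ z) k := by
  unfold ftrlDist
  refine Measurable.ite (hA k) (Measurable.div (by have := hΛ k; fun_prop) ?_) measurable_const
  have : (fun z => ∑ i ∈ A z, Real.exp (-η * Λ z i)) = fun z =>
      ∑ i, if i ∈ A z then Real.exp (-η * Λ z i) else 0 := by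
    funext z; simp
  rw [this]
  exact Finset.measurable_sum _ fun i _ =>
    Measurable.ite (hA i) (by have := hΛ i; fun_prop) measurable_const

theorem MeasurableFamily.ftrl [NeZero K] (h : MeasurableFamily st) (k : Fin K) :
    Measurable fun z : Z × X => (st z.1).ftrl E P z.2 k :=
  measurable_ftrlDist (fun k => measurable_snd (E.measurableSet_active k)) h.cumLoss k

theorem MeasurableFamily.play [NeZero K] (h : MeasurableFamily st) (t : ℕ) (k : Fin K) :
    Measurable fun z : Z × X => (st z.1).play E P t z.2 k := by
  have hp := h.ftrl (E := E) (P := P)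
  have hs := h.snap
  have : (fun z : Z × X => (st z.1).play E P t z.2 k) = fun z =>
      if P.L ≤ t ∧ ∀ k, (st z.1).snap z.2 k / 2 ≤ (st z.1).ftrl E P z.2 k then
        (st z.1).ftrl E P z.2 k else (st z.1).snap z.2 k := by
    funext z; unfold State.play; split_ifs <;> rfl
  rw [this]
  have h2 : {z : Z × X | ∀ k, (st z.1).snap z.2 k / 2 ≤ (st z.1).ftrl E P z.2 k} =
      ⋂ k, {z | (st z.1).snap z.2 k / 2 ≤ (st z.1).ftrl E P z.2 k} := by ext; simp
  have h3 : MeasurableSet {z : Z × X |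
      ∀ k, (st z.1).snap z.2 k / 2 ≤ (st z.1).ftrl E P z.2 k} := by
    rw [h2]
    exact MeasurableSet.iInter fun k => measurableSet_le ((hs k).div_const 2) (hp k)
  exact Measurable.ite ((MeasurableSet.const (P.L ≤ t)).inter h3) (hp k) (hs k)

theorem measurable_at {g : Z × X → ℝ} (hg : Measurable g) {c : Z → X} (hc : Measurable c) :
    Measurable fun z => g (z, c z) :=
  hg.comp (measurable_id.prodMk hc)

theorem MeasurableFamily.pick [NeZero K] (h : MeasurableFamily st) (t : ℕ) {r : Z → RoundData X}
    (hr : Measurable r) : Measurable fun z => (st z).pick E P t (r z) := by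
  have hc : Measurable fun z => (r z).1 := by fun_prop
  refine measurable_select (fun k => measurable_at (h.play t k) hc) (fun k => ?_)
    (by fun_prop) (by fun_prop)
  exact (measurable_at (h.snap k) hc).div ((measurable_at (h.play t k) hc).const_mul 2)

theorem measurable_idealPick [NeZero K] {s : Z → X → Fin K → ℝ}
    (h : ∀ k, Measurable fun z : Z × X => s z.1 z.2 k) {r : Z → RoundData X}
    (hr : Measurable r) : Measurable fun z => idealPick (s z) (r z) := by
  have hc : Measurable fun z => (r z).1 := by fun_prop
  exact measurable_select (fun k => measurable_at (h k) hc) (fun k => measurable_const)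
    (by fun_prop) (by fun_prop)

theorem MeasurableFamily.feedback [NeZero K] (h : MeasurableFamily st) (j : ℕ)
    {x y : Z → RoundData X} (hx : Measurable x) (hy : Measurable y) :
    Measurable fun z => (st z).feedback E P j (x z) (y z) := by
  unfold State.feedback
  split_ifs
  · fun_prop
  · have h1 := h.pick (E := E) (P := P) (2 * j) hx
    have h2 := h.pick (E := E) (P := P) (2 * j) hy
    refine Measurable.ite (measurableSet_eq_fun (by fun_prop) measurable_const) ?_ ?_ <;> fun_prop

theorem MeasurableFamily.idealFeedback [NeZero K] (h : MeasurableFamily st) (j : ℕ)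
    {a : Z → RoundData X} {b : Z → X × X} (ha : Measurable a) (hb : Measurable b) :
    Measurable fun z => (st z).idealFeedback P j (a z) (b z) := by
  unfold State.idealFeedback
  split_ifs
  · fun_prop
  · have h1 := measurable_idealPick (s := fun z => (st z).snap) h.snap ha
    fun_prop

theorem measurable_freqTerm {s : Z → X → Fin K → ℝ}
    (h : ∀ k, Measurable fun z : Z × X => s z.1 z.2 k) (j : ℕ) {b : Z → X × X}
    (hb : Measurable b) (k : Fin K) : Measurable fun z => freqTerm P (s z) j (b z) k := by
  have h1 : Measurable fun z => s z (b z).1 k := measurable_at (h k) (by fun_prop)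
  have h2 : Measurable fun z => s z (b z).2 k := measurable_at (h k) (by fun_prop)
  unfold freqTerm
  split_ifs <;> fun_prop

theorem MeasurableFamily.estimate (h : MeasurableFamily st) (j : ℕ)
    {f : Z → Feedback X K} (hf : Measurable f) (k : Fin K) :
    Measurable fun z : Z × X => (st z.1).estimate E P j (f z.1) z.2 k := by
  have h1 : Measurable fun z : Z × X => (f z.1).1 := by fun_prop
  have h2 : Measurable fun z : Z × X => (f z.1).2.1 := by fun_prop
  have hl : Measurable fun z : Z × X =>
      E.loss (if (f z.1).2.1 = true then 2 * j + 1 else 2 * j) k z.2 := by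
    have : (fun z : Z × X => E.loss (if (f z.1).2.1 = true then 2 * j + 1 else 2 * j) k z.2) =
        fun z => if (f z.1).2.1 = true then E.loss (2 * j + 1) k z.2
          else E.loss (2 * j) k z.2 := by
      funext z; split_ifs <;> rfl
    rw [this]
    exact Measurable.ite (measurableSet_eq_fun h2 measurable_const)
      ((E.measurable_loss _ k).comp measurable_snd) ((E.measurable_loss _ k).comp measurable_snd)
  unfold State.estimate
  refine Measurable.ite (h1 (measurableSet_singleton (some k))) ?_ measurable_const
  exact (hl.const_mul 2).div (((h.freq k).comp measurable_fst).add_const _)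

theorem MeasurableFamily.feed [NeZero K] (h : MeasurableFamily st) (j : ℕ)
    {f : Z → Feedback X K} (hf : Measurable f) :
    MeasurableFamily fun z => (st z).feed E P j (f z) := by
  have ho : MeasurableFamily fun z => (st z).absorb E P j (f z) := by
    refine ⟨fun k => (h.cumLoss k).add ?_, h.snap, h.nextSnap, h.freq, fun k =>
      (h.nextFreq k).add (Measurable.div_const ?_ _)⟩
    · by_cases hj : 2 * j < P.L
      · simp only [hj, if_true]; exact measurable_const
      · simp only [hj, if_false]; exact h.estimate j hf k
    · exact measurable_freqTerm h.nextSnap j (by fun_prop) k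
  unfold State.feed
  by_cases hj : P.L ∣ 2 * j + 2
  · simp only [hj, if_true]
    exact ⟨ho.cumLoss, h.nextSnap, h.ftrl, ho.nextFreq, fun _ => measurable_const⟩
  · simp only [hj, if_false]
    exact ho

/-- The initial snapshots are FTRL distributions for zero losses, so the stability argument covers
the first epochs as well. -/
theorem uniformOnArms_eq_ftrlDist (η : ℝ) (A : Finset (Fin K)) :
    uniformOnArms A = ftrlDist η A fun _ => 0 := by
  funext k; simp [uniformOnArms, ftrlDist]

variable (E P)

theorem measurableFamily_initState :
    MeasurableFamily fun _ : Z => (initState E : State X K) := by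
  have hu : ∀ k, Measurable fun z : Z × X => uniformOnArms (E.active z.2) k := by
    intro k
    simp only [uniformOnArms_eq_ftrlDist 0]
    exact measurable_ftrlDist (fun k => measurable_snd (E.measurableSet_active k))
      (fun _ => measurable_const) k
  exact ⟨fun _ => measurable_const, hu, hu, fun _ => measurable_const, fun _ => measurable_const⟩

theorem measurableFamily_stateOf [NeZero K] (j : ℕ) :
    MeasurableFamily fun h : ℕ → Feedback X K => stateOf E P h j := by
  induction j with
  | zero => exact measurableFamily_initState E
  | succ j ih => exact ih.feed j (measurable_pi_apply j)

/-- The snapshots in a memory are probability vectors on the active arms. -/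
structure State.Valid (st : State X K) : Prop where
  snap_mem : ∀ c, st.snap c ∈ simplexOn (E.active c)
  nextSnap_mem : ∀ c, st.nextSnap c ∈ simplexOn (E.active c)

theorem State.Valid.feed [NeZero K] {E : Environment X K} {st : State X K} (h : st.Valid E) (j : ℕ)
    (f : Feedback X K) : (st.feed E P j f).Valid E := by
  unfold State.feed
  split_ifs
  · exact ⟨h.nextSnap_mem, fun c => ftrlDist_mem_simplexOn _ (E.active_nonempty c) _⟩
  · exact ⟨h.snap_mem, h.nextSnap_mem⟩

theorem valid_initState : (initState E).Valid E := by
  have : ∀ c, uniformOnArms (E.active c) ∈ simplexOn (E.active c) := fun c => by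
    rw [uniformOnArms_eq_ftrlDist 0]
    exact ftrlDist_mem_simplexOn _ (E.active_nonempty c) _
  exact ⟨this, this⟩

theorem valid_stateOf [NeZero K] (h : ℕ → Feedback X K) (j : ℕ) : (stateOf E P h j).Valid E := by
  induction j with
  | zero => exact valid_initState E
  | succ j ih => exact ih.feed P j _

variable {E} [NeZero K]

theorem State.Valid.play_mem {st : State X K} (h : st.Valid E) (t : ℕ) (c : X) :
    st.play E P t c ∈ simplexOn (E.active c) := by
  unfold State.play
  split_ifs
  · exact ftrlDist_mem_simplexOn _ (E.active_nonempty c) _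
  · exact h.snap_mem c

theorem State.Valid.half_snap_le_play {st : State X K} (h : st.Valid E) (t : ℕ) (c : X)
    (k : Fin K) : st.snap c k / 2 ≤ st.play E P t c k := by
  unfold State.play
  split_ifs with h1
  · exact h1.2 k
  · linarith [(h.snap_mem c).1 k]

/-- The reason for the acceptance test: its probability cancels `play` and leaves half the snapshot.
The fallback to the snapshot in `play` guarantees that the probability is at most 1. -/
theorem State.Valid.lintegral_pick {st : State X K} (h : st.Valid E) (t : ℕ) (c : X)
    (G : Option (Fin K) → ENNReal) :
    ∫⁻ u : unitInterval, ∫⁻ v : unitInterval,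
        G (select (st.play E P t c) (st.acceptProb E P t c) u v) =
      ∫⁻ u : unitInterval, ∫⁻ v : unitInterval, G (select (st.snap c) (fun _ => 1 / 2) u v) := by
  have hs := h.snap_mem c
  have hp := h.play_mem P t c
  have hl := h.half_snap_le_play P t c
  refine lintegral_select_congr hp.1 hp.2.1 (fun k => ?_) (fun k => ?_) hs.1 hs.2.1
    (fun _ => by norm_num) (fun _ => by norm_num) (fun k => ?_) G
  · exact div_nonneg (hs.1 k) (mul_nonneg zero_le_two (hp.1 k))
  · exact div_le_one_of_le₀ (by linarith [hl k]) (mul_nonneg zero_le_two (hp.1 k))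
  · unfold State.acceptProb
    -- For an arm that is never played the acceptance probability is a division by zero. This is
    -- harmless since `snap ≤ 2 * play` makes the snapshot vanish there too.
    rcases eq_or_ne (st.play E P t c k) 0 with h0 | h0
    · have h1 : st.snap c k = 0 := le_antisymm (by linarith [hl k]) (hs.1 k)
      simp [h0, h1]
    · field_simp

/-- The feedback of a pair of rounds has the same law as the idealised feedback. -/
theorem State.Valid.lintegral_feedback {st : State X K} (h : st.Valid E)
    (hm : MeasurableFamily fun _ : Unit => st) (j : ℕ) {F : Feedback X K → ENNReal}
    (hF : Measurable F) :
    ∫⁻ x, ∫⁻ y, F (st.feedback E P j x y) ∂(roundLaw E.contextLaw) ∂(roundLaw E.contextLaw) =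
      ∫⁻ a, ∫⁻ b, F (st.idealFeedback P j a b) ∂(E.contextLaw.prod E.contextLaw)
        ∂(roundLaw E.contextLaw) := by
  set ν := E.contextLaw with hν
  by_cases hj : 2 * j < P.L
  · simp only [State.feedback, State.idealFeedback, hj, if_true]
    rw [lintegral_const, measure_univ, mul_one, lintegral_prod _ (by fun_prop)]
    have h1 : ∀ x : RoundData X, ∫⁻ y, F (none, true, x.1, y.1) ∂(roundLaw ν) =
        ∫⁻ c, F (none, true, x.1, c) ∂ν := fun x =>
      lintegral_roundLaw_context ν (F := fun c => F (none, true, x.1, c)) (by fun_prop)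
    simp only [h1]
    refine lintegral_roundLaw_context ν (F := fun c' => ∫⁻ c, F (none, true, c', c) ∂ν) ?_
    exact Measurable.lintegral_prod_right' (f := fun p : X × X => F (none, true, p.1, p.2))
      (by fun_prop)
  · have hmz : ∀ {Z : Type u} [MeasurableSpace Z], MeasurableFamily fun _ : Z => st := fun {Z} _ =>
      hm.comp (g := fun _ : Z => ()) measurable_const
    have hpick : Measurable fun r : RoundData X => st.pick E P (2 * j) r :=
      (hmz (Z := RoundData X)).pick (2 * j) measurable_id
    have hipick : Measurable fun r : RoundData X => idealPick st.snap r :=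
      measurable_idealPick (hmz (Z := RoundData X)).snap measurable_id
    have hκ : ∀ b c, ∫⁻ r, F (st.pick E P (2 * j) r, b, c, c) ∂(roundLaw ν) =
        ∫⁻ r, F (idealPick st.snap r, b, c, c) ∂(roundLaw ν) := by
      intro b c
      have h1 := lintegral_roundLaw_seeds ν (F := fun c' u v => F (select (st.play E P (2 * j) c')
        (st.acceptProb E P (2 * j) c') u v, b, c, c)) ?_
      · have h2 := lintegral_roundLaw_seeds ν (F := fun c' u v =>
          F (select (st.snap c') (fun _ => 1 / 2) u v, b, c, c)) ?_
        · refine Eq.trans h1 (Eq.trans ?_ h2.symm)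
          refine lintegral_congr fun c' => ?_
          exact h.lintegral_pick P (2 * j) c' fun o => F (o, b, c, c)
        · have := hipick.comp (g := idealPick st.snap)
            (f := fun p : X × unitInterval × unitInterval => ((p.1, p.2.1, true, p.2.2) :
              RoundData X)) (by fun_prop)
          exact hF.comp (this.prodMk (by fun_prop))
      · have := hpick.comp (f := fun p : X × unitInterval × unitInterval =>
          ((p.1, p.2.1, true, p.2.2) : RoundData X)) (by fun_prop)
        exact hF.comp (this.prodMk (by fun_prop))
    have hfb : Measurable fun p : RoundData X × RoundData X => st.feedback E P j p.1 p.2 :=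
      (hmz (Z := RoundData X × RoundData X)).feedback j measurable_fst measurable_snd
    have hifb : Measurable fun p : RoundData X × X × X => st.idealFeedback P j p.1 p.2 :=
      (hmz (Z := RoundData X × X × X)).idealFeedback j measurable_fst measurable_snd
    have hA : Measurable fun x => ∫⁻ y, F (st.feedback E P j x y) ∂(roundLaw ν) :=
      Measurable.lintegral_prod_right' (hF.comp hfb)
    have hB : Measurable fun a => ∫⁻ b, F (st.idealFeedback P j a b) ∂(ν.prod ν) :=
      Measurable.lintegral_prod_right' (hF.comp hifb)
    -- Given the coin, the selection uses one round of the pair and the frequency context the other,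
    -- so the two are independent. The selection is then exchanged for the ideal one by `hκ`.
    rw [lintegral_setCoin ν hA, lintegral_setCoin ν hB]
    simp only [State.feedback, State.idealFeedback, hj, if_false]
    simp only [setCoin, if_true, Bool.false_eq_true, if_false]
    have hpair : ∀ b, Measurable fun p : RoundData X × X => F (st.pick E P (2 * j) p.1, b, p.2, p.2) :=
      fun b => hF.comp ((hpick.comp measurable_fst).prodMk (by fun_prop))
    have hipair : ∀ b, Measurable fun p : RoundData X × X =>
        F (idealPick st.snap p.1, b, p.2, p.2) :=
      fun b => hF.comp ((hipick.comp measurable_fst).prodMk (by fun_prop))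
    have hleft : ∀ b, ∫⁻ c, ∫⁻ r, F (st.pick E P (2 * j) r, b, c, c) ∂(roundLaw ν) ∂ν =
        ∫⁻ r, ∫⁻ z : X × X, F (idealPick st.snap r, b, z.1, z.1) ∂(ν.prod ν) ∂(roundLaw ν) := by
      intro b
      simp only [hκ]
      rw [lintegral_lintegral_swap (f := fun c r => F (idealPick st.snap r, b, c, c))
        ((hipair b).comp measurable_swap).aemeasurable]
      refine lintegral_congr fun r => ?_
      rw [lintegral_prod _ (by fun_prop)]
      simp
    have ht : ∫⁻ x : RoundData X, ∫⁻ y, F (st.pick E P (2 * j) y, true, x.1, x.1) ∂(roundLaw ν)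
        ∂(roundLaw ν) =
        ∫⁻ c, ∫⁻ r, F (st.pick E P (2 * j) r, true, c, c) ∂(roundLaw ν) ∂ν :=
      lintegral_roundLaw_context ν
        (F := fun c => ∫⁻ r, F (st.pick E P (2 * j) r, true, c, c) ∂(roundLaw ν))
        (Measurable.lintegral_prod_left' (hpair true))
    have hf : ∫⁻ x : RoundData X, ∫⁻ y : RoundData X, F (st.pick E P (2 * j) x, false, y.1, y.1)
        ∂(roundLaw ν) ∂(roundLaw ν) =
        ∫⁻ c, ∫⁻ r, F (st.pick E P (2 * j) r, false, c, c) ∂(roundLaw ν) ∂ν := by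
      rw [lintegral_lintegral_swap]
      · exact lintegral_roundLaw_context ν
          (F := fun c => ∫⁻ r, F (st.pick E P (2 * j) r, false, c, c) ∂(roundLaw ν))
          (Measurable.lintegral_prod_left' (hpair false))
      · exact ((hpair false).comp (f := fun p : RoundData X × RoundData X => (p.1, p.2.1))
          (by fun_prop)).aemeasurable
    -- `pick` never reads the coin, so overwriting it changes nothing.
    have hL : ∫⁻ x : RoundData X, ∫⁻ y : RoundData X,
        F (st.pick E P (2 * j) (x.1, x.2.1, false, x.2.2.2), false, y.1, y.1)
        ∂(roundLaw ν) ∂(roundLaw ν) = ∫⁻ x : RoundData X, ∫⁻ y : RoundData X,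
        F (st.pick E P (2 * j) x, false, y.1, y.1) ∂(roundLaw ν) ∂(roundLaw ν) := rfl
    rw [hL, ht, hf, hleft, hleft]
    rfl

end MeasurableFamily

/-! ### Equality in law of the memories of the two algorithms. -/

section History

variable {X : Type u} [MeasurableSpace X] {K : ℕ} [NeZero K] (E : Environment X K) (P : Params)

/-- The history of feedback of the algorithm. -/
def history (ω : ℕ → RoundData X) (j : ℕ) : Feedback X K :=
  (state E P ω j).feedback E P j (ω (2 * j)) (ω (2 * j + 1))

theorem state_eq_stateOf (ω : ℕ → RoundData X) (j : ℕ) :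
    state E P ω j = stateOf E P (history E P ω) j := by
  induction j with
  | zero => rfl
  | succ j ih =>
    rw [state, State.next_eq_feed, stateOf, ← ih]
    rfl

/-- The randomness of the idealised algorithm: rounds for the selections and pairs of contexts for
the frequency estimates. -/
abbrev IdealData (X : Type u) := (ℕ → RoundData X) × (ℕ → X × X)

/-- The law of the randomness of the idealised algorithm. -/
def Environment.idealProb : Measure (IdealData X) :=
  (iidLaw (roundLaw E.contextLaw)).prod (iidLaw (E.contextLaw.prod E.contextLaw))

instance : IsProbabilityMeasure E.idealProb := by
  unfold Environment.idealProb; infer_instance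

/-- The memory of the idealised algorithm. -/
def idealState (ω : IdealData X) : ℕ → State X K
  | 0 => initState E
  | j + 1 => (idealState ω j).feed E P j ((idealState ω j).idealFeedback P j (ω.1 j) (ω.2 j))

/-- The history of feedback of the idealised algorithm. -/
def idealHistory (ω : IdealData X) (j : ℕ) : Feedback X K :=
  (idealState E P ω j).idealFeedback P j (ω.1 j) (ω.2 j)

theorem idealState_eq_stateOf (ω : IdealData X) (j : ℕ) :
    idealState E P ω j = stateOf E P (idealHistory E P ω) j := by
  induction j with
  | zero => rfl
  | succ j ih =>
    rw [idealState, stateOf, ← ih]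
    rfl

theorem valid_idealState (ω : IdealData X) (j : ℕ) : (idealState E P ω j).Valid E := by
  rw [idealState_eq_stateOf]; exact valid_stateOf E P _ j

/-- The first `n` entries of a history, continued by a default value. -/
def truncHistory (d : Feedback X K) (n : ℕ) (h : ℕ → Feedback X K) (i : ℕ) : Feedback X K :=
  if i < n then h i else d

theorem stateOf_congr {h h' : ℕ → Feedback X K} {j : ℕ} (hh : ∀ i < j, h i = h' i) :
    stateOf E P h j = stateOf E P h' j := by
  induction j with
  | zero => rfl
  | succ j ih =>
    rw [stateOf, stateOf, ih fun i hi => hh i (by omega), hh j (by omega)]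

theorem stateOf_truncHistory (d : Feedback X K) (n : ℕ) (h : ℕ → Feedback X K) :
    stateOf E P (truncHistory d n h) n = stateOf E P h n :=
  stateOf_congr E P fun i hi => by simp [truncHistory, hi]

theorem truncHistory_succ (d : Feedback X K) (n : ℕ) (h : ℕ → Feedback X K) :
    truncHistory d (n + 1) h = Function.update (truncHistory d n h) n (h n) := by
  funext i
  rcases lt_trichotomy i n with hi | hi | hi
  · rw [Function.update_of_ne hi.ne]; simp [truncHistory, hi, hi.trans (Nat.lt_succ_self n)]
  · subst hi; simp [truncHistory]
  · rw [Function.update_of_ne hi.ne']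
    simp [truncHistory, not_lt.2 hi.le, not_lt.2 (Nat.succ_le_of_lt hi)]

theorem state_congr {ω ω' : ℕ → RoundData X} {j : ℕ} (h : ∀ i < 2 * j, ω i = ω' i) :
    state E P ω j = state E P ω' j := by
  induction j with
  | zero => rfl
  | succ j ih =>
    rw [state, state, State.next_eq_feed, State.next_eq_feed, ih fun i hi => h i (by omega),
      h (2 * j) (by omega), h (2 * j + 1) (by omega)]

theorem idealState_congr {ω ω' : IdealData X} {j : ℕ} (h1 : ∀ i < j, ω.1 i = ω'.1 i)
    (h2 : ∀ i < j, ω.2 i = ω'.2 i) : idealState E P ω j = idealState E P ω' j := by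
  induction j with
  | zero => rfl
  | succ j ih =>
    rw [idealState, idealState, ih (fun i hi => h1 i (by omega)) (fun i hi => h2 i (by omega)),
      h1 j (by omega), h2 j (by omega)]

theorem truncHistory_history_congr (d : Feedback X K) {ω ω' : ℕ → RoundData X} {n : ℕ}
    (h : ∀ i < 2 * n, ω i = ω' i) :
    truncHistory d n (history E P ω) = truncHistory d n (history E P ω') := by
  funext i
  unfold truncHistory history
  split_ifs with hi
  · rw [state_congr E P fun k hk => h k (by omega), h (2 * i) (by omega), h (2 * i + 1) (by omega)]
  · rfl

theorem truncHistory_idealHistory_congr (d : Feedback X K) {ω ω' : IdealData X} {n : ℕ}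
    (h1 : ∀ i < n, ω.1 i = ω'.1 i) (h2 : ∀ i < n, ω.2 i = ω'.2 i) :
    truncHistory d n (idealHistory E P ω) = truncHistory d n (idealHistory E P ω') := by
  funext i
  unfold truncHistory idealHistory
  split_ifs with hi
  · rw [idealState_congr E P (fun k hk => h1 k (by omega)) (fun k hk => h2 k (by omega)),
      h1 i hi, h2 i hi]
  · rfl

theorem measurableFamily_state (j : ℕ) : MeasurableFamily fun ω => state E P ω j :=
  have h := measurableState_state E P j
  ⟨h.cumLoss, h.snap, h.nextSnap, h.freq, h.nextFreq⟩

theorem measurableFamily_idealState (j : ℕ) : MeasurableFamily fun ω => idealState E P ω j := by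
  induction j with
  | zero => exact measurableFamily_initState E
  | succ j ih => exact ih.feed j (ih.idealFeedback j (by fun_prop) (by fun_prop))

theorem measurable_history : Measurable (history E P) := by
  refine measurable_pi_iff.2 fun j => ?_
  exact (measurableFamily_state E P j).feedback j (by fun_prop) (by fun_prop)

theorem measurable_idealHistory : Measurable (idealHistory E P) := by
  refine measurable_pi_iff.2 fun j => ?_
  exact (measurableFamily_idealState E P j).idealFeedback j (by fun_prop) (by fun_prop)

omit [NeZero K] in
theorem measurable_truncHistory (d : Feedback X K) (n : ℕ) :
    Measurable (truncHistory d n : (ℕ → Feedback X K) → ℕ → Feedback X K) := by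
  refine measurable_pi_iff.2 fun i => ?_
  unfold truncHistory
  split_ifs <;> fun_prop

/-- The histories of the algorithm and of the idealised algorithm have the same law. -/
theorem lintegral_truncHistory (d : Feedback X K) (n : ℕ) {F : (ℕ → Feedback X K) → ENNReal}
    (hF : Measurable F) :
    ∫⁻ ω, F (truncHistory d n (history E P ω)) ∂E.prob =
      ∫⁻ ω, F (truncHistory d n (idealHistory E P ω)) ∂E.idealProb := by
  induction n generalizing F with
  | zero =>
    have h0 : ∀ h : ℕ → Feedback X K, truncHistory d 0 h = fun _ => d := fun h => by
      funext i; simp [truncHistory]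
    simp only [h0]
    rw [lintegral_const, lintegral_const, measure_univ, measure_univ]
  | succ n ih =>
    set μ := roundLaw E.contextLaw with hμ
    set κ := E.contextLaw.prod E.contextLaw with hκ
    have hT := measurable_truncHistory (X := X) (K := K) d n
    have hupd : Measurable fun p : (ℕ → Feedback X K) × Feedback X K =>
        Function.update p.1 n p.2 := by
      refine measurable_pi_iff.2 fun i => ?_
      by_cases hi : i = n
      · subst hi; simp only [Function.update_self]; fun_prop
      · simp only [Function.update_of_ne hi]; fun_prop
    -- The transition kernel of the feedback given the first `n` entries. Both algorithms are shown
    -- to have it: the actual one by redrawing the two rounds of pair `n`, the ideal one by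
    -- redrawing one round and one pair of contexts.
    set F1 : (ℕ → Feedback X K) → ENNReal := fun h =>
      ∫⁻ x, ∫⁻ y, F (Function.update h n ((stateOf E P h n).feedback E P n x y)) ∂μ ∂μ with hF1
    have hF1m : Measurable F1 := by
      refine Measurable.lintegral_prod_right' (f := fun p : (ℕ → Feedback X K) × RoundData X =>
        ∫⁻ y, F (Function.update p.1 n ((stateOf E P p.1 n).feedback E P n p.2 y)) ∂μ) ?_
      refine Measurable.lintegral_prod_right' (f := fun q : ((ℕ → Feedback X K) × RoundData X) ×
        RoundData X => F (Function.update q.1.1 n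
          ((stateOf E P q.1.1 n).feedback E P n q.1.2 q.2))) ?_
      have hfam := (measurableFamily_stateOf E P n).comp (W := ((ℕ → Feedback X K) × RoundData X) ×
        RoundData X) (g := fun q => q.1.1) (by fun_prop)
      have hfb := hfam.feedback (E := E) (P := P) n (x := fun q => q.1.2) (y := fun q => q.2)
        (by fun_prop) (by fun_prop)
      exact hF.comp (hupd.comp ((by fun_prop : Measurable fun q : ((ℕ → Feedback X K) ×
        RoundData X) × RoundData X => q.1.1).prodMk hfb))
    have hreal : ∫⁻ ω, F (truncHistory d (n + 1) (history E P ω)) ∂E.prob =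
        ∫⁻ ω, F1 (truncHistory d n (history E P ω)) ∂E.prob := by
      have hm1 : Measurable fun ω => F (truncHistory d (n + 1) (history E P ω)) :=
        hF.comp ((measurable_truncHistory d (n + 1)).comp (measurable_history E P))
      have hE : E.prob = iidLaw μ := rfl
      have hm2 : Measurable fun ω => ∫⁻ x, F (truncHistory d (n + 1)
          (history E P (Function.update ω (2 * n + 1) x))) ∂μ :=
        Measurable.lintegral_prod_right' (f := fun p : (ℕ → RoundData X) × RoundData X =>
          F (truncHistory d (n + 1) (history E P (Function.update p.1 (2 * n + 1) p.2))))
          (hm1.comp (measurePreserving_update μ (2 * n + 1)).measurable)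
      rw [hE, lintegral_update μ hm1 (2 * n + 1), lintegral_update μ hm2 (2 * n)]
      refine lintegral_congr fun ω => ?_
      simp only [hF1]
      refine lintegral_congr fun x => lintegral_congr fun y => ?_
      set ω' := Function.update (Function.update ω (2 * n) x) (2 * n + 1) y with hω'
      have hag : ∀ i < 2 * n, ω' i = ω i := fun i hi => by
        rw [hω', Function.update_of_ne (by omega), Function.update_of_ne (by omega)]
      rw [truncHistory_succ, truncHistory_history_congr E P d hag, stateOf_truncHistory,
        ← state_eq_stateOf, history, state_congr E P hag]
      congr 3
      · rw [hω', Function.update_of_ne (by omega), Function.update_self]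
      · rw [hω', Function.update_self]
    have hideal : ∫⁻ ω, F (truncHistory d (n + 1) (idealHistory E P ω)) ∂E.idealProb =
        ∫⁻ ω, F1 (truncHistory d n (idealHistory E P ω)) ∂E.idealProb := by
      have hm1 : Measurable fun ω => F (truncHistory d (n + 1) (idealHistory E P ω)) :=
        hF.comp ((measurable_truncHistory d (n + 1)).comp (measurable_idealHistory E P))
      have hm5 : Measurable fun ω => F1 (truncHistory d n (idealHistory E P ω)) :=
        hF1m.comp (hT.comp (measurable_idealHistory E P))
      unfold Environment.idealProb
      rw [← hμ, ← hκ, lintegral_prod _ hm1.aemeasurable, lintegral_prod _ hm5.aemeasurable]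
      have hb : ∀ α, ∫⁻ β, F (truncHistory d (n + 1) (idealHistory E P (α, β))) ∂(iidLaw κ) =
          ∫⁻ β, ∫⁻ b, F (truncHistory d (n + 1) (idealHistory E P
            (α, Function.update β n b))) ∂κ ∂(iidLaw κ) := fun α =>
        lintegral_update κ (F := fun β => F (truncHistory d (n + 1) (idealHistory E P (α, β))))
          (hm1.comp (by fun_prop)) n
      simp only [hb]
      have hm3 : Measurable fun p : (ℕ → RoundData X) × (ℕ → X × X) =>
          ∫⁻ b, F (truncHistory d (n + 1) (idealHistory E P
            (p.1, Function.update p.2 n b))) ∂κ :=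
        Measurable.lintegral_prod_right' (f := fun q : ((ℕ → RoundData X) × (ℕ → X × X)) × X × X =>
          F (truncHistory d (n + 1) (idealHistory E P (q.1.1, Function.update q.1.2 n q.2))))
          (hm1.comp ((by fun_prop : Measurable fun q : ((ℕ → RoundData X) × (ℕ → X × X)) × X × X =>
            q.1.1).prodMk ((measurePreserving_update κ n).measurable.comp (by fun_prop :
            Measurable fun q : ((ℕ → RoundData X) × (ℕ → X × X)) × X × X => (q.1.2, q.2)))))
      have hm4 : Measurable fun α => ∫⁻ β, ∫⁻ b, F (truncHistory d (n + 1) (idealHistory E P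
            (α, Function.update β n b))) ∂κ ∂(iidLaw κ) :=
        Measurable.lintegral_prod_right' hm3
      rw [lintegral_update μ hm4 n]
      refine lintegral_congr fun α => ?_
      -- The integral over the context sequence is moved outside, so that for a frozen past exactly
      -- the two innermost integrals of the one-step identity remain.
      rw [lintegral_lintegral_swap]
      · refine lintegral_congr fun β => ?_
        set T := truncHistory d n (idealHistory E P (α, β)) with hTd
        have hval := (valid_stateOf E P T n).lintegral_feedback P
          ((measurableFamily_stateOf E P n).comp (W := Unit) (g := fun _ => T) measurable_const) n
          (F := fun f => F (Function.update T n f))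
          (hF.comp (hupd.comp (f := fun f => (T, f)) (by fun_prop)))
        simp only [hF1]
        rw [hval]
        refine lintegral_congr fun a => lintegral_congr fun b => ?_
        have h1 : ∀ i < n, Function.update α n a i = α i := fun i hi => by
          rw [Function.update_of_ne (by omega)]
        have h2 : ∀ i < n, Function.update β n b i = β i := fun i hi => by
          rw [Function.update_of_ne (by omega)]
        rw [truncHistory_succ, truncHistory_idealHistory_congr E P d
          (ω' := (α, β)) h1 h2, ← hTd, idealHistory, idealState_congr E P (ω' := (α, β)) h1 h2,
          hTd, stateOf_truncHistory, ← idealState_eq_stateOf]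
        simp
      · exact (hm3.comp (f := fun p : RoundData X × (ℕ → X × X) => (Function.update α n p.1, p.2))
          (((measurePreserving_update μ n).measurable.comp (by fun_prop :
            Measurable fun p : RoundData X × (ℕ → X × X) => (α, p.1))).prodMk
            (by fun_prop))).aemeasurable
    rw [hreal, hideal, ih hF1m]

/-- Expectations of functions of the memory may be computed for the idealised algorithm. -/
theorem integral_state_eq (j : ℕ) {F : State X K → ℝ}
    (hF : Measurable fun h => F (stateOf E P h j)) :
    ∫ ω, F (state E P ω j) ∂E.prob = ∫ ω, F (idealState E P ω j) ∂E.idealProb := by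
  -- Some context is needed to pad truncated histories. The padding is never read, since the memory
  -- after `j` pairs uses only the first `j` entries.
  obtain ⟨c⟩ := E.contextLaw.nonempty_of_neZero
  set d : Feedback X K := (none, true, c, c) with hd
  have h1 : Measurable fun ω => truncHistory d j (history E P ω) :=
    (measurable_truncHistory d j).comp (measurable_history E P)
  have h2 : Measurable fun ω => truncHistory d j (idealHistory E P ω) :=
    (measurable_truncHistory d j).comp (measurable_idealHistory E P)
  have hlaw : E.prob.map (fun ω => truncHistory d j (history E P ω)) =
      E.idealProb.map (fun ω => truncHistory d j (idealHistory E P ω)) := by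
    refine Measure.ext_of_lintegral _ fun F hF => ?_
    rw [lintegral_map hF h1, lintegral_map hF h2]
    exact lintegral_truncHistory E P d j hF
  have e1 : ∀ ω, F (state E P ω j) = F (stateOf E P (truncHistory d j (history E P ω)) j) :=
    fun ω => by rw [stateOf_truncHistory, ← state_eq_stateOf]
  have e2 : ∀ ω, F (idealState E P ω j) =
      F (stateOf E P (truncHistory d j (idealHistory E P ω)) j) :=
    fun ω => by rw [stateOf_truncHistory, ← idealState_eq_stateOf]
  simp only [e1, e2]
  rw [← integral_map (f := fun h => F (stateOf E P h j)) h1.aemeasurable hF.aestronglyMeasurable,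
    ← integral_map (f := fun h => F (stateOf E P h j)) h2.aemeasurable hF.aestronglyMeasurable,
    hlaw]

end History

/-! ### The expected regret in terms of the idealised memory. -/

section RegretDecomposition

variable {X : Type u} [MeasurableSpace X] {K : ℕ} [NeZero K] (E : Environment X K) (P : Params)

theorem integral_sample {q : Fin K → ℝ} (hq : ∀ k, 0 ≤ q k) (hs : ∑ k, q k = 1)
    (G : Fin K → ℝ) : ∫ u : unitInterval, G (sample q u) = ∑ k, q k * G k := by
  have hm : Measurable fun u : unitInterval => sample q (u : ℝ) :=
    measurable_sample (fun k => measurable_const) measurable_subtype_coe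
  rw [← integral_map (f := G) hm.aemeasurable (measurable_of_countable G).aestronglyMeasurable,
    integral_fintype (Integrable.of_finite)]
  refine Finset.sum_congr rfl fun k _ => ?_
  rw [map_measureReal_apply hm (measurableSet_singleton k), smul_eq_mul]
  congr 1
  have := volume_sample_eq hq hs k
  rw [measureReal_def]
  have h2 : (fun u : unitInterval => sample q (u : ℝ)) ⁻¹' {k} =
    {u : unitInterval | sample q u = k} := rfl
  rw [h2, this, ENNReal.toReal_ofReal (hq k)]

omit [NeZero K] in
theorem integral_roundLaw_context_seed (ν : Measure X) [IsProbabilityMeasure ν]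
    {F : X × unitInterval → ℝ} (hF : Measurable F) (hb : ∀ z, 0 ≤ F z ∧ F z ≤ 1) :
    ∫ r, F (r.1, r.2.1) ∂(roundLaw ν) = ∫ c, (∫ u : unitInterval, F (c, u)) ∂ν := by
  have hi : Integrable (fun r : RoundData X => F (r.1, r.2.1)) (roundLaw ν) :=
    integrable_of_mem_Icc (by fun_prop) fun r => hb _
  unfold roundLaw at hi ⊢
  rw [integral_prod _ hi]
  refine integral_congr_ae (ae_of_all _ fun c => ?_)
  simp only
  rw [integral_prod]
  · simp
  · exact integrable_of_mem_Icc (by fun_prop) fun r => hb _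

/-- The expected loss of the arm played in context `c`. -/
def State.playLoss (st : State X K) (t : ℕ) (c : X) : ℝ :=
  ∑ k, st.play E P t c k * E.loss t k c

variable {E}

theorem State.Valid.playLoss_mem {st : State X K} (h : st.Valid E) (t : ℕ) (c : X) :
    0 ≤ st.playLoss E P t c ∧ st.playLoss E P t c ≤ 1 := by
  obtain ⟨h0, h1, -⟩ := h.play_mem P t c
  refine ⟨Finset.sum_nonneg fun k _ => mul_nonneg (h0 k) (E.loss_nonneg t k c), ?_⟩
  rw [← h1]
  exact Finset.sum_le_sum fun k _ => mul_le_of_le_one_right (h0 k) (E.loss_le_one t k c)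

variable (E)

theorem measurable_playLoss {Z : Type*} [MeasurableSpace Z] {st : Z → State X K}
    (h : MeasurableFamily st) (t : ℕ) :
    Measurable fun z : Z × X => (st z.1).playLoss E P t z.2 :=
  Finset.measurable_sum _ fun k _ =>
    (h.play t k).mul ((E.measurable_loss t k).comp measurable_snd)

theorem valid_state (ω : ℕ → RoundData X) (j : ℕ) : (state E P ω j).Valid E := by
  rw [state_eq_stateOf]; exact valid_stateOf E P _ j

/-- Redrawing round `t` does not affect the memory at the start of its pair, so the context is fresh
and the seed samples from `play`. What is left is a function of the memory, and its expectation may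
be computed for the idealised algorithm. -/
theorem integral_playedLoss (t : ℕ) :
    ∫ ω, E.loss t (playedArm E P ω t) (context ω t) ∂E.prob =
      ∫ ω, ∫ c, (idealState E P ω (t / 2)).playLoss E P t c ∂E.contextLaw ∂E.idealProb := by
  set ν := E.contextLaw with hν
  have hm : Measurable fun ω => E.loss t (playedArm E P ω t) (context ω t) :=
    measurable_at_arm (fun k => (E.measurable_loss t k).comp (measurable_context t))
      (measurable_playedArm E P t)
  have hi : Integrable (fun ω => E.loss t (playedArm E P ω t) (context ω t)) E.prob :=
    integrable_of_mem_Icc hm fun ω => ⟨E.loss_nonneg _ _ _, E.loss_le_one _ _ _⟩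
  have hE : E.prob = iidLaw (roundLaw ν) := rfl
  rw [hE] at hi ⊢
  rw [integral_update _ hi t]
  have hstep : ∀ ω : ℕ → RoundData X, ∫ y, E.loss t
      (playedArm E P (Function.update ω t y) t) (context (Function.update ω t y) t)
      ∂(roundLaw ν) = ∫ c, (state E P ω (t / 2)).playLoss E P t c ∂ν := by
    intro ω
    set st := state E P ω (t / 2) with hst
    have hv : st.Valid E := valid_state E P ω _
    have hfam : MeasurableFamily fun _ : X × unitInterval => st :=
      (measurableFamily_state E P (t / 2)).comp (g := fun _ => ω) measurable_const
    have h1 : ∀ y, E.loss t (playedArm E P (Function.update ω t y) t)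
        (context (Function.update ω t y) t) =
        E.loss t (sample (st.play E P t y.1) y.2.1) y.1 := by
      intro y
      have hs : state E P (Function.update ω t y) (t / 2) = st :=
        state_congr E P fun i hi => by rw [Function.update_of_ne (by omega)]
      simp only [playedArm, State.arm, context, armSeed, Function.update_self, hs]
    simp only [h1]
    have hmF : Measurable fun z : X × unitInterval =>
        E.loss t (sample (st.play E P t z.1) z.2) z.1 :=
      measurable_at_arm (fun k => (E.measurable_loss t k).comp measurable_fst)
        (measurable_sample (fun k => measurable_at (hfam.play t k) measurable_fst)
          (measurable_subtype_coe.comp measurable_snd))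
    rw [integral_roundLaw_context_seed ν (F := fun z : X × unitInterval =>
      E.loss t (sample (st.play E P t z.1) z.2) z.1) hmF
      fun z => ⟨E.loss_nonneg _ _ _, E.loss_le_one _ _ _⟩]
    refine integral_congr_ae (ae_of_all _ fun c => ?_)
    obtain ⟨h0, h1, -⟩ := hv.play_mem P t c
    exact integral_sample h0 h1 fun k => E.loss t k c
  simp only [hstep]
  refine integral_state_eq E P (t / 2) (F := fun st => ∫ c, st.playLoss E P t c ∂ν) ?_
  exact (measurable_playLoss E P (measurableFamily_stateOf E P (t / 2)) t).stronglyMeasurable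
    |>.integral_prod_right'.measurable

theorem integral_policyLoss (π : E.Policy) (t : ℕ) :
    ∫ ω, E.loss t (π.1 (context ω t)) (context ω t) ∂E.prob =
      ∫ c, E.loss t (π.1 c) c ∂E.contextLaw := by
  have hm : Measurable fun c => E.loss t (π.1 c) c :=
    measurable_at_arm (fun k => E.measurable_loss t k) π.2.1
  have hE : E.prob = iidLaw (roundLaw E.contextLaw) := rfl
  rw [hE]
  have h1 := integral_eval (roundLaw E.contextLaw)
    (h := fun r : RoundData X => E.loss t (π.1 r.1) r.1) (hm.comp measurable_fst) t
  refine h1.trans ?_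
  have := integral_roundLaw_context_seed E.contextLaw
    (F := fun z : X × unitInterval => E.loss t (π.1 z.1) z.1) (hm.comp measurable_fst)
    fun z => ⟨E.loss_nonneg _ _ _, E.loss_le_one _ _ _⟩
  simpa using this

/-- The sum of the losses in a pair of rounds. -/
def Environment.pairLoss (j : ℕ) (k : Fin K) (c : X) : ℝ :=
  E.loss (2 * j) k c + E.loss (2 * j + 1) k c

/-- The expected regret in the pair of rounds `{2j, 2j+1}` in context `c`. -/
def State.pairRegret (st : State X K) (π : E.Policy) (j : ℕ) (c : X) : ℝ :=
  ∑ k, st.play E P (2 * j) c k * E.pairLoss j k c - E.pairLoss j (π.1 c) c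

/-- The expected regret is a sum over pairs of rounds of the idealised algorithm. -/
theorem integral_realizedRegret_le (hL : Even P.L) (T : ℕ) (π : E.Policy) :
    ∫ ω, realizedRegret E P T π ω ∂E.prob ≤ 1 + ∑ j ∈ Finset.range (T / 2),
      ∫ ω, ∫ c, (idealState E P ω j).pairRegret E P π j c ∂E.contextLaw ∂E.idealProb := by
  set ν := E.contextLaw with hν
  set R : ℕ → ℝ := fun t => ∫ ω, (E.loss t (playedArm E P ω t) (context ω t)
    - E.loss t (π.1 (context ω t)) (context ω t)) ∂E.prob with hR
  have hmA : ∀ t, Measurable fun ω => E.loss t (playedArm E P ω t) (context ω t) := fun t =>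
    measurable_at_arm (fun k => (E.measurable_loss t k).comp (measurable_context t))
      (measurable_playedArm E P t)
  have hmπ : ∀ t, Measurable fun ω : ℕ → RoundData X =>
      E.loss t (π.1 (context ω t)) (context ω t) := fun t =>
    measurable_at_arm (fun k => (E.measurable_loss t k).comp (measurable_context t))
      (π.2.1.comp (measurable_context t))
  have hiA : ∀ t, Integrable (fun ω => E.loss t (playedArm E P ω t) (context ω t)) E.prob :=
    fun t => integrable_of_mem_Icc (hmA t) fun ω => ⟨E.loss_nonneg _ _ _, E.loss_le_one _ _ _⟩
  have hiπ : ∀ t, Integrable (fun ω : ℕ → RoundData X =>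
      E.loss t (π.1 (context ω t)) (context ω t)) E.prob := fun t =>
    integrable_of_mem_Icc (hmπ t) fun ω => ⟨E.loss_nonneg _ _ _, E.loss_le_one _ _ _⟩
  have hsum : ∫ ω, realizedRegret E P T π ω ∂E.prob = ∑ t ∈ Finset.range T, R t := by
    unfold realizedRegret
    have hi : ∀ t, Integrable (fun ω => E.loss t (playedArm E P ω t) (context ω t)
      - E.loss t (π.1 (context ω t)) (context ω t)) E.prob := fun t => (hiA t).sub (hiπ t)
    rw [integral_finsetSum _ fun t _ => hi t]
  have hR1 : ∀ t, R t ≤ 1 := fun t => integral_le_of_le_const zero_le_one fun ω => by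
    linarith [E.loss_nonneg t (π.1 (context ω t)) (context ω t),
      E.loss_le_one t (playedArm E P ω t) (context ω t)]
  have hpair : ∀ m, ∑ t ∈ Finset.range (2 * m), R t =
      ∑ j ∈ Finset.range m, (R (2 * j) + R (2 * j + 1)) := by
    intro m
    induction m with
    | zero => simp
    | succ m ih =>
      rw [Finset.sum_range_succ, ← ih, show 2 * (m + 1) = 2 * m + 1 + 1 by ring,
        Finset.sum_range_succ, Finset.sum_range_succ, add_assoc]
  have hRj : ∀ j, R (2 * j) + R (2 * j + 1) =
      ∫ ω, ∫ c, (idealState E P ω j).pairRegret E P π j c ∂ν ∂E.idealProb := by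
    intro j
    have hRt : ∀ t, R t = ∫ ω, ∫ c, ((idealState E P ω (t / 2)).playLoss E P t c
        - E.loss t (π.1 c) c) ∂ν ∂E.idealProb := by
      intro t
      have hfam := measurableFamily_idealState E P (t / 2)
      have hmp := measurable_playLoss E P hfam t
      have hip : ∀ ω, Integrable (fun c => (idealState E P ω (t / 2)).playLoss E P t c) ν :=
        fun ω => integrable_of_mem_Icc (hmp.comp (f := fun c => (ω, c)) (by fun_prop))
          fun c => (valid_idealState E P ω _).playLoss_mem P t c
      have hil : Integrable (fun c => E.loss t (π.1 c) c) ν :=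
        integrable_of_mem_Icc (measurable_at_arm (fun k => E.measurable_loss t k) π.2.1)
          fun c => ⟨E.loss_nonneg _ _ _, E.loss_le_one _ _ _⟩
      have h1 : ∀ ω, ∫ c, ((idealState E P ω (t / 2)).playLoss E P t c
        - E.loss t (π.1 c) c) ∂ν = ∫ c, (idealState E P ω (t / 2)).playLoss E P t c ∂ν -
          ∫ c, E.loss t (π.1 c) c ∂ν := fun ω => integral_sub (hip ω) hil
      simp only [h1]
      rw [hR]
      simp only
      rw [integral_sub (hiA t) (hiπ t), integral_playedLoss, integral_policyLoss, integral_sub]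
      · rw [integral_const, probReal_univ, one_smul]
      · refine integrable_of_mem_Icc (a := 0) (b := 1)
          hmp.stronglyMeasurable.integral_prod_right'.measurable fun ω => ⟨?_, ?_⟩
        · exact integral_nonneg fun c => ((valid_idealState E P ω _).playLoss_mem P t c).1
        · exact integral_le_of_le_const zero_le_one
            fun c => ((valid_idealState E P ω _).playLoss_mem P t c).2
      · exact integrable_const _
    have hfam := measurableFamily_idealState E P j
    have hmD : ∀ t, Measurable fun z : IdealData X × X =>
        (idealState E P z.1 j).playLoss E P t z.2 - E.loss t (π.1 z.2) z.2 := fun t =>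
      (measurable_playLoss E P hfam t).sub ((measurable_at_arm (fun k => E.measurable_loss t k)
        π.2.1).comp measurable_snd)
    have hbD : ∀ t (z : IdealData X × X), -1 ≤
        (idealState E P z.1 j).playLoss E P t z.2 - E.loss t (π.1 z.2) z.2 ∧
        (idealState E P z.1 j).playLoss E P t z.2 - E.loss t (π.1 z.2) z.2 ≤ 1 := by
      intro t z
      have h1 := (valid_idealState E P z.1 j).playLoss_mem P t z.2
      constructor <;> linarith [E.loss_nonneg t (π.1 z.2) z.2, E.loss_le_one t (π.1 z.2) z.2]
    have hic : ∀ t ω, Integrable (fun c => (idealState E P ω j).playLoss E P t c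
        - E.loss t (π.1 c) c) ν := fun t ω =>
      integrable_of_mem_Icc ((hmD t).comp (f := fun c => (ω, c)) (by fun_prop))
        fun c => hbD t (ω, c)
    have hio : ∀ t, Integrable (fun ω => ∫ c, ((idealState E P ω j).playLoss E P t c
        - E.loss t (π.1 c) c) ∂ν) E.idealProb := fun t =>
      (integrable_of_mem_Icc (P := E.idealProb.prod ν) (hmD t) (hbD t)).integral_prod_left
    rw [hRt, hRt, show 2 * j / 2 = j by omega, show (2 * j + 1) / 2 = j by omega,
      ← integral_add (hio _) (hio _)]
    refine integral_congr_ae (ae_of_all _ fun ω => ?_)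
    simp only
    rw [← integral_add (hic _ ω) (hic _ ω)]
    refine integral_congr_ae (ae_of_all _ fun c => ?_)
    -- As `L` is even, the two rounds of a pair lie on the same side of the end of the first epoch.
    have hplay : (idealState E P ω j).play E P (2 * j + 1) =
        (idealState E P ω j).play E P (2 * j) := by
      obtain ⟨m, hm⟩ := hL
      exact State.play_congr E P _ (by omega)
    simp only [State.playLoss, State.pairRegret, Environment.pairLoss, hplay, mul_add,
      Finset.sum_add_distrib]
    ring
  rw [hsum]
  have hT : Finset.range T = Finset.range (2 * (T / 2) + T % 2) := by
    congr 1; omega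
  rw [hT, ← Finset.sum_congr rfl fun j _ => hRj j, ← hpair]
  -- For odd `T` the unpaired last round costs at most 1.
  rcases Nat.mod_two_eq_zero_or_one T with h | h
  · rw [h, add_zero]; linarith
  · rw [h, Finset.sum_range_succ]; linarith [hR1 (2 * (T / 2))]

end RegretDecomposition

/-! ### Structure of an epoch of `n = L / 2` pairs, numbered from 0. -/

section Epochs

variable {X : Type u} [MeasurableSpace X] {K : ℕ} [NeZero K] (E : Environment X K) (P : Params)

/-- The selection made in a pair of rounds of the idealised algorithm. -/
def selection (ω : IdealData X) (j : ℕ) : Option (Fin K) :=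
  idealPick (idealState E P ω j).snap (ω.1 j)

/-- The numerator of the loss estimate of a pair of rounds. -/
def selLoss (ω : IdealData X) (j : ℕ) (c : X) (k : Fin K) : ℝ :=
  if selection E P ω j = some k then
    2 * E.loss (if (ω.1 j).2.2.1 then 2 * j + 1 else 2 * j) k c else 0

/-- The indicator that an arm is selected. -/
def selInd (ω : IdealData X) (j : ℕ) (k : Fin K) : ℝ :=
  if selection E P ω j = some k then 1 else 0

/-- The loss estimate of a pair of rounds of the idealised algorithm. -/
def lossEst (ω : IdealData X) (j : ℕ) (c : X) (k : Fin K) : ℝ :=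
  if 2 * j < P.L then 0
  else selLoss E P ω j c k / ((idealState E P ω j).freq k + 3 / 2 * P.γ)

theorem selInd_nonneg (ω : IdealData X) (j : ℕ) (k : Fin K) : 0 ≤ selInd E P ω j k := by
  unfold selInd; split_ifs <;> norm_num

theorem selLoss_nonneg (ω : IdealData X) (j : ℕ) (c : X) (k : Fin K) :
    0 ≤ selLoss E P ω j c k := by
  unfold selLoss
  split_ifs
  · exact mul_nonneg zero_le_two (E.loss_nonneg _ _ _)
  · exact mul_nonneg zero_le_two (E.loss_nonneg _ _ _)
  · exact le_rfl

theorem selLoss_le (ω : IdealData X) (j : ℕ) (c : X) (k : Fin K) :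
    selLoss E P ω j c k ≤ 2 * selInd E P ω j k := by
  unfold selLoss selInd
  by_cases h : selection E P ω j = some k
  · simp only [h, if_true]
    exact mul_le_mul_of_nonneg_left (E.loss_le_one _ _ _) zero_le_two
  · simp [h]

theorem cumLoss_succ (ω : IdealData X) (j : ℕ) (c : X) (k : Fin K) :
    (idealState E P ω (j + 1)).cumLoss c k =
      (idealState E P ω j).cumLoss c k + lossEst E P ω j c k := by
  have h : (idealState E P ω (j + 1)).cumLoss c k = ((idealState E P ω j).absorb E P j
      ((idealState E P ω j).idealFeedback P j (ω.1 j) (ω.2 j))).cumLoss c k := by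
    rw [idealState, State.feed]; split_ifs <;> rfl
  rw [h, State.absorb]
  simp only [lossEst, State.estimate, selLoss, selection, State.idealFeedback]
  congr 1
  by_cases hj : 2 * j < P.L
  · simp [hj]
  · simp only [hj, if_false]
    split_ifs <;> simp_all

theorem freqTerm_mem {s : X → Fin K → ℝ} {k : Fin K} (h0 : ∀ c, 0 ≤ s c k)
    (h1 : ∀ c, s c k ≤ 1) (j : ℕ) (z : X × X) :
    0 ≤ freqTerm P s j z k ∧ freqTerm P s j z k ≤ 1 / 2 := by
  unfold freqTerm
  split_ifs
  · constructor <;> linarith [h0 z.1, h0 z.2, h1 z.1, h1 z.2]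
  · constructor <;> linarith [h0 z.1, h1 z.1]

omit [NeZero K] [MeasurableSpace X] in
theorem le_one_of_mem_simplexOn {A : Finset (Fin K)} {x : Fin K → ℝ} (h : x ∈ simplexOn A)
    (k : Fin K) : x k ≤ 1 := by
  rw [← h.2.1]
  exact Finset.single_le_sum (f := x) (fun i _ => h.1 i) (Finset.mem_univ k)

variable {P} {n : ℕ}

theorem idealState_succ_of_not_dvd (hL : P.L = 2 * n) (ω : IdealData X) {j : ℕ}
    (hj : ¬ n ∣ j + 1) : idealState E P ω (j + 1) = (idealState E P ω j).absorb E P j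
      ((idealState E P ω j).idealFeedback P j (ω.1 j) (ω.2 j)) := by
  have : ¬ P.L ∣ 2 * j + 2 := by
    rw [hL, show 2 * j + 2 = 2 * (j + 1) by ring, Nat.mul_dvd_mul_iff_left two_pos]; exact hj
  rw [idealState, State.feed, if_neg this]

theorem idealState_succ_of_dvd (hL : P.L = 2 * n) (ω : IdealData X) {j : ℕ} (hj : n ∣ j + 1) :
    idealState E P ω (j + 1) =
      { cumLoss := (idealState E P ω (j + 1)).cumLoss
        snap := (idealState E P ω j).nextSnap
        nextSnap := (idealState E P ω j).ftrl E P
        freq := fun k => (idealState E P ω j).nextFreq k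
          + freqTerm P (idealState E P ω j).nextSnap j (ω.2 j) k / n
        nextFreq := fun _ => 0 } := by
  have h1 : P.L ∣ 2 * j + 2 := by
    rw [hL, show 2 * j + 2 = 2 * (j + 1) by ring, Nat.mul_dvd_mul_iff_left two_pos]; exact hj
  have h2 : ((P.L : ℝ) / 2) = n := by rw [hL]; push_cast; ring
  rw [idealState, State.feed, if_pos h1]
  congr 1
  funext k
  simp only [State.absorb, h2]
  congr 2
  unfold State.idealFeedback freqTerm
  split_ifs <;> rfl

theorem not_dvd_of_lt {e i : ℕ} (hi : i + 1 < n) : ¬ n ∣ e * n + i + 1 := by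
  intro h
  rw [add_assoc, Nat.dvd_add_right (Dvd.intro_left e rfl)] at h
  exact absurd (Nat.le_of_dvd (by omega) h) (by omega)

theorem epoch_constant (hL : P.L = 2 * n) (ω : IdealData X) (e : ℕ) {i : ℕ} (hi : i < n) :
    (idealState E P ω (e * n + i)).snap = (idealState E P ω (e * n)).snap ∧
    (idealState E P ω (e * n + i)).nextSnap = (idealState E P ω (e * n)).nextSnap ∧
    (idealState E P ω (e * n + i)).freq = (idealState E P ω (e * n)).freq := by
  induction i with
  | zero => exact ⟨rfl, rfl, rfl⟩
  | succ i ih =>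
    have h := idealState_succ_of_not_dvd E hL ω (not_dvd_of_lt (e := e) hi)
    rw [← add_assoc, h]
    exact ih (by omega)

theorem snap_epoch (hL : P.L = 2 * n) (hn : 0 < n) (ω : IdealData X) (j : ℕ) :
    (idealState E P ω j).snap = (idealState E P ω (j / n * n)).snap := by
  conv_lhs => rw [← Nat.div_add_mod' j n]
  exact (epoch_constant E hL ω _ (Nat.mod_lt j hn)).1

theorem freq_epoch (hL : P.L = 2 * n) (hn : 0 < n) (ω : IdealData X) (j : ℕ) :
    (idealState E P ω j).freq = (idealState E P ω (j / n * n)).freq := by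
  conv_lhs => rw [← Nat.div_add_mod' j n]
  exact (epoch_constant E hL ω _ (Nat.mod_lt j hn)).2.2

theorem nextFreq_epoch_start (hL : P.L = 2 * n) (hn : 0 < n) (ω : IdealData X) (e : ℕ) (k : Fin K) :
    (idealState E P ω (e * n)).nextFreq k = 0 := by
  cases e with
  | zero => simp [idealState, initState]
  | succ e =>
    have h1 : (e + 1) * n = ((e + 1) * n - 1) + 1 := by
      have : 0 < (e + 1) * n := by positivity
      omega
    rw [h1, idealState_succ_of_dvd E hL ω (by rw [← h1]; exact Dvd.intro_left _ rfl)]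

theorem nextFreq_epoch (hL : P.L = 2 * n) (hn : 0 < n) (ω : IdealData X) (e : ℕ) {i : ℕ}
    (hi : i < n) (k : Fin K) :
    (idealState E P ω (e * n + i)).nextFreq k = (∑ m ∈ Finset.Ico (e * n) (e * n + i),
      freqTerm P (idealState E P ω (e * n)).nextSnap m (ω.2 m) k) / n := by
  induction i with
  | zero => simp [nextFreq_epoch_start E hL hn]
  | succ i ih =>
    have h2 : ((P.L : ℝ) / 2) = n := by rw [hL]; push_cast; ring
    rw [← add_assoc, idealState_succ_of_not_dvd E hL ω (not_dvd_of_lt (e := e) hi),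
      Finset.sum_Ico_succ_top (by omega), add_div, ← ih (by omega)]
    simp only [State.absorb, h2, (epoch_constant E hL ω e (show i < n by omega)).2.1]
    congr 2
    unfold State.idealFeedback freqTerm
    split_ifs <;> rfl

/-- The new second snapshot is the FTRL distribution of the last pair before the feedback of that
pair is added. This off-by-one costs one single loss estimate in `snapshots_close`. -/
theorem epoch_succ (hL : P.L = 2 * n) (hn : 0 < n) (ω : IdealData X) (e : ℕ) :
    (idealState E P ω ((e + 1) * n)).snap = (idealState E P ω (e * n)).nextSnap ∧
    (idealState E P ω ((e + 1) * n)).nextSnap =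
      (idealState E P ω (e * n + (n - 1))).ftrl E P ∧
    ∀ k, (idealState E P ω ((e + 1) * n)).freq k =
      (∑ m ∈ Finset.Ico (e * n) ((e + 1) * n),
        freqTerm P (idealState E P ω ((e + 1) * n)).snap m (ω.2 m) k) / n := by
  have h1 : (e + 1) * n = (e * n + (n - 1)) + 1 := by
    rw [add_mul, one_mul]; omega
  have hd : n ∣ (e * n + (n - 1)) + 1 := by rw [← h1]; exact Dvd.intro_left _ rfl
  have hc := (epoch_constant E hL ω e (show n - 1 < n by omega)).2.1
  rw [h1, idealState_succ_of_dvd E hL ω hd]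
  refine ⟨hc, rfl, fun k => ?_⟩
  simp only
  rw [hc, nextFreq_epoch E hL hn ω e (by omega), Finset.sum_Ico_succ_top (by omega), add_div]

theorem freq_nonneg (hL : P.L = 2 * n) (hn : 0 < n) (ω : IdealData X) (j : ℕ) (k : Fin K) :
    0 ≤ (idealState E P ω j).freq k := by
  rw [freq_epoch E hL hn]
  cases j / n with
  | zero => simp [idealState, initState]
  | succ e =>
    rw [(epoch_succ E hL hn ω e).2.2 k]
    have hv := valid_idealState E P ω ((e + 1) * n)
    exact div_nonneg (Finset.sum_nonneg fun m _ => (freqTerm_mem P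
      (fun c => (hv.snap_mem c).1 k) (fun c => le_one_of_mem_simplexOn (hv.snap_mem c) k) _ _).1)
      (Nat.cast_nonneg n)

theorem lossEst_nonneg (hL : P.L = 2 * n) (hn : 0 < n) (hγ : 0 < P.γ) (ω : IdealData X) (j : ℕ)
    (c : X) (k : Fin K) : 0 ≤ lossEst E P ω j c k := by
  unfold lossEst
  split_ifs
  · exact le_rfl
  · have := freq_nonneg E hL hn ω j k
    exact div_nonneg (selLoss_nonneg E P ω j c k) (by positivity)

theorem lossEst_le (hL : P.L = 2 * n) (hn : 0 < n) (hγ : 0 < P.γ) (ω : IdealData X) (j : ℕ)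
    (c : X) (k : Fin K) : lossEst E P ω j c k ≤ 4 / (3 * P.γ) := by
  unfold lossEst
  split_ifs
  · positivity
  · have h0 := freq_nonneg E hL hn ω j k
    have h1 := selLoss_le E P ω j c k
    have h2 : selInd E P ω j k ≤ 1 := by unfold selInd; split_ifs <;> norm_num
    rw [div_le_div_iff₀ (by positivity) (by positivity)]
    nlinarith

/-- The cumulative loss estimates within an epoch other than the first. -/
theorem cumLoss_epoch (hL : P.L = 2 * n) (ω : IdealData X) (e : ℕ) {i : ℕ} (hi : i ≤ n) (c : X)
    (k : Fin K) :
    (idealState E P ω ((e + 1) * n + i)).cumLoss c k =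
      (idealState E P ω ((e + 1) * n)).cumLoss c k +
        (∑ m ∈ Finset.Ico ((e + 1) * n) ((e + 1) * n + i), selLoss E P ω m c k) /
          ((idealState E P ω ((e + 1) * n)).freq k + 3 / 2 * P.γ) := by
  induction i with
  | zero => simp
  | succ i ih =>
    have hj : ¬ 2 * ((e + 1) * n + i) < P.L := by
      rw [hL, add_mul, one_mul]
      have : 0 ≤ e * n := Nat.zero_le _
      omega
    rw [← add_assoc, cumLoss_succ, ih (by omega), Finset.sum_Ico_succ_top (by omega), add_div,
      lossEst, if_neg hj, (epoch_constant E hL ω (e + 1) (show i < n by omega)).2.2]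
    ring

theorem cumLoss_first_epoch (hL : P.L = 2 * n) (ω : IdealData X) {i : ℕ} (hi : i ≤ n) (c : X)
    (k : Fin K) : (idealState E P ω i).cumLoss c k = 0 := by
  induction i with
  | zero => simp [idealState, initState]
  | succ i ih =>
    rw [cumLoss_succ, ih (by omega), lossEst, if_pos (by omega), add_zero]

/-- The memory is the same up to the partial frequency estimate. -/
structure State.AgreeExceptNextFreq (st st' : State X K) : Prop where
  cumLoss : st.cumLoss = st'.cumLoss
  snap : st.snap = st'.snap
  nextSnap : st.nextSnap = st'.nextSnap
  freq : st.freq = st'.freq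

theorem selLoss_congr {ω ω' : IdealData X} (h1 : ω.1 = ω'.1) {j : ℕ}
    (hs : selection E P ω j = selection E P ω' j) : selLoss E P ω j = selLoss E P ω' j := by
  funext c k
  unfold selLoss
  rw [h1, hs]

theorem lossEst_congr {ω ω' : IdealData X} (h1 : ω.1 = ω'.1) {j : ℕ}
    (hs : (idealState E P ω j).snap = (idealState E P ω' j).snap)
    (hf : (idealState E P ω j).freq = (idealState E P ω' j).freq) :
    lossEst E P ω j = lossEst E P ω' j := by
  funext c k
  have : selection E P ω j = selection E P ω' j := by
    unfold selection
    rw [h1, hs]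
  unfold lossEst
  rw [selLoss_congr E h1 this, hf]

/-- The contexts for the frequency estimates of an epoch do not influence the rest of the
epoch. -/
theorem idealState_agree (hL : P.L = 2 * n) {ω ω' : IdealData X} (h1 : ω.1 = ω'.1) {e : ℕ}
    (h2 : ∀ i < e * n, ω.2 i = ω'.2 i) {i : ℕ} (hi : i < n) :
    (idealState E P ω (e * n + i)).AgreeExceptNextFreq (idealState E P ω' (e * n + i)) := by
  induction i with
  | zero =>
    rw [add_zero, idealState_congr E P (fun i _ => by rw [h1]) h2]
    exact ⟨rfl, rfl, rfl, rfl⟩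
  | succ i ih =>
    obtain ⟨ha, hb, hc, hd⟩ := ih (by omega)
    have h := fun ω => idealState_succ_of_not_dvd E hL ω (not_dvd_of_lt (e := e) hi)
    have hcum : ∀ c k, (idealState E P ω (e * n + i + 1)).cumLoss c k =
        (idealState E P ω' (e * n + i + 1)).cumLoss c k := by
      intro c k
      rw [cumLoss_succ, cumLoss_succ, ha, lossEst_congr E h1 hb hd]
    refine ⟨funext fun c => funext fun k => hcum c k, ?_, ?_, ?_⟩
    · rw [← add_assoc, h, h]; exact hb
    · rw [← add_assoc, h, h]; exact hc
    · rw [← add_assoc, h, h]; exact hd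

/-- At the end of an epoch its frequency contexts have not yet been used in any loss estimate, and
the snapshot now becoming active was already fixed when the epoch began. -/
theorem idealState_agree_next (hL : P.L = 2 * n) (hn : 0 < n) {ω ω' : IdealData X}
    (h1 : ω.1 = ω'.1) {e : ℕ} (h2 : ∀ i < e * n, ω.2 i = ω'.2 i) :
    (idealState E P ω ((e + 1) * n)).cumLoss = (idealState E P ω' ((e + 1) * n)).cumLoss ∧
    (idealState E P ω ((e + 1) * n)).snap = (idealState E P ω' ((e + 1) * n)).snap := by
  obtain ⟨ha, hb, hc, hd⟩ := idealState_agree E hL h1 h2 (show n - 1 < n by omega)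
  have h3 : (e + 1) * n = (e * n + (n - 1)) + 1 := by
    rw [add_mul, one_mul]; omega
  constructor
  · funext c k
    rw [h3, cumLoss_succ, cumLoss_succ, ha, lossEst_congr E h1 hb hd]
  · rw [(epoch_succ E hL hn ω e).1, (epoch_succ E hL hn ω' e).1,
      idealState_congr E P (fun i _ => by rw [h1]) h2]

/-- A selection reads only the snapshot and its own round. Snapshots are known an epoch ahead, so
redrawn contexts of epoch `e` cannot alter a selection before the end of epoch `e + 1`. This delay
is why two snapshots are kept. -/
theorem selection_agree (hL : P.L = 2 * n) (hn : 0 < n) {ω ω' : IdealData X}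
    (h1 : ω.1 = ω'.1) {e : ℕ} (h2 : ∀ i < e * n, ω.2 i = ω'.2 i) {j : ℕ}
    (hj : j < (e + 2) * n) : selection E P ω j = selection E P ω' j := by
  unfold selection
  rw [h1, snap_epoch E hL hn ω, snap_epoch E hL hn ω']
  have he : j / n < e + 2 := by rwa [Nat.div_lt_iff_lt_mul hn]
  have hs : (idealState E P ω (j / n * n)).snap = (idealState E P ω' (j / n * n)).snap := by
    rcases Nat.lt_or_ge (j / n) (e + 1) with h | h
    · have := Nat.mul_le_mul_right n (Nat.lt_succ_iff.1 h)
      rw [idealState_congr E P (fun i _ => by rw [h1]) fun i hi => h2 i (by omega)]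
    · rw [show j / n = e + 1 by omega]
      exact (idealState_agree_next E hL hn h1 h2).2
  rw [hs]

end Epochs

/-! ### The good event and the stability of FTRL on it. -/

section GoodEvent

variable {X : Type u} [MeasurableSpace X] {K : ℕ} [NeZero K] (E : Environment X K) (P : Params)

/-- The probability that an arm is selected in a pair of rounds with snapshot `s`. -/
def trueFreq (s : X → Fin K → ℝ) (k : Fin K) : ℝ := (∫ c, s c k ∂E.contextLaw) / 2

/-- The frequency estimates are not much too small. -/
def State.FreqGood (st : State X K) : Prop :=
  ∀ k, 7 / 8 * trueFreq E st.snap k - P.γ / 2 ≤ st.freq k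

/-- No arm was selected much too often in the current epoch. -/
def SelGood (n : ℕ) (ω : IdealData X) (j : ℕ) : Prop :=
  ∀ k, ∑ m ∈ Finset.Ico (j / n * n) j, selInd E P ω m k ≤
    n * (57 / 50 * trueFreq E (idealState E P ω j).snap k + P.γ / 2)

/-- The good event up to a pair of rounds. -/
def Good (n : ℕ) (ω : IdealData X) (j : ℕ) : Prop :=
  ∀ i ≤ j, n ≤ i → (idealState E P ω i).FreqGood E P ∧ SelGood E P n ω i

/-- The range of the parameters in which the algorithm is analysed. -/
structure Regime (P : Params) (n K : ℕ) (ι : ℝ) : Prop where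
  L_eq : P.L = 2 * n
  n_pos : 0 < n
  η_pos : 0 < P.η
  γ_pos : 0 < P.γ
  γ_le_one : P.γ ≤ 1
  η_le : P.η * (8 * n) ≤ 1
  nγ_ge : 33 ≤ 2 * n * P.γ
  tail : ι ≤ n * P.γ / 8
  union : K * Real.exp (-ι) ≤ P.γ / 8

variable {E P} {n : ℕ} {ι : ℝ}

theorem Good.mono {ω : IdealData X} {i j : ℕ} (h : Good E P n ω j) (hij : i ≤ j) :
    Good E P n ω i := fun m hm => h m (hm.trans hij)

theorem State.Valid.trueFreq_nonneg {st : State X K} (h : st.Valid E) (k : Fin K) :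
    0 ≤ trueFreq E st.snap k :=
  div_nonneg (integral_nonneg fun c => (h.snap_mem c).1 k) zero_le_two

theorem mul_add_epoch_div (hn : 0 < n) {e i : ℕ} (hi : i < n) : (e * n + i) / n = e := by
  rw [mul_comm, Nat.mul_add_div hn, Nat.div_eq_of_lt hi, add_zero]

theorem sum_selLoss_le (h : Regime P n K ι) (ω : IdealData X) (e : ℕ) {i : ℕ} (hi : i < n)
    (hs : SelGood E P n ω ((e + 1) * n + i)) (c : X) (k : Fin K) :
    ∑ m ∈ Finset.Ico ((e + 1) * n) ((e + 1) * n + i), selLoss E P ω m c k ≤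
      2 * (n * (57 / 50 * trueFreq E (idealState E P ω ((e + 1) * n)).snap k + P.γ / 2)) := by
  have h1 := hs k
  rw [mul_add_epoch_div h.n_pos hi, (epoch_constant E h.L_eq ω (e + 1) hi).1] at h1
  refine le_trans ?_ (mul_le_mul_of_nonneg_left h1 zero_le_two)
  rw [Finset.mul_sum]
  exact Finset.sum_le_sum fun m _ => selLoss_le E P ω m c k

theorem sum_selLoss_nonneg (ω : IdealData X) (a b : ℕ) (c : X) (k : Fin K) :
    0 ≤ ∑ m ∈ Finset.Ico a b, selLoss E P ω m c k :=
  Finset.sum_nonneg fun m _ => selLoss_nonneg E P ω m c k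

/-- The denominator is at least `7 / 8 * f + γ`, and 1303/1000 is just above (57/50)/(7/8). The
lower bound on `φ` is the only thing used, so the lemma serves for the estimate and for the true
frequency alike. -/
theorem sum_selLoss_div_le (h : Regime P n K ι) (ω : IdealData X) (e : ℕ) {i : ℕ} (hi : i < n)
    (hs : SelGood E P n ω ((e + 1) * n + i)) (c : X) (k : Fin K) {φ : ℝ}
    (hφ : 7 / 8 * trueFreq E (idealState E P ω ((e + 1) * n)).snap k - P.γ / 2 ≤ φ) :
    (∑ m ∈ Finset.Ico ((e + 1) * n) ((e + 1) * n + i), selLoss E P ω m c k) / (φ + 3 / 2 * P.γ) ≤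
      1303 / 1000 * (2 * n) := by
  have h1 := sum_selLoss_le h ω e hi hs c k
  have hf := (valid_idealState E P ω ((e + 1) * n)).trueFreq_nonneg k
  have hγ := h.γ_pos
  have hn : (0 : ℝ) < n := by exact_mod_cast h.n_pos
  rw [div_le_iff₀ (by linarith)]
  refine h1.trans ?_
  set f := trueFreq E (idealState E P ω ((e + 1) * n)).snap k
  have h2 : 57 / 50 * f + P.γ / 2 ≤ 1303 / 1000 * (φ + 3 / 2 * P.γ) := by linarith
  nlinarith

theorem cumLoss_mono (h : Regime P n K ι) (ω : IdealData X) (j : ℕ) (c : X) (k : Fin K) :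
    (idealState E P ω j).cumLoss c k ≤ (idealState E P ω (j + 1)).cumLoss c k ∧
    (idealState E P ω (j + 1)).cumLoss c k ≤
      (idealState E P ω j).cumLoss c k + 4 / (3 * P.γ) := by
  rw [cumLoss_succ]
  have h1 := lossEst_nonneg E h.L_eq h.n_pos h.γ_pos ω j c k
  have h2 := lossEst_le E h.L_eq h.n_pos h.γ_pos ω j c k
  constructor <;> linarith

theorem cumLoss_epoch_bounds (h : Regime P n K ι) (ω : IdealData X) (e : ℕ) {i : ℕ} (hi : i < n)
    (hs : SelGood E P n ω ((e + 1) * n + i))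
    (hf : (idealState E P ω ((e + 1) * n)).FreqGood E P) (c : X) (k : Fin K) :
    (idealState E P ω ((e + 1) * n)).cumLoss c k ≤
        (idealState E P ω ((e + 1) * n + i)).cumLoss c k ∧
    (idealState E P ω ((e + 1) * n + i)).cumLoss c k ≤
      (idealState E P ω ((e + 1) * n)).cumLoss c k + 1303 / 1000 * (2 * n) := by
  rw [cumLoss_epoch E h.L_eq ω e hi.le]
  have h1 := sum_selLoss_div_le h ω e hi hs c k (hf k)
  have h2 : 0 ≤ (∑ m ∈ Finset.Ico ((e + 1) * n) ((e + 1) * n + i), selLoss E P ω m c k) /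
      ((idealState E P ω ((e + 1) * n)).freq k + 3 / 2 * P.γ) := by
    have := freq_nonneg E h.L_eq h.n_pos ω ((e + 1) * n) k
    have := h.γ_pos
    exact div_nonneg (sum_selLoss_nonneg ω _ _ c k) (by positivity)
  constructor <;> linarith

/-- At the start of an epoch, the snapshots are FTRL distributions of cumulative losses close to the
current one. -/
theorem snapshots_close (h : Regime P n K ι) (ω : IdealData X) (e : ℕ)
    (hg : ∀ i < (e + 1) * n, n ≤ i → (idealState E P ω i).FreqGood E P ∧ SelGood E P n ω i)
    (c : X) : ∃ Λs Λn : Fin K → ℝ,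
      (idealState E P ω ((e + 1) * n)).snap c = ftrlDist P.η (E.active c) Λs ∧
      (idealState E P ω ((e + 1) * n)).nextSnap c = ftrlDist P.η (E.active c) Λn ∧
      ∀ k, Λs k ≤ (idealState E P ω ((e + 1) * n)).cumLoss c k ∧
        (idealState E P ω ((e + 1) * n)).cumLoss c k ≤
          Λs k + (1303 / 1000 * (2 * n) + 2 * (4 / (3 * P.γ))) ∧
        Λn k ≤ (idealState E P ω ((e + 1) * n)).cumLoss c k ∧
        (idealState E P ω ((e + 1) * n)).cumLoss c k ≤ Λn k + 4 / (3 * P.γ) := by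
  have hγ := h.γ_pos
  have hw : 0 ≤ 4 / (3 * P.γ) := by positivity
  have hn := h.n_pos
  induction e with
  | zero =>
    -- No loss is estimated in the first epoch: both snapshots and the current distribution belong
    -- to zero losses.
    obtain ⟨h1, h2, -⟩ := epoch_succ E h.L_eq h.n_pos ω 0
    have h0 := cumLoss_first_epoch E h.L_eq ω (i := (0 + 1) * n) (by simp) c
    refine ⟨fun _ => 0, fun _ => 0, ?_, ?_, fun k => ?_⟩
    · rw [h1, ← uniformOnArms_eq_ftrlDist, zero_mul]; rfl
    · rw [h2, State.ftrl]
      congr 1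
      funext k
      exact cumLoss_first_epoch E h.L_eq ω (by omega) c k
    · rw [h0 k]
      refine ⟨le_rfl, ?_, le_rfl, ?_⟩ <;> positivity
  | succ e ih =>
    obtain ⟨Λs, Λn, -, h2, h3⟩ := ih fun i hi => hg i (by nlinarith)
    obtain ⟨h4, h5, -⟩ := epoch_succ E h.L_eq h.n_pos ω (e + 1)
    have hlast : (e + 1 + 1) * n = ((e + 1) * n + (n - 1)) + 1 := by
      rw [add_mul (e + 1), one_mul]; omega
    have hge : n ≤ (e + 1) * n := by nlinarith
    have hgl := hg ((e + 1) * n + (n - 1)) (by omega) (by omega)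
    have hg0 := hg ((e + 1) * n) (by omega) hge
    -- The old second snapshot becomes active. It lags by one estimate from before, the growth over
    -- the epoch, and the estimate of the last pair, whence one epoch and two single estimates.
    refine ⟨Λn, fun k => (idealState E P ω ((e + 1) * n + (n - 1))).cumLoss c k, ?_, ?_,
      fun k => ?_⟩
    · rw [h4, h2]
    · rw [h5, State.ftrl]
    · obtain ⟨-, -, h6, h7⟩ := h3 k
      obtain ⟨h8, h9⟩ := cumLoss_epoch_bounds h ω e (show n - 1 < n by omega) hgl.2 hg0.1 c k
      obtain ⟨h10, h11⟩ := cumLoss_mono h ω ((e + 1) * n + (n - 1)) c k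
      rw [← hlast] at h10 h11
      refine ⟨?_, ?_, h10, h11⟩ <;> linarith

/-- From `2 * n * γ ≥ 33` a single estimate is at most `8 / 99 * n`, so the growth in question is
below `5.4 * n`. With `η * (8 * n) ≤ 1` the exponent is below 0.68 < log 2, matching the factor 2 in
the test of the algorithm. -/
theorem exp_bound_of_regime (h : Regime P n K ι) :
    Real.exp (P.η * (2 * (1303 / 1000 * (2 * n)) + 2 * (4 / (3 * P.γ)))) ≤ 2 := by
  have hn : (0 : ℝ) < n := by exact_mod_cast h.n_pos
  have hγ := h.γ_pos
  have hw : 4 / (3 * P.γ) ≤ 8 / 99 * n := by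
    rw [div_le_iff₀ (by positivity)]
    have := h.nγ_ge
    nlinarith
  have h1 : P.η * (2 * (1303 / 1000 * (2 * n)) + 2 * (4 / (3 * P.γ))) ≤ 68 / 100 := by
    have h2 : 2 * (1303 / 1000 * (2 * n)) + 2 * (4 / (3 * P.γ)) ≤ 5.4 * n := by linarith
    have h3 := mul_le_mul_of_nonneg_left h2 h.η_pos.le
    have h4 := h.η_le
    linarith
  rw [← Real.le_log_iff_exp_le two_pos]
  have := Real.log_two_gt_d9
  linarith

/-- The FTRL distribution of a cumulative loss that has grown little within the epoch is comparable
to the snapshot. -/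
theorem ftrlDist_comparable (h : Regime P n K ι) (ω : IdealData X) (e : ℕ)
    (hg : ∀ i < (e + 1) * n, n ≤ i → (idealState E P ω i).FreqGood E P ∧ SelGood E P n ω i)
    (c : X) {D : Fin K → ℝ} (hD0 : ∀ k, 0 ≤ D k) (hD1 : ∀ k, D k ≤ 1303 / 1000 * (2 * n))
    (k : Fin K) :
    (idealState E P ω ((e + 1) * n)).snap c k / 2 ≤ ftrlDist P.η (E.active c)
        (fun i => (idealState E P ω ((e + 1) * n)).cumLoss c i + D i) k ∧
      ftrlDist P.η (E.active c)
        (fun i => (idealState E P ω ((e + 1) * n)).cumLoss c i + D i) k ≤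
        2 * (idealState E P ω ((e + 1) * n)).snap c k := by
  obtain ⟨Λs, Λn, h1, h1', h2⟩ := snapshots_close h ω e hg c
  -- Two epochs' growth enters: one is the lag of the snapshot, the other is `D`. Only events before
  -- the current epoch are assumed, so `D` may be computed with the true frequencies instead of the
  -- current estimates.
  obtain ⟨h3, h4⟩ := ftrlDist_ratio h.η_pos.le (E.active_nonempty c) (Λ := Λs)
    (Λ' := fun i => (idealState E P ω ((e + 1) * n)).cumLoss c i + D i)
    (M := P.η * (2 * (1303 / 1000 * (2 * n)) + 2 * (4 / (3 * P.γ))))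
    (fun k => by have := (h2 k).1; have := hD0 k; linarith)
    (fun k => mul_le_mul_of_nonneg_left
      (by have := (h2 k).2.1; have := hD1 k; linarith) h.η_pos.le) k
  have hM := exp_bound_of_regime h
  set M := P.η * (2 * (1303 / 1000 * (2 * n)) + 2 * (4 / (3 * P.γ)))
  have hp := ftrlDist_nonneg P.η (E.active c) Λs k
  rw [h1]
  have hinv : 1 / 2 ≤ Real.exp (-M) := by
    rw [Real.exp_neg, one_div]
    exact inv_anti₀ (Real.exp_pos M) hM
  constructor
  · refine le_trans ?_ h3
    have := mul_le_mul_of_nonneg_right hinv hp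
    linarith
  · exact h4.trans (mul_le_mul_of_nonneg_right hM hp)

theorem Good.before {ω : IdealData X} {j e : ℕ} (h : Good E P n ω j) (he : (e + 1) * n ≤ j) :
    ∀ i < (e + 1) * n, n ≤ i → (idealState E P ω i).FreqGood E P ∧ SelGood E P n ω i :=
  fun i hi => h i (by omega)

theorem exists_epoch (hn : 0 < n) {j : ℕ} (hj : n ≤ j) : ∃ e i, i < n ∧ j = (e + 1) * n + i := by
  obtain ⟨e, he⟩ : ∃ e, j / n = e + 1 := Nat.exists_eq_succ_of_ne_zero
    (Nat.div_pos hj hn).ne'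
  refine ⟨e, j % n, Nat.mod_lt _ hn, ?_⟩
  rw [← he, Nat.div_add_mod']

/-- On the good event, the FTRL distribution is comparable to the snapshot. -/
theorem Good.ftrl_comparable (h : Regime P n K ι) {ω : IdealData X} {j : ℕ} (hj : n ≤ j)
    (hg : Good E P n ω j) (c : X) (k : Fin K) :
    (idealState E P ω j).snap c k / 2 ≤ (idealState E P ω j).ftrl E P c k ∧
      (idealState E P ω j).ftrl E P c k ≤ 2 * (idealState E P ω j).snap c k := by
  obtain ⟨e, i, hi, rfl⟩ := exists_epoch h.n_pos hj
  have h0 := (hg ((e + 1) * n) (by omega) (by nlinarith)).1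
  have h1 := (hg ((e + 1) * n + i) le_rfl hj).2
  rw [(epoch_constant E h.L_eq ω (e + 1) hi).1]
  have hb := cumLoss_epoch_bounds h ω e hi h1 h0 c
  have := ftrlDist_comparable h ω e (hg.before (by omega)) c
    (D := fun k => (idealState E P ω ((e + 1) * n + i)).cumLoss c k -
      (idealState E P ω ((e + 1) * n)).cumLoss c k)
    (fun k => by linarith [(hb k).1]) (fun k => by linarith [(hb k).2]) k
  simpa only [add_sub_cancel, State.ftrl] using this

/-- On the good event, the algorithm plays the FTRL distribution. -/
theorem Good.play_eq (h : Regime P n K ι) {ω : IdealData X} {j : ℕ} (hj : n ≤ j)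
    (hg : Good E P n ω j) (c : X) :
    (idealState E P ω j).play E P (2 * j) c = (idealState E P ω j).ftrl E P c := by
  unfold State.play
  rw [if_pos ⟨by rw [h.L_eq]; omega, fun k => (hg.ftrl_comparable h hj c k).1⟩]

end GoodEvent

/-! ### The law of the idealised selection, and redrawing of the idealised randomness. -/

section GoodEventProbability

variable {X : Type u} [MeasurableSpace X] {K : ℕ} [NeZero K] (E : Environment X K) (P : Params)

theorem integral_coin (h : Bool → ℝ) :
    ∫ b, h b ∂(PMF.uniformOfFintype Bool).toMeasure = (h true + h false) / 2 := by
  rw [integral_fintype Integrable.of_finite]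
  simp [measureReal_def, PMF.uniformOfFintype_apply]
  ring

/-- The law of the idealised selection together with the coin. -/
theorem integral_idealPick {s : X → Fin K → ℝ} (hm : ∀ k, Measurable fun c => s c k)
    (hs : ∀ c, s c ∈ simplexOn (E.active c)) (k : Fin K) (h : Bool → ℝ) :
    ∫ r, (if idealPick s r = some k then h r.2.2.1 else 0) ∂(roundLaw E.contextLaw) =
      trueFreq E s k * ((h true + h false) / 2) := by
  set ν := E.contextLaw with hν
  have hhalf : ∫ v : unitInterval, (if (v : ℝ) < 1 / 2 then (1 : ℝ) else 0) = 1 / 2 := by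
    set x : unitInterval := ⟨1 / 2, by norm_num, by norm_num⟩ with hx
    have h1 : (fun v : unitInterval => if (v : ℝ) < 1 / 2 then (1 : ℝ) else 0) =
        (Set.Iio x).indicator fun _ => 1 := by
      funext v
      by_cases hv : (v : ℝ) < 1 / 2
      · have : v ∈ Set.Iio x := hv
        rw [Set.indicator_of_mem this, if_pos hv]
      · have : v ∉ Set.Iio x := hv
        rw [Set.indicator_of_notMem this, if_neg hv]
    rw [h1, integral_indicator_const _ measurableSet_Iio, measureReal_def, unitInterval.volume_Iio]
    simp [x]
  have hp : Measurable fun r : RoundData X => idealPick s r :=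
    measurable_idealPick (s := fun _ : RoundData X => s) (fun k => (hm k).comp measurable_snd)
      measurable_id
  have hmeas : Measurable fun r : RoundData X =>
      if idealPick s r = some k then h r.2.2.1 else 0 :=
    Measurable.ite (hp (measurableSet_singleton (some k)))
      ((measurable_of_countable h).comp (by fun_prop)) measurable_const
  have hint : Integrable (fun r : RoundData X =>
      if idealPick s r = some k then h r.2.2.1 else 0) (roundLaw ν) := by
    refine integrable_of_mem_Icc (a := -(|h true| + |h false|)) (b := |h true| + |h false|)
      hmeas fun r => ?_
    have h1 := abs_nonneg (h true)
    have h2 := abs_nonneg (h false)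
    have h3 := neg_abs_le (h true)
    have h4 := neg_abs_le (h false)
    have h5 := le_abs_self (h true)
    have h6 := le_abs_self (h false)
    split_ifs
    · cases r.2.2.1 <;> constructor <;> linarith
    · constructor <;> linarith
  unfold roundLaw at hint ⊢
  rw [integral_prod _ hint]
  have hin : ∀ c, ∫ y : unitInterval × Bool × unitInterval,
      (if idealPick s (c, y) = some k then h y.2.1 else 0) ∂((volume : Measure unitInterval).prod
        ((PMF.uniformOfFintype Bool).toMeasure.prod (volume : Measure unitInterval))) =
      s c k * ((h true + h false) / 2 * (1 / 2)) := by
    intro c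
    have h1 : ∀ y : unitInterval × Bool × unitInterval,
        (if idealPick s (c, y) = some k then h y.2.1 else 0) =
        (if sample (s c) y.1 = k then 1 else 0) *
          (h y.2.1 * if (y.2.2 : ℝ) < 1 / 2 then 1 else 0) := by
      intro y
      unfold idealPick
      simp only [select_eq_some_iff]
      by_cases ha : sample (s c) (y.1 : ℝ) = k <;> by_cases hb : (y.2.2 : ℝ) < 1 / 2 <;>
        simp only [ha, hb] <;> simp
    simp only [h1]
    rw [integral_prod_mul (fun u : unitInterval => if sample (s c) u = k then (1 : ℝ) else 0)
      (fun y : Bool × unitInterval => h y.1 * if (y.2 : ℝ) < 1 / 2 then 1 else 0),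
      integral_prod_mul h (fun v : unitInterval => if (v : ℝ) < 1 / 2 then (1 : ℝ) else 0),
      hhalf, integral_coin, integral_sample (hs c).1 (hs c).2.1 fun i => if i = k then 1 else 0]
    simp
  simp only [hin]
  rw [integral_mul_const, trueFreq]
  ring

/-- The weights 1/4 on two contexts in the first epoch and 1/2 on one context later give the same
mean, which is also the selection probability with acceptance 1/2. So all epochs can be treated
alike. -/
theorem integral_freqTerm {s : X → Fin K → ℝ} (hm : ∀ k, Measurable fun c => s c k)
    (hs : ∀ c, s c ∈ simplexOn (E.active c)) (j : ℕ) (k : Fin K) :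
    ∫ z, freqTerm P s j z k ∂(E.contextLaw.prod E.contextLaw) = trueFreq E s k := by
  set ν := E.contextLaw with hν
  have hk := hm k
  have hi : Integrable (fun c => s c k) ν := integrable_of_mem_Icc hk fun c =>
    ⟨(hs c).1 k, le_one_of_mem_simplexOn (hs c) k⟩
  have h1 : ∫ z : X × X, s z.1 k ∂(ν.prod ν) = ∫ c, s c k ∂ν := by
    rw [integral_fun_fst (f := fun c => s c k)]; simp
  have h2 : ∫ z : X × X, s z.2 k ∂(ν.prod ν) = ∫ c, s c k ∂ν := by
    rw [integral_fun_snd (f := fun c => s c k)]; simp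
  have hi1 : Integrable (fun z : X × X => s z.1 k) (ν.prod ν) := hi.comp_fst ν
  have hi2 : Integrable (fun z : X × X => s z.2 k) (ν.prod ν) := hi.comp_snd ν
  unfold freqTerm trueFreq
  split_ifs
  · rw [integral_div, integral_add hi1 hi2, h1, h2]; ring
  · rw [integral_div, h1]

theorem trueFreq_le_half {st : State X K} (h : st.Valid E) (k : Fin K) :
    trueFreq E st.snap k ≤ 1 / 2 := by
  have : ∫ c, st.snap c k ∂E.contextLaw ≤ 1 :=
    integral_le_of_le_const zero_le_one fun c => le_one_of_mem_simplexOn (h.snap_mem c) k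
  unfold trueFreq; linarith

/-- Redraw the contexts for the frequency estimates in some pairs of rounds. -/
def IdealData.withContexts (ω : IdealData X) (S : Finset ℕ) (β : ℕ → X × X) : IdealData X :=
  (ω.1, S.piecewise β ω.2)

/-- Redraw the rounds for the selections in some pairs of rounds. -/
def IdealData.withRounds (ω : IdealData X) (S : Finset ℕ) (α : ℕ → RoundData X) : IdealData X :=
  (S.piecewise α ω.1, ω.2)

omit [NeZero K]

/-- Takes the place of conditional expectation: integrating over an independent redraw of some
contexts conditions on everything else. -/
theorem integral_withContexts {F : IdealData X → ℝ} (hF : Integrable F E.idealProb)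
    (S : Finset ℕ) :
    ∫ ω, F ω ∂E.idealProb = ∫ ω, ∫ β, F (ω.withContexts S β)
      ∂(iidLaw (E.contextLaw.prod E.contextLaw)) ∂E.idealProb := by
  set κ := E.contextLaw.prod E.contextLaw with hκ
  have hpw := measurePreserving_piecewise κ S
  have hmp : MeasurePreserving (fun p : IdealData X × (ℕ → X × X) => p.1.withContexts S p.2)
      (E.idealProb.prod (iidLaw κ)) E.idealProb := by
    unfold Environment.idealProb
    rw [← hκ]
    have h2 := (MeasurePreserving.id (iidLaw (roundLaw E.contextLaw))).prod hpw
    have h3 := measurePreserving_prodAssoc (iidLaw (roundLaw E.contextLaw)) (iidLaw κ) (iidLaw κ)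
    exact h2.comp h3
  have h1 : Integrable (fun p : IdealData X × (ℕ → X × X) => F (p.1.withContexts S p.2))
      (E.idealProb.prod (iidLaw κ)) := hmp.integrable_comp_of_integrable hF
  rw [← integral_prod _ h1]
  conv_lhs => rw [← hmp.map_eq]
  rw [integral_map hmp.measurable.aemeasurable]
  rw [hmp.map_eq]; exact hF.aestronglyMeasurable

theorem integral_withRounds {F : IdealData X → ℝ} (hF : Integrable F E.idealProb)
    (S : Finset ℕ) :
    ∫ ω, F ω ∂E.idealProb = ∫ ω, ∫ α, F (ω.withRounds S α)
      ∂(iidLaw (roundLaw E.contextLaw)) ∂E.idealProb := by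
  set κ := E.contextLaw.prod E.contextLaw with hκ
  set μ := roundLaw E.contextLaw with hμ
  have hpw := measurePreserving_piecewise μ S
  have hmp : MeasurePreserving (fun p : IdealData X × (ℕ → RoundData X) => p.1.withRounds S p.2)
      (E.idealProb.prod (iidLaw μ)) E.idealProb := by
    unfold Environment.idealProb
    rw [← hκ, ← hμ]
    have h2 := hpw.prod (MeasurePreserving.id (iidLaw κ))
    have h4 := (measurePreserving_prodAssoc (iidLaw μ) (iidLaw μ) (iidLaw κ)).symm
      MeasurableEquiv.prodAssoc
    have h5 := (MeasurePreserving.id (iidLaw μ)).prod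
      (Measure.measurePreserving_swap (μ := iidLaw κ) (ν := iidLaw μ))
    have h3 := measurePreserving_prodAssoc (iidLaw μ) (iidLaw κ) (iidLaw μ)
    exact h2.comp (h4.comp (h5.comp h3))
  have h1 : Integrable (fun p : IdealData X × (ℕ → RoundData X) => F (p.1.withRounds S p.2))
      (E.idealProb.prod (iidLaw μ)) := hmp.integrable_comp_of_integrable hF
  rw [← integral_prod _ h1]
  conv_lhs => rw [← hmp.map_eq]
  rw [integral_map hmp.measurable.aemeasurable]
  rw [hmp.map_eq]; exact hF.aestronglyMeasurable

theorem measure_le_of_withContexts {A : Set (IdealData X)} (hA : MeasurableSet A) (S : Finset ℕ)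
    {θ : ℝ} (hθ : 0 ≤ θ) (h : ∀ ω : IdealData X,
      (iidLaw (E.contextLaw.prod E.contextLaw)).real {β | ω.withContexts S β ∈ A} ≤ θ) :
    E.idealProb.real A ≤ θ := by
  have hi : Integrable (A.indicator fun _ => (1 : ℝ)) E.idealProb :=
    (integrable_const _).indicator hA
  have h1 : E.idealProb.real A = ∫ ω, A.indicator (fun _ => (1 : ℝ)) ω ∂E.idealProb := by
    rw [integral_indicator_const _ hA]; simp
  rw [h1, integral_withContexts E hi S]
  refine integral_le_of_le_const hθ fun ω => ?_
  have hm : MeasurableSet {β | ω.withContexts S β ∈ A} := by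
    refine hA.preimage ?_
    exact measurable_const.prodMk ((measurePreserving_piecewise (E.contextLaw.prod E.contextLaw)
      S).measurable.comp (by fun_prop : Measurable fun β : ℕ → X × X => (ω.2, β)))
  have h2 : ∫ β, A.indicator (fun _ => (1 : ℝ)) (ω.withContexts S β)
      ∂(iidLaw (E.contextLaw.prod E.contextLaw)) =
      ∫ β, {β | ω.withContexts S β ∈ A}.indicator (fun _ => (1 : ℝ)) β
      ∂(iidLaw (E.contextLaw.prod E.contextLaw)) := rfl
  rw [h2, integral_indicator_const _ hm]
  simpa using h ω

theorem measure_le_of_withRounds {A : Set (IdealData X)} (hA : MeasurableSet A) (S : Finset ℕ)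
    {θ : ℝ} (hθ : 0 ≤ θ) (h : ∀ ω : IdealData X,
      (iidLaw (roundLaw E.contextLaw)).real {α | ω.withRounds S α ∈ A} ≤ θ) :
    E.idealProb.real A ≤ θ := by
  have hi : Integrable (A.indicator fun _ => (1 : ℝ)) E.idealProb :=
    (integrable_const _).indicator hA
  have h1 : E.idealProb.real A = ∫ ω, A.indicator (fun _ => (1 : ℝ)) ω ∂E.idealProb := by
    rw [integral_indicator_const _ hA]; simp
  rw [h1, integral_withRounds E hi S]
  refine integral_le_of_le_const hθ fun ω => ?_
  have hm : MeasurableSet {α | ω.withRounds S α ∈ A} := by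
    refine hA.preimage ?_
    exact ((measurePreserving_piecewise (roundLaw E.contextLaw)
      S).measurable.comp (by fun_prop : Measurable fun α : ℕ → RoundData X => (ω.1, α))).prodMk
      measurable_const
  have h2 : ∫ α, A.indicator (fun _ => (1 : ℝ)) (ω.withRounds S α)
      ∂(iidLaw (roundLaw E.contextLaw)) =
      ∫ α, {α | ω.withRounds S α ∈ A}.indicator (fun _ => (1 : ℝ)) α
      ∂(iidLaw (roundLaw E.contextLaw)) := rfl
  rw [h2, integral_indicator_const _ hm]
  simpa using h ω

end GoodEventProbability

/-! ### Quality of the frequency estimates and probability of the good event. -/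

section GoodEventProbability

variable {X : Type u} [MeasurableSpace X] {K : ℕ} [NeZero K] (E : Environment X K) {P : Params}
  {n : ℕ} {ι : ℝ}

theorem measurable_snap (P : Params) (ω : IdealData X) (j : ℕ) (k : Fin K) :
    Measurable fun c => (idealState E P ω j).snap c k :=
  ((measurableFamily_idealState E P j).snap k).comp (f := fun c => (ω, c)) (by fun_prop)

theorem idealState_withContexts_snap (h : Regime P n K ι) (ω : IdealData X) (e : ℕ)
    (β : ℕ → X × X) :
    (idealState E P (ω.withContexts (Finset.Ico (e * n) ((e + 1) * n)) β) ((e + 1) * n)).snap =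
      (idealState E P ω ((e + 1) * n)).snap := by
  refine (idealState_agree_next E h.L_eq h.n_pos (by rfl) fun i hi => ?_).2
  simp [IdealData.withContexts, Finset.piecewise, hi]

theorem idealState_withContexts_freq (h : Regime P n K ι) (ω : IdealData X) (e : ℕ)
    (β : ℕ → X × X) (k : Fin K) :
    (idealState E P (ω.withContexts (Finset.Ico (e * n) ((e + 1) * n)) β) ((e + 1) * n)).freq k =
      (∑ m ∈ Finset.Ico (e * n) ((e + 1) * n),
        freqTerm P (idealState E P ω ((e + 1) * n)).snap m (β m) k) / n := by
  rw [(epoch_succ E h.L_eq h.n_pos _ e).2.2 k, idealState_withContexts_snap E h]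
  congr 1
  refine Finset.sum_congr rfl fun m hm => ?_
  exact congrArg (freqTerm P _ m · k) (Finset.piecewise_eq_of_mem _ _ _ hm)

theorem card_epoch (e : ℕ) : (Finset.Ico (e * n) ((e + 1) * n)).card = n := by
  rw [Nat.card_Ico, add_mul, one_mul]; omega

theorem measureReal_exists_le {Ω : Type*} [MeasurableSpace Ω] {Q : Measure Ω}
    [IsProbabilityMeasure Q] {B : Fin K → Set Ω} {θ : ℝ} (h : ∀ k, Q.real (B k) ≤ θ) :
    Q.real {x | ∃ k, x ∈ B k} ≤ K * θ := by
  have h1 : {x | ∃ k, x ∈ B k} = ⋃ k, B k := by ext; simp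
  rw [h1]
  refine (measureReal_iUnion_fintype_le B).trans ?_
  refine (Finset.sum_le_card_nsmul _ _ θ fun k _ => h k).trans ?_
  simp

theorem Regime.exp_tail_le (h : Regime P n K ι) :
    Real.exp (-(n * P.γ / 8)) ≤ Real.exp (-ι) :=
  Real.exp_le_exp.2 (neg_le_neg h.tail)

theorem measurable_freqTerm_snd {s : X → Fin K → ℝ} (hm : ∀ k, Measurable fun c => s c k) (j : ℕ)
    (k : Fin K) : Measurable fun z => freqTerm P s j z k := by
  have := hm k
  unfold freqTerm
  split_ifs <;> fun_prop

/-- The frequency estimate made in an epoch, as a function of the contexts drawn for it. -/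
theorem frequencyEstimate_epoch (h : Regime P n K ι) (ω : IdealData X) (e : ℕ) :
    FrequencyEstimate (iidLaw (E.contextLaw.prod E.contextLaw))
      (fun β => (idealState E P (ω.withContexts (Finset.Ico (e * n) ((e + 1) * n)) β)
        ((e + 1) * n)).freq)
      (trueFreq E (idealState E P ω ((e + 1) * n)).snap) P.γ (1 / (2 * n))
      (K * Real.exp (-ι)) := by
  set s := (idealState E P ω ((e + 1) * n)).snap with hs
  have hv := valid_idealState E P ω ((e + 1) * n)
  have hsm := measurable_snap E P ω ((e + 1) * n)
  have hφ : ∀ β k, (idealState E P (ω.withContexts (Finset.Ico (e * n) ((e + 1) * n)) β)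
        ((e + 1) * n)).freq k = (∑ m ∈ Finset.Ico (e * n) ((e + 1) * n),
        freqTerm P s m (β m) k) / n := idealState_withContexts_freq E h ω e
  have hmem := fun k => freqTerm_mem (s := s) (k := k) P (fun c => (hv.snap_mem c).1 k)
    fun c => le_one_of_mem_simplexOn (hv.snap_mem c) k
  have hm : ∀ k j, Measurable fun z => freqTerm P s j z k :=
    fun k j => measurable_freqTerm_snd hsm j k
  have hcard := card_epoch (n := n) e
  have hpos : 0 < (Finset.Ico (e * n) ((e + 1) * n)).card := by rw [hcard]; exact h.n_pos
  have hn : (0 : ℝ) < n := by exact_mod_cast h.n_pos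
  have hint : ∀ k j, ∫ z, freqTerm P s j z k ∂(E.contextLaw.prod E.contextLaw) = trueFreq E s k :=
    fun k j => integral_freqTerm E P hsm hv.snap_mem j k
  constructor
  · intro k
    simp only [hφ]
    have := hm k
    fun_prop
  · intro β k
    rw [hφ]
    exact div_nonneg (Finset.sum_nonneg fun m _ => (hmem k m _).1) hn.le
  · intro β k
    rw [hφ, div_le_iff₀ hn]
    refine (Finset.sum_le_card_nsmul _ _ _ fun m _ => (hmem k m _).2).trans ?_
    rw [hcard, nsmul_eq_mul]; linarith
  · intro k
    simp only [hφ]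
    have := integral_avg (E.contextLaw.prod E.contextLaw) (hm k) (fun i z => (hmem k i z).1)
      (fun i z => (hmem k i z).2) (Finset.Ico (e * n) ((e + 1) * n)) (fun i _ => hint k i) hpos
    rwa [hcard] at this
  · intro k
    simp only [hφ]
    have := integral_avg_sub_sq_le (E.contextLaw.prod E.contextLaw) (hm k)
      (fun i z => (hmem k i z).1)
      (fun i z => (hmem k i z).2) (Finset.Ico (e * n) ((e + 1) * n)) (fun i _ => hint k i) hpos
    rw [hcard] at this
    refine this.trans (le_of_eq ?_)
    ring
  · refine le_trans (measureReal_mono ?_) (measureReal_exists_le (B := fun k => {β |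
      (∑ m ∈ Finset.Ico (e * n) ((e + 1) * n), freqTerm P s m (β m) k) / n <
        7 / 8 * trueFreq E s k - P.γ / 2}) fun k => ?_)
    · intro β hβ
      simp only [Set.mem_compl_iff, Set.mem_ofPred_eq, not_forall, not_le, hφ] at hβ ⊢
      exact hβ
    · have := measure_avg_lower_tail (E.contextLaw.prod E.contextLaw) (γ := P.γ) (hm k)
        (fun i z => (hmem k i z).1)
        (fun i z => (hmem k i z).2) (Finset.Ico (e * n) ((e + 1) * n)) (fun i _ => hint k i) hpos
      rw [hcard] at this
      exact this.trans h.exp_tail_le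

theorem measurable_trueFreq (P : Params) (j : ℕ) (k : Fin K) :
    Measurable fun ω => trueFreq E (idealState E P ω j).snap k := by
  have := ((measurableFamily_idealState E P j).snap k).stronglyMeasurable.integral_prod_right'
    (ν := E.contextLaw)
  exact this.measurable.div_const 2

theorem measurableSet_freqGood (P : Params) (j : ℕ) :
    MeasurableSet {ω | (idealState E P ω j).FreqGood E P} := by
  have h1 : {ω | (idealState E P ω j).FreqGood E P} = ⋂ k, {ω |
      7 / 8 * trueFreq E (idealState E P ω j).snap k - P.γ / 2 ≤ (idealState E P ω j).freq k} := by
    ext ω; simp [State.FreqGood]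
  rw [h1]
  exact MeasurableSet.iInter fun k => measurableSet_le
    (((measurable_trueFreq E P j k).const_mul _).sub_const _)
    ((measurableFamily_idealState E P j).freq k)

theorem measurable_selection (P : Params) (j : ℕ) : Measurable fun ω => selection E P ω j :=
  measurable_idealPick (s := fun ω => (idealState E P ω j).snap)
    (measurableFamily_idealState E P j).snap (by fun_prop)

theorem measurable_selInd (P : Params) (j : ℕ) (k : Fin K) :
    Measurable fun ω => selInd E P ω j k :=
  Measurable.ite (measurable_selection E P j (measurableSet_singleton (some k)))
    measurable_const measurable_const

theorem measurableSet_selGood (P : Params) (j : ℕ) : MeasurableSet {ω | SelGood E P n ω j} := by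
  have h1 : {ω | SelGood E P n ω j} = ⋂ k, {ω | ∑ m ∈ Finset.Ico (j / n * n) j, selInd E P ω m k ≤
    n * (57 / 50 * trueFreq E (idealState E P ω j).snap k + P.γ / 2)} := by
    ext ω; simp [SelGood]
  rw [h1]
  refine MeasurableSet.iInter fun k => measurableSet_le
    (Finset.measurable_sum _ fun m _ => measurable_selInd E P m k) ?_
  exact (((measurable_trueFreq E P j k).const_mul _).add_const _).const_mul _

theorem measurableSet_good (P : Params) (j : ℕ) : MeasurableSet {ω | Good E P n ω j} := by
  have h1 : {ω | Good E P n ω j} = ⋂ i, ⋂ (_ : i ≤ j), ⋂ (_ : n ≤ i),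
      ({ω | (idealState E P ω i).FreqGood E P} ∩ {ω | SelGood E P n ω i}) := by
    ext ω; simp [Good]
  rw [h1]
  exact MeasurableSet.iInter fun i => MeasurableSet.iInter fun _ => MeasurableSet.iInter fun _ =>
    (measurableSet_freqGood E P i).inter (measurableSet_selGood E P i)

theorem measure_freqBad_le (h : Regime P n K ι) (e : ℕ) :
    E.idealProb.real {ω | (idealState E P ω ((e + 1) * n)).FreqGood E P}ᶜ ≤
      K * Real.exp (-ι) := by
  refine measure_le_of_withContexts E (measurableSet_freqGood E P _).compl
    (Finset.Ico (e * n) ((e + 1) * n)) (by positivity) fun ω => ?_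
  refine le_of_eq_of_le ?_ (frequencyEstimate_epoch E h ω e).measure_bad_le
  congr 1
  ext β
  simp only [Set.mem_compl_iff, Set.mem_ofPred_eq, State.FreqGood,
    idealState_withContexts_snap E h]

/-- The snapshot is settled at the start of the epoch. With all other data frozen, the selections of
an arm within the epoch are therefore independent indicators with mean `trueFreq`. -/
theorem measure_selBad_le (h : Regime P n K ι) (e : ℕ) :
    E.idealProb.real {ω | ∃ k, n * (57 / 50 * trueFreq E (idealState E P ω (e * n)).snap k
        + P.γ / 2) < ∑ m ∈ Finset.Ico (e * n) ((e + 1) * n), selInd E P ω m k} ≤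
      K * Real.exp (-ι) := by
  refine measure_le_of_withRounds E ?_ (Finset.Ico (e * n) ((e + 1) * n)) (by positivity)
    fun ω => ?_
  · have h1 : {ω | ∃ k, n * (57 / 50 * trueFreq E (idealState E P ω (e * n)).snap k
        + P.γ / 2) < ∑ m ∈ Finset.Ico (e * n) ((e + 1) * n), selInd E P ω m k} =
        ⋃ k, {ω | n * (57 / 50 * trueFreq E (idealState E P ω (e * n)).snap k
        + P.γ / 2) < ∑ m ∈ Finset.Ico (e * n) ((e + 1) * n), selInd E P ω m k} := by
      ext ω; simp
    rw [h1]
    exact MeasurableSet.iUnion fun k => measurableSet_lt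
      ((((measurable_trueFreq E P _ k).const_mul _).add_const _).const_mul _)
      (Finset.measurable_sum _ fun m _ => measurable_selInd E P m k)
  · set s := (idealState E P ω (e * n)).snap with hs
    have hst : ∀ α, idealState E P (ω.withRounds (Finset.Ico (e * n) ((e + 1) * n)) α) (e * n) =
        idealState E P ω (e * n) := fun α =>
      idealState_congr E P (fun i hi => by simp [IdealData.withRounds, Finset.piecewise, hi])
        fun i _ => rfl
    have hsel : ∀ α, ∀ m ∈ Finset.Ico (e * n) ((e + 1) * n), ∀ k,
        selInd E P (ω.withRounds (Finset.Ico (e * n) ((e + 1) * n)) α) m k =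
        if idealPick s (α m) = some k then 1 else 0 := by
      intro α m hm k
      have hdiv : m / n = e := by
        rw [Finset.mem_Ico] at hm
        exact Nat.div_eq_of_lt_le hm.1 hm.2
      have hα : (ω.withRounds (Finset.Ico (e * n) ((e + 1) * n)) α).1 m = α m :=
        Finset.piecewise_eq_of_mem _ _ _ hm
      rw [selInd, selection, snap_epoch E h.L_eq h.n_pos, hdiv, hst, hα]
    have hv := valid_idealState E P ω (e * n)
    have hp : Measurable fun r : RoundData X => idealPick s r :=
      measurable_idealPick (s := fun _ : RoundData X => s)
        (fun k => (measurable_snap E P ω (e * n) k).comp measurable_snd) measurable_id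
    refine le_trans (measureReal_mono ?_) (measureReal_exists_le (B := fun k => {α : ℕ → RoundData X |
      n * (57 / 50 * trueFreq E s k + P.γ / 2) < ∑ m ∈ Finset.Ico (e * n) ((e + 1) * n),
        if idealPick s (α m) = some k then (1 : ℝ) else 0}) fun k => ?_)
    · rintro α ⟨k, hk⟩
      refine ⟨k, ?_⟩
      rw [hst, Finset.sum_congr rfl fun m hm => hsel α m hm k] at hk
      exact hk
    · have := measure_count_upper_tail (roundLaw E.contextLaw) (γ := P.γ)
        (f := trueFreq E s k) (B := fun _ r => if idealPick s r = some k then (1 : ℝ) else 0)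
        (fun i => Measurable.ite (hp (measurableSet_singleton (some k))) measurable_const
          measurable_const) (fun i r => by split_ifs <;> simp)
        (Finset.Ico (e * n) ((e + 1) * n)) (fun i _ => by
          have := integral_idealPick E (measurable_snap E P ω (e * n)) hv.snap_mem k fun _ => 1
          refine this.trans ?_
          ring)
      rw [card_epoch] at this
      exact this.trans h.exp_tail_le

/-- The good event fails with small probability. -/
theorem measure_not_good_le (h : Regime P n K ι) (j : ℕ) :
    E.idealProb.real {ω | Good E P n ω j}ᶜ ≤ (j / n : ℕ) * (2 * (K * Real.exp (-ι))) := by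
  -- Selection counts increase within an epoch, so the bound for the full epoch implies all the
  -- intermediate ones. The union is over epochs rather than pairs, which yields the factor `j / n`.
  have hsub : {ω | Good E P n ω j}ᶜ ⊆ ⋃ e ∈ Finset.range (j / n),
      ({ω | (idealState E P ω ((e + 1) * n)).FreqGood E P}ᶜ ∪
        {ω | ∃ k, n * (57 / 50 * trueFreq E (idealState E P ω ((e + 1) * n)).snap k
        + P.γ / 2) < ∑ m ∈ Finset.Ico ((e + 1) * n) ((e + 1 + 1) * n), selInd E P ω m k}) := by
    intro ω hω
    by_contra hcon
    simp only [Set.mem_iUnion, Finset.mem_range, Set.mem_union, Set.mem_compl_iff,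
      Set.mem_ofPred_eq, not_exists, not_or, not_not, not_lt] at hcon
    apply hω
    intro i hij hni
    obtain ⟨e, r, hr, rfl⟩ := exists_epoch h.n_pos hni
    have he : e < j / n := by
      rw [Nat.lt_iff_add_one_le, Nat.le_div_iff_mul_le h.n_pos]; omega
    obtain ⟨h1, h2⟩ := hcon e he
    obtain ⟨hc1, -, hc3⟩ := epoch_constant E h.L_eq ω (e + 1) hr
    constructor
    · intro k
      rw [hc1, hc3]
      exact h1 k
    · intro k
      rw [hc1, mul_add_epoch_div h.n_pos hr]
      refine le_trans ?_ (h2 k)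
      refine Finset.sum_le_sum_of_subset_of_nonneg (Finset.Ico_subset_Ico le_rfl ?_)
        fun m _ _ => selInd_nonneg E P ω m k
      rw [add_mul (e + 1), one_mul]; omega
  refine (measureReal_mono hsub (measure_ne_top _ _)).trans ((measureReal_biUnion_finset_le _ _).trans ?_)
  refine (Finset.sum_le_card_nsmul _ _ (2 * (K * Real.exp (-ι))) fun e _ => ?_).trans (by simp)
  refine (measureReal_union_le _ _).trans ?_
  have h1 := measure_freqBad_le E h e
  have h2 := measure_selBad_le E h (e + 1)
  linarith

end GoodEventProbability

/-! ### Conditional moments of a loss estimate, and the stopped FTRL regret. -/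

section OneStep

variable {X : Type u} [MeasurableSpace X] {K : ℕ} [NeZero K] (E : Environment X K) {P : Params}
  {n : ℕ} {ι : ℝ}

open Classical in
/-- The indicator of the good event. -/
def goodInd (P : Params) (n : ℕ) (ω : IdealData X) (j : ℕ) : ℝ := if Good E P n ω j then 1 else 0

theorem goodInd_mem (ω : IdealData X) (j : ℕ) :
    0 ≤ goodInd E P n ω j ∧ goodInd E P n ω j ≤ 1 := by
  unfold goodInd; split_ifs <;> norm_num

theorem measurable_goodInd (j : ℕ) : Measurable fun ω => goodInd E P n ω j :=
  Measurable.ite (measurableSet_good E P j) measurable_const measurable_const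

theorem measurable_idealFtrl (P : Params) (j : ℕ) (k : Fin K) :
    Measurable fun z : IdealData X × X => (idealState E P z.1 j).ftrl E P z.2 k :=
  (measurableFamily_idealState E P j).ftrl k

theorem measurable_lossEst (P : Params) (j : ℕ) (k : Fin K) :
    Measurable fun z : IdealData X × X => lossEst E P z.1 j z.2 k := by
  have h : (fun z : IdealData X × X => lossEst E P z.1 j z.2 k) = fun z =>
      (idealState E P z.1 (j + 1)).cumLoss z.2 k - (idealState E P z.1 j).cumLoss z.2 k := by
    funext z; rw [cumLoss_succ]; ring
  rw [h]
  exact ((measurableFamily_idealState E P (j + 1)).cumLoss k).sub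
    ((measurableFamily_idealState E P j).cumLoss k)

theorem ftrl_mem (ω : IdealData X) (j : ℕ) (c : X) :
    (idealState E P ω j).ftrl E P c ∈ simplexOn (E.active c) :=
  ftrlDist_mem_simplexOn _ (E.active_nonempty c) _

theorem selInd_congr {ω ω' : IdealData X} {j : ℕ} (h1 : ∀ i ≤ j, ω.1 i = ω'.1 i)
    (h2 : ω.2 = ω'.2) (k : Fin K) : selInd E P ω j k = selInd E P ω' j k := by
  unfold selInd selection
  rw [idealState_congr E P (fun i hi => h1 i hi.le) fun i _ => by rw [h2], h1 j le_rfl]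

/-- The count in `SelGood` at `j` excludes pair `j`, so the good event is decided before the
selection of that pair and its indicator can multiply the pair's loss estimate. -/
theorem good_congr {ω ω' : IdealData X} {j : ℕ} (h1 : ∀ i < j, ω.1 i = ω'.1 i)
    (h2 : ω.2 = ω'.2) : Good E P n ω j ↔ Good E P n ω' j := by
  unfold Good SelGood
  refine forall_congr' fun i => forall_congr' fun hi => forall_congr' fun _ => ?_
  rw [idealState_congr E P (ω := ω) (ω' := ω') (j := i) (fun m hm => h1 m (by omega))
    fun m _ => by rw [h2]]
  refine and_congr_right fun _ => forall_congr' fun k => ?_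
  rw [Finset.sum_congr rfl fun m hm => selInd_congr E (fun i' hi' => h1 i' (by
    rw [Finset.mem_Ico] at hm; omega)) h2 k]

/-- Functions of the randomness that do not depend on the selection data of the pair of rounds `j`
and later ones. -/
def Predictable (w : IdealData X → ℝ) (j : ℕ) : Prop :=
  ∀ ω ω' : IdealData X, (∀ i < j, ω.1 i = ω'.1 i) → ω.2 = ω'.2 → w ω = w ω'

omit E in
theorem Predictable.mul {w w' : IdealData X → ℝ} {j : ℕ} (h : Predictable w j)
    (h' : Predictable w' j) : Predictable (fun ω => w ω * w' ω) j := fun ω ω' h1 h2 => by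
  simp only [h ω ω' h1 h2, h' ω ω' h1 h2]

theorem predictable_state (P : Params) (j : ℕ) (F : State X K → ℝ) :
    Predictable (fun ω => F (idealState E P ω j)) j := fun ω ω' h1 h2 => by
  simp only [idealState_congr E P h1 fun i _ => by rw [h2]]

theorem predictable_goodInd (P : Params) (n j : ℕ) :
    Predictable (fun ω => goodInd E P n ω j) j := fun ω ω' h1 h2 => by
  classical
  unfold goodInd
  exact if_congr (good_congr E h1 h2) rfl rfl

/-- Conditional expectation of a function of the selection in a pair of rounds. -/
theorem integral_selection (P : Params) (j : ℕ) (k : Fin K) (h : Bool → ℝ) {w : IdealData X → ℝ}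
    (hw : Predictable w j) (hwm : Measurable w) {B : ℝ} (hB : ∀ ω, |w ω| ≤ B) :
    ∫ ω, w ω * (if selection E P ω j = some k then h (ω.1 j).2.2.1 else 0) ∂E.idealProb =
      ∫ ω, w ω * (trueFreq E (idealState E P ω j).snap k * ((h true + h false) / 2))
        ∂E.idealProb := by
  obtain ⟨H, hH⟩ : ∃ H, ∀ b, |h b| ≤ H :=
    ⟨|h true| + |h false|, fun b => by
      have h1 := abs_nonneg (h true)
      have h2 := abs_nonneg (h false)
      cases b <;> linarith⟩
  have hm : Measurable fun ω : IdealData X => w ω *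
      (if selection E P ω j = some k then h (ω.1 j).2.2.1 else 0) :=
    hwm.mul (Measurable.ite (measurable_selection E P j (measurableSet_singleton (some k)))
      ((measurable_of_countable h).comp (by fun_prop)) measurable_const)
  have hint : Integrable (fun ω : IdealData X => w ω *
      (if selection E P ω j = some k then h (ω.1 j).2.2.1 else 0)) E.idealProb := by
    refine Integrable.of_bound hm.aestronglyMeasurable (B * H) (ae_of_all _ fun ω => ?_)
    have hB0 : 0 ≤ B := (abs_nonneg _).trans (hB ω)
    have hH0 : 0 ≤ H := (abs_nonneg _).trans (hH true)
    rw [Real.norm_eq_abs, abs_mul]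
    refine mul_le_mul (hB ω) ?_ (abs_nonneg _) hB0
    split_ifs
    · exact hH _
    · simpa using hH0
  -- Redrawing round `j` alone leaves the weight `w` and the snapshot fixed, so the inner integral
  -- is over one fresh selection.
  rw [integral_withRounds E hint {j}]
  refine integral_congr_ae (ae_of_all _ fun ω => ?_)
  have hag : ∀ α, ∀ i < j, (ω.withRounds {j} α).1 i = ω.1 i := fun α i hi => by
    simp [IdealData.withRounds, Finset.piecewise, hi.ne]
  have h1 : ∀ α, w (ω.withRounds {j} α) * (if selection E P (ω.withRounds {j} α) j = some k then
      h ((ω.withRounds {j} α).1 j).2.2.1 else 0) =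
      w ω * (fun r : RoundData X => if idealPick (idealState E P ω j).snap r = some k then
        h r.2.2.1 else 0) (α j) := by
    intro α
    have hα : (ω.withRounds {j} α).1 j = α j :=
      Finset.piecewise_eq_of_mem _ _ _ (Finset.mem_singleton_self j)
    rw [hw _ ω (hag α) rfl, selection, hα, idealState_congr E P (ω' := ω) (hag α) fun i _ => rfl]
  have hp : Measurable fun r : RoundData X => idealPick (idealState E P ω j).snap r :=
    measurable_idealPick (s := fun _ : RoundData X => (idealState E P ω j).snap)
      (fun k => (measurable_snap E P ω j k).comp measurable_snd) measurable_id
  simp only [h1]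
  rw [integral_const_mul, integral_eval (roundLaw E.contextLaw)
    (h := fun r : RoundData X => if idealPick (idealState E P ω j).snap r = some k then
        h r.2.2.1 else 0) ?_ j,
    integral_idealPick E (measurable_snap E P ω j) (valid_idealState E P ω j).snap_mem]
  exact Measurable.ite (hp (measurableSet_singleton (some k)))
    ((measurable_of_countable h).comp (by fun_prop)) measurable_const

/-- Conditional expectation of a loss estimate. -/
theorem integral_lossEst (hr : Regime P n K ι) {j : ℕ} (hj : n ≤ j) (c : X) (k : Fin K)
    {w : IdealData X → ℝ} (hw : Predictable w j) (hwm : Measurable w) {B : ℝ}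
    (hB : ∀ ω, |w ω| ≤ B) :
    ∫ ω, w ω * lossEst E P ω j c k ∂E.idealProb =
      ∫ ω, w ω * (E.pairLoss j k c * (trueFreq E (idealState E P ω j).snap k /
        ((idealState E P ω j).freq k + 3 / 2 * P.γ))) ∂E.idealProb := by
  have hγ := hr.γ_pos
  have hx : ∀ ω, 3 / 2 * P.γ ≤ (idealState E P ω j).freq k + 3 / 2 * P.γ := fun ω => by
    linarith [freq_nonneg E hr.L_eq hr.n_pos ω j k]
  have hnj : ¬ 2 * j < P.L := by rw [hr.L_eq]; omega
  have h1 := integral_selection E P j k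
    (fun b => 2 * E.loss (if b then 2 * j + 1 else 2 * j) k c)
    (w := fun ω => w ω * ((idealState E P ω j).freq k + 3 / 2 * P.γ)⁻¹)
    (hw.mul (predictable_state E P j fun st => (st.freq k + 3 / 2 * P.γ)⁻¹))
    (hwm.mul (((measurableFamily_idealState E P j).freq k).add_const _).inv)
    (B := B * (3 / 2 * P.γ)⁻¹) fun ω => by
      have h0 : 0 ≤ B := (abs_nonneg _).trans (hB ω)
      have hxp : 0 < (idealState E P ω j).freq k + 3 / 2 * P.γ := by linarith [hx ω]
      rw [abs_mul, abs_of_pos (inv_pos.2 hxp)]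
      exact mul_le_mul (hB ω) (inv_anti₀ (by positivity) (hx ω)) (inv_pos.2 hxp).le h0
  refine Eq.trans ?_ (h1.trans ?_)
  · refine integral_congr_ae (ae_of_all _ fun ω => ?_)
    simp only [lossEst, hnj, if_false, selLoss]
    ring
  -- The coin chooses one of the two rounds, so twice the chosen loss averages to the loss of the
  -- whole pair.
  · refine integral_congr_ae (ae_of_all _ fun ω => ?_)
    simp only [Environment.pairLoss, if_true, Bool.false_eq_true, if_false]
    ring

/-- Conditional second moment of a loss estimate. -/
theorem integral_lossEst_sq_le (hr : Regime P n K ι) {j : ℕ} (c : X) (k : Fin K)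
    {w : IdealData X → ℝ} (hw : Predictable w j) (hwm : Measurable w) {B : ℝ}
    (hw0 : ∀ ω, 0 ≤ w ω) (hB : ∀ ω, w ω ≤ B) :
    ∫ ω, w ω * lossEst E P ω j c k ^ 2 ∂E.idealProb ≤
      ∫ ω, w ω * (4 * trueFreq E (idealState E P ω j).snap k /
        ((idealState E P ω j).freq k + 3 / 2 * P.γ) ^ 2) ∂E.idealProb := by
  have hγ := hr.γ_pos
  have hx : ∀ ω, 3 / 2 * P.γ ≤ (idealState E P ω j).freq k + 3 / 2 * P.γ := fun ω => by
    linarith [freq_nonneg E hr.L_eq hr.n_pos ω j k]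
  have hxp : ∀ ω, 0 < (idealState E P ω j).freq k + 3 / 2 * P.γ := fun ω => by linarith [hx ω]
  have hf0 : ∀ ω, 0 ≤ trueFreq E (idealState E P ω j).snap k := fun ω =>
    (valid_idealState E P ω j).trueFreq_nonneg k
  have hf1 : ∀ ω, trueFreq E (idealState E P ω j).snap k ≤ 1 / 2 := fun ω =>
    trueFreq_le_half E (valid_idealState E P ω j) k
  have hmx : Measurable fun ω => (idealState E P ω j).freq k + 3 / 2 * P.γ :=
    ((measurableFamily_idealState E P j).freq k).add_const _
  have hmf := measurable_trueFreq E P j k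
  have hinv : ∀ ω, (((idealState E P ω j).freq k + 3 / 2 * P.γ) ^ 2)⁻¹ ≤
      ((3 / 2 * P.γ) ^ 2)⁻¹ := fun ω => by
    have := hx ω
    exact inv_anti₀ (by positivity) (by gcongr)
  have hwB : ∀ ω, w ω * (((idealState E P ω j).freq k + 3 / 2 * P.γ) ^ 2)⁻¹ ≤
      B * ((3 / 2 * P.γ) ^ 2)⁻¹ := fun ω =>
    mul_le_mul (hB ω) (hinv ω) (inv_nonneg.2 (sq_nonneg _)) ((hw0 ω).trans (hB ω))
  have hwn : ∀ ω, 0 ≤ w ω * (((idealState E P ω j).freq k + 3 / 2 * P.γ) ^ 2)⁻¹ := fun ω =>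
    mul_nonneg (hw0 ω) (inv_nonneg.2 (sq_nonneg _))
  have h1 := integral_selection E P j k
    (fun b => (2 * E.loss (if b then 2 * j + 1 else 2 * j) k c) ^ 2)
    (w := fun ω => w ω * (((idealState E P ω j).freq k + 3 / 2 * P.γ) ^ 2)⁻¹)
    (hw.mul (predictable_state E P j fun st => ((st.freq k + 3 / 2 * P.γ) ^ 2)⁻¹))
    (hwm.mul (hmx.pow_const 2).inv) (B := B * ((3 / 2 * P.γ) ^ 2)⁻¹)
    fun ω => by rw [abs_of_nonneg (hwn ω)]; exact hwB ω
  have hsq : ∀ t, 0 ≤ (2 * E.loss t k c) ^ 2 ∧ (2 * E.loss t k c) ^ 2 ≤ 4 := fun t => by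
    have := E.loss_nonneg t k c
    have := E.loss_le_one t k c
    constructor
    · positivity
    · nlinarith
  by_cases hj : 2 * j < P.L
  · have h0 : ∀ ω, w ω * lossEst E P ω j c k ^ 2 = 0 := fun ω => by simp [lossEst, hj]
    simp only [h0, integral_zero]
    exact integral_nonneg fun ω => mul_nonneg (hw0 ω)
      (div_nonneg (mul_nonneg (by norm_num) (hf0 ω)) (sq_nonneg _))
  refine le_of_eq_of_le (Eq.trans ?_ h1) ?_
  · refine integral_congr_ae (ae_of_all _ fun ω => ?_)
    simp only [lossEst, hj, if_false, selLoss]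
    generalize (idealState E P ω j).freq k + 3 / 2 * P.γ = x
    split_ifs <;> ring
  · have hbound : ∀ ω, w ω * (((idealState E P ω j).freq k + 3 / 2 * P.γ) ^ 2)⁻¹ *
        (trueFreq E (idealState E P ω j).snap k * ((
          (2 * E.loss (if true then 2 * j + 1 else 2 * j) k c) ^ 2 +
          (2 * E.loss (if false then 2 * j + 1 else 2 * j) k c) ^ 2) / 2)) ≤
        w ω * (4 * trueFreq E (idealState E P ω j).snap k /
        ((idealState E P ω j).freq k + 3 / 2 * P.γ) ^ 2) := fun ω => by
      have h2 := (hsq (2 * j + 1)).2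
      have h3 := (hsq (2 * j)).2
      simp only [if_true, Bool.false_eq_true, if_false]
      have e : w ω * (4 * trueFreq E (idealState E P ω j).snap k /
        ((idealState E P ω j).freq k + 3 / 2 * P.γ) ^ 2) =
        w ω * (((idealState E P ω j).freq k + 3 / 2 * P.γ) ^ 2)⁻¹ *
          (trueFreq E (idealState E P ω j).snap k * 4) := by ring
      rw [e]
      refine mul_le_mul_of_nonneg_left (mul_le_mul_of_nonneg_left ?_ (hf0 ω)) (hwn ω)
      linarith
    have hint : Integrable (fun ω => w ω * (4 * trueFreq E (idealState E P ω j).snap k /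
        ((idealState E P ω j).freq k + 3 / 2 * P.γ) ^ 2)) E.idealProb := by
      refine integrable_of_mem_Icc (a := 0) (b := B * ((3 / 2 * P.γ) ^ 2)⁻¹ * 2)
        (hwm.mul ((hmf.const_mul 4).div (hmx.pow_const 2))) fun ω => ⟨mul_nonneg (hw0 ω)
        (div_nonneg (mul_nonneg (by norm_num) (hf0 ω)) (sq_nonneg _)), ?_⟩
      have e : w ω * (4 * trueFreq E (idealState E P ω j).snap k /
        ((idealState E P ω j).freq k + 3 / 2 * P.γ) ^ 2) =
        w ω * (((idealState E P ω j).freq k + 3 / 2 * P.γ) ^ 2)⁻¹ *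
          (4 * trueFreq E (idealState E P ω j).snap k) := by ring
      rw [e]
      exact mul_le_mul (hwB ω) (by linarith [hf1 ω]) (by linarith [hf0 ω])
        ((hwn ω).trans (hwB ω))
    refine integral_mono_of_nonneg (ae_of_all _ fun ω => ?_) hint (ae_of_all _ hbound)
    exact mul_nonneg (hwn ω) (mul_nonneg (hf0 ω)
      (div_nonneg (add_nonneg (hsq _).1 (hsq _).1) zero_le_two))

/-- The FTRL regret bound for the loss estimates, stopped when the good event fails. -/
theorem sum_goodInd_ftrl_regret (hr : Regime P n K ι) (ω : IdealData X) (c : X) {m : Fin K}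
    (hm : m ∈ E.active c) (J : ℕ) :
    ∑ j ∈ Finset.range J, goodInd E P n ω j *
        (∑ k, (idealState E P ω j).ftrl E P c k * lossEst E P ω j c k - lossEst E P ω j c m) ≤
      Real.log K / P.η + P.η / 2 * ∑ j ∈ Finset.range J, goodInd E P n ω j *
        ∑ k, (idealState E P ω j).ftrl E P c k * lossEst E P ω j c k ^ 2 := by
  have hK : (1 : ℝ) ≤ K := by exact_mod_cast NeZero.one_le
  induction J with
  | zero =>
    simp only [Finset.range_zero, Finset.sum_empty, mul_zero, add_zero]
    exact div_nonneg (Real.log_nonneg hK) hr.η_pos.le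
  | succ J ih =>
    -- The good event decreases in `j`. Either every indicator up to `J` is 1 and the pathwise FTRL
    -- bound applies, or the last summands on both sides vanish.
    by_cases hg : Good E P n ω J
    · have h1 : ∀ j ∈ Finset.range (J + 1), goodInd E P n ω j = 1 := fun j hj => by
        rw [goodInd, if_pos (hg.mono (Nat.lt_succ_iff.1 (Finset.mem_range.1 hj)))]
      have h2 : ∀ F : ℕ → ℝ, ∑ j ∈ Finset.range (J + 1), goodInd E P n ω j * F j =
          ∑ j ∈ Finset.range (J + 1), F j := fun F =>
        Finset.sum_congr rfl fun j hj => by rw [h1 j hj, one_mul]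
      rw [h2, h2]
      exact ftrl_regret hr.η_pos (fun j => (idealState E P ω j).cumLoss c)
        (fun j => lossEst E P ω j c)
        (fun j k => lossEst_nonneg E hr.L_eq hr.n_pos hr.γ_pos ω j c k)
        (fun k => by simp [idealState, initState]) (fun j k => cumLoss_succ E P ω j c k) hm (J + 1)
    · have h0 : goodInd E P n ω J = 0 := by rw [goodInd, if_neg hg]
      rw [Finset.sum_range_succ, Finset.sum_range_succ, h0, zero_mul, zero_mul, add_zero, add_zero]
      exact ih

end OneStep

/-! ### The expected bias at the comparator and at the played distribution. -/

section Bias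

variable {X : Type u} [MeasurableSpace X] {K : ℕ} [NeZero K] (E : Environment X K) {P : Params}
  {n : ℕ} {ι : ℝ}

/-- The part of the good event that does not involve the frequency estimate of the current epoch. -/
def RestGood (P : Params) (n : ℕ) (ω : IdealData X) (e i : ℕ) : Prop :=
  (∀ m < (e + 1) * n, n ≤ m → (idealState E P ω m).FreqGood E P ∧ SelGood E P n ω m) ∧
    ∀ r ≤ i, SelGood E P n ω ((e + 1) * n + r)

/-- Within an epoch the estimate and the snapshot are constant, so the current epoch contributes a
single frequency condition. It can be split off and treated as a constraint on the redrawn contexts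
alone. -/
theorem good_iff (h : Regime P n K ι) (ω : IdealData X) (e : ℕ) {i : ℕ} (hi : i < n) :
    Good E P n ω ((e + 1) * n + i) ↔
      (idealState E P ω ((e + 1) * n)).FreqGood E P ∧ RestGood E P n ω e i := by
  have hle : n ≤ (e + 1) * n := by nlinarith
  constructor
  · intro hg
    exact ⟨(hg _ (by omega) hle).1, hg.before (by omega), fun r hr => (hg _ (by omega) (by omega)).2⟩
  · rintro ⟨h1, h2, h3⟩ m hm hnm
    rcases Nat.lt_or_ge m ((e + 1) * n) with hlt | hge
    · exact h2 m hlt hnm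
    · obtain ⟨r, rfl⟩ := Nat.exists_eq_add_of_le hge
      refine ⟨fun k => ?_, h3 r (by omega)⟩
      obtain ⟨hc1, -, hc3⟩ := epoch_constant E h.L_eq ω (e + 1) (show r < n by omega)
      rw [hc1, hc3]
      exact h1 k

theorem snap_freq_agree (h : Regime P n K ι) {ω ω' : IdealData X} (h1 : ω.1 = ω'.1) {e : ℕ}
    (h2 : ∀ i < e * n, ω.2 i = ω'.2 i) {m : ℕ} (hm : m < (e + 1) * n) :
    (idealState E P ω m).snap = (idealState E P ω' m).snap ∧
      (idealState E P ω m).freq = (idealState E P ω' m).freq := by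
  rcases Nat.lt_or_ge m (e * n) with hlt | hge
  · rw [idealState_congr E P (fun i _ => by rw [h1]) fun i hi => h2 i (by omega)]
    exact ⟨rfl, rfl⟩
  · obtain ⟨r, rfl⟩ := Nat.exists_eq_add_of_le hge
    rw [add_mul, one_mul] at hm
    have := idealState_agree E h.L_eq h1 h2 (show r < n by omega)
    exact ⟨this.snap, this.freq⟩

theorem selGood_agree (h : Regime P n K ι) {ω ω' : IdealData X} (h1 : ω.1 = ω'.1) {e : ℕ}
    (h2 : ∀ i < e * n, ω.2 i = ω'.2 i) {m : ℕ} (hm : m < (e + 2) * n)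
    (hs : (idealState E P ω m).snap = (idealState E P ω' m).snap) :
    SelGood E P n ω m ↔ SelGood E P n ω' m := by
  unfold SelGood
  refine forall_congr' fun k => ?_
  have : ∀ r ∈ Finset.Ico (m / n * n) m, selInd E P ω r k = selInd E P ω' r k := fun r hr => by
    rw [Finset.mem_Ico] at hr
    unfold selInd
    rw [selection_agree E h.L_eq h.n_pos h1 h2 (show r < (e + 2) * n by omega)]
  rw [Finset.sum_congr rfl this, hs]

theorem snap_agree_epoch (h : Regime P n K ι) {ω ω' : IdealData X} (h1 : ω.1 = ω'.1) {e : ℕ}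
    (h2 : ∀ i < e * n, ω.2 i = ω'.2 i) {i : ℕ} (hi : i < n) :
    (idealState E P ω ((e + 1) * n + i)).snap = (idealState E P ω' ((e + 1) * n + i)).snap := by
  rw [(epoch_constant E h.L_eq ω (e + 1) hi).1, (epoch_constant E h.L_eq ω' (e + 1) hi).1]
  exact (idealState_agree_next E h.L_eq h.n_pos h1 h2).2

/-- Earlier epochs, and the snapshot and selections of the current one, do not see the contexts
redrawn in epoch `e`. -/
theorem restGood_agree (h : Regime P n K ι) {ω ω' : IdealData X} (h1 : ω.1 = ω'.1) {e : ℕ}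
    (h2 : ∀ i < e * n, ω.2 i = ω'.2 i) {i : ℕ} (hi : i < n) :
    RestGood E P n ω e i ↔ RestGood E P n ω' e i := by
  have hlt : (e + 1) * n < (e + 2) * n := by have := h.n_pos; nlinarith
  have hsucc : (e + 2) * n = (e + 1) * n + n := by ring
  unfold RestGood
  refine and_congr ?_ ?_
  · refine forall_congr' fun m => forall_congr' fun hm => forall_congr' fun _ => ?_
    obtain ⟨hs, hf⟩ := snap_freq_agree E h h1 h2 hm
    refine and_congr ?_ (selGood_agree E h h1 h2 (by omega) hs)
    unfold State.FreqGood
    rw [hs, hf]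
  · refine forall_congr' fun r => forall_congr' fun hr => ?_
    exact selGood_agree E h h1 h2 (by omega) (snap_agree_epoch E h h1 h2 (by omega))

omit [MeasurableSpace X] in
theorem withContexts_agree (ω : IdealData X) (e : ℕ) (β : ℕ → X × X) : ∀ i < e * n,
    (ω.withContexts (Finset.Ico (e * n) ((e + 1) * n)) β).2 i = ω.2 i := fun i hi => by
  simp [IdealData.withContexts, Finset.piecewise, hi]

open Classical in
/-- The indicator of the part of the good event that does not involve the frequency estimate of the
current epoch. -/
def restInd (P : Params) (n : ℕ) (ω : IdealData X) (e i : ℕ) : ℝ :=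
  if RestGood E P n ω e i then 1 else 0

theorem restInd_mem (ω : IdealData X) (e i : ℕ) :
    0 ≤ restInd E P n ω e i ∧ restInd E P n ω e i ≤ 1 := by
  unfold restInd; split_ifs <;> norm_num

/-- Integration over the good event, by first integrating over the contexts for the frequency
estimate of the current epoch. -/
theorem integral_goodInd_mul (h : Regime P n K ι) (e : ℕ) {i : ℕ} (hi : i < n)
    {Φ : IdealData X → ℝ}
    (hΦ : Integrable (fun ω => goodInd E P n ω ((e + 1) * n + i) * Φ ω) E.idealProb) :
    ∫ ω, goodInd E P n ω ((e + 1) * n + i) * Φ ω ∂E.idealProb =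
      ∫ ω, restInd E P n ω e i *
        ∫ β in {β | ∀ k, 7 / 8 * trueFreq E (idealState E P ω ((e + 1) * n)).snap k - P.γ / 2 ≤
            (idealState E P (ω.withContexts (Finset.Ico (e * n) ((e + 1) * n)) β)
              ((e + 1) * n)).freq k},
          Φ (ω.withContexts (Finset.Ico (e * n) ((e + 1) * n)) β)
          ∂(iidLaw (E.contextLaw.prod E.contextLaw)) ∂E.idealProb := by
  -- After the redraw the rest of the good event is a constant factor, and the current frequency
  -- condition becomes the domain of the inner integral.
  rw [integral_withContexts E hΦ (Finset.Ico (e * n) ((e + 1) * n))]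
  refine integral_congr_ae (ae_of_all _ fun ω => ?_)
  dsimp only
  rw [← integral_indicator (frequencyEstimate_epoch E h ω e).measurableSet_good,
    ← integral_const_mul]
  refine integral_congr_ae (ae_of_all _ fun β => ?_)
  have h1 := good_iff E h (ω.withContexts (Finset.Ico (e * n) ((e + 1) * n)) β) e hi
  rw [restGood_agree E h (show (ω.withContexts (Finset.Ico (e * n) ((e + 1) * n)) β).1 = ω.1 from rfl)
    (withContexts_agree ω e β) hi] at h1
  have h2 : (idealState E P (ω.withContexts (Finset.Ico (e * n) ((e + 1) * n)) β)
      ((e + 1) * n)).FreqGood E P ↔ β ∈ {β | ∀ k, 7 / 8 *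
        trueFreq E (idealState E P ω ((e + 1) * n)).snap k - P.γ / 2 ≤
            (idealState E P (ω.withContexts (Finset.Ico (e * n) ((e + 1) * n)) β)
              ((e + 1) * n)).freq k} := by
    simp only [State.FreqGood, idealState_withContexts_snap E h, Set.mem_ofPred_eq]
  rw [h2] at h1
  unfold goodInd restInd
  dsimp only
  by_cases ha : RestGood E P n ω e i
  · rw [if_pos ha, one_mul]
    by_cases hb : β ∈ {β | ∀ k, 7 / 8 *
        trueFreq E (idealState E P ω ((e + 1) * n)).snap k - P.γ / 2 ≤
            (idealState E P (ω.withContexts (Finset.Ico (e * n) ((e + 1) * n)) β)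
              ((e + 1) * n)).freq k}
    · rw [if_pos (h1.2 ⟨hb, ha⟩), one_mul, Set.indicator_of_mem hb]
    · rw [if_neg fun hg => hb (h1.1 hg).1, zero_mul, Set.indicator_of_notMem hb]
  · rw [if_neg ha, zero_mul, if_neg fun hg => ha (h1.1 hg).2, zero_mul]

/-- The factor by which the expectation of a loss estimate differs from the loss. -/
def freqRatio (P : Params) (ω : IdealData X) (j : ℕ) (k : Fin K) : ℝ :=
  trueFreq E (idealState E P ω j).snap k / ((idealState E P ω j).freq k + 3 / 2 * P.γ)

theorem measurable_freqRatio (P : Params) (j : ℕ) (k : Fin K) :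
    Measurable fun ω => freqRatio E P ω j k :=
  (measurable_trueFreq E P j k).div (((measurableFamily_idealState E P j).freq k).add_const _)

theorem freqRatio_mem (h : Regime P n K ι) (ω : IdealData X) (j : ℕ) (k : Fin K) :
    0 ≤ freqRatio E P ω j k ∧ freqRatio E P ω j k ≤ 1 / (3 * P.γ) := by
  have hγ := h.γ_pos
  have hf0 := (valid_idealState E P ω j).trueFreq_nonneg k
  have hf1 := trueFreq_le_half E (valid_idealState E P ω j) k
  have hx := freq_nonneg E h.L_eq h.n_pos ω j k
  unfold freqRatio
  refine ⟨by positivity, ?_⟩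
  rw [div_le_div_iff₀ (by positivity) (by positivity)]
  nlinarith

theorem pairLoss_mem (j : ℕ) (k : Fin K) (c : X) :
    0 ≤ E.pairLoss j k c ∧ E.pairLoss j k c ≤ 2 := by
  unfold Environment.pairLoss
  have := E.loss_nonneg (2 * j) k c
  have := E.loss_nonneg (2 * j + 1) k c
  have := E.loss_le_one (2 * j) k c
  have := E.loss_le_one (2 * j + 1) k c
  constructor <;> linarith

theorem freqRatio_withContexts (h : Regime P n K ι) (ω : IdealData X) (e : ℕ) {i : ℕ}
    (hi : i < n) (β : ℕ → X × X) (k : Fin K) :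
    freqRatio E P (ω.withContexts (Finset.Ico (e * n) ((e + 1) * n)) β) ((e + 1) * n + i) k =
      trueFreq E (idealState E P ω ((e + 1) * n)).snap k /
        ((idealState E P (ω.withContexts (Finset.Ico (e * n) ((e + 1) * n)) β)
          ((e + 1) * n)).freq k + 3 / 2 * P.γ) := by
  obtain ⟨hc1, -, hc3⟩ := epoch_constant E h.L_eq
    (ω.withContexts (Finset.Ico (e * n) ((e + 1) * n)) β) (e + 1) hi
  rw [freqRatio, hc1, hc3, idealState_withContexts_snap E h]

theorem Regime.variance_le (h : Regime P n K ι) : 1 / (2 * n : ℝ) ≤ P.γ / 32 := by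
  have hn : (0 : ℝ) < n := by exact_mod_cast h.n_pos
  rw [div_le_div_iff₀ (by positivity) (by norm_num)]
  linarith [h.nγ_ge]

/-- The loss estimates of a policy are optimistic in expectation. -/
theorem integral_policy_bias_nonpos (h : Regime P n K ι) {j : ℕ} (hj : n ≤ j) (m : Fin K) {g : ℝ}
    (hg : 0 ≤ g) :
    ∫ ω, goodInd E P n ω j * (g * (freqRatio E P ω j m - 1)) ∂E.idealProb ≤ 0 := by
  obtain ⟨e, i, hi, rfl⟩ := exists_epoch h.n_pos hj
  have hγ := h.γ_pos
  have hmem := fun ω => goodInd_mem (P := P) (n := n) E ω ((e + 1) * n + i)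
  have hr := fun ω => freqRatio_mem E h ω ((e + 1) * n + i) m
  have hint : Integrable (fun ω => goodInd E P n ω ((e + 1) * n + i) *
      (g * (freqRatio E P ω ((e + 1) * n + i) m - 1))) E.idealProb := by
    refine Integrable.of_bound ((measurable_goodInd E _).mul (((measurable_freqRatio E P _
      m).sub_const 1).const_mul g)).aestronglyMeasurable (1 * (g * (1 / (3 * P.γ) + 1)))
      (ae_of_all _ fun ω => ?_)
    rw [Real.norm_eq_abs, abs_mul, abs_mul, abs_of_nonneg (hmem ω).1, abs_of_nonneg hg]
    have h1 : |freqRatio E P ω ((e + 1) * n + i) m - 1| ≤ 1 / (3 * P.γ) + 1 := by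
      have := hr ω
      have : 0 < 1 / (3 * P.γ) := by positivity
      rw [abs_le]; constructor <;> linarith
    exact mul_le_mul (hmem ω).2 (mul_le_mul_of_nonneg_left h1 hg)
      (mul_nonneg hg (abs_nonneg _)) zero_le_one
  rw [integral_goodInd_mul E h e hi hint]
  refine integral_nonpos fun ω => mul_nonpos_of_nonneg_of_nonpos (restInd_mem E ω e i).1 ?_
  simp only [freqRatio_withContexts E h ω e hi]
  rw [integral_const_mul]
  refine mul_nonpos_of_nonneg_of_nonpos hg ?_
  exact (frequencyEstimate_epoch E h ω e).setIntegral_div_sub_one_nonpos hγ h.γ_le_one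
    (by positivity) h.variance_le h.union m

/-- A nonintegrable left-hand side has integral 0, so the integrability of the inner integrals
obtained after redrawing need not be checked. -/
theorem integral_mono_of_nonneg_right {Ω : Type*} [MeasurableSpace Ω] {Q : Measure Ω}
    {f g : Ω → ℝ} (hg : Integrable g Q) (hg0 : ∀ x, 0 ≤ g x) (h : ∀ x, f x ≤ g x) :
    ∫ x, f x ∂Q ≤ ∫ x, g x ∂Q := by
  by_cases hf : Integrable f Q
  · exact integral_mono hf hg h
  · rw [integral_undef hf]; exact integral_nonneg hg0

/-- The coefficient in the bias bound. -/
def biasCoeff (P : Params) (n : ℕ) (ω : IdealData X) (e : ℕ) (k : Fin K) : ℝ :=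
  P.γ / 4 + (3 / n + 27 / 2 * P.γ) /
    (trueFreq E (idealState E P ω ((e + 1) * n)).snap k + 3 / 2 * P.γ)

/-- Exhibits the FTRL distribution as a function of the redrawn estimate through the denominators
only, the form that the expected bias bound requires. -/
theorem ftrl_withContexts (h : Regime P n K ι) (ω : IdealData X) (e : ℕ) {i : ℕ}
    (hi : i < n) (β : ℕ → X × X) (c : X) :
    (idealState E P (ω.withContexts (Finset.Ico (e * n) ((e + 1) * n)) β)
        ((e + 1) * n + i)).ftrl E P c =
      ftrlDist P.η (E.active c) (fun k => (idealState E P ω ((e + 1) * n)).cumLoss c k +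
        (∑ m ∈ Finset.Ico ((e + 1) * n) ((e + 1) * n + i), selLoss E P ω m c k) /
          ((idealState E P (ω.withContexts (Finset.Ico (e * n) ((e + 1) * n)) β)
            ((e + 1) * n)).freq k + 3 / 2 * P.γ)) := by
  have h1 : (ω.withContexts (Finset.Ico (e * n) ((e + 1) * n)) β).1 = ω.1 := rfl
  have h2 := withContexts_agree (n := n) ω e β
  unfold State.ftrl
  congr 1
  funext k
  rw [cumLoss_epoch E h.L_eq _ e hi.le, (idealState_agree_next E h.L_eq h.n_pos h1 h2).1]
  congr 2
  refine Finset.sum_congr rfl fun m hm => ?_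
  rw [Finset.mem_Ico] at hm
  rw [selLoss_congr E h1 (selection_agree E h.L_eq h.n_pos h1 h2 ?_)]
  have : (e + 2) * n = (e + 1) * n + n := by ring
  omega

/-- The bias of the loss estimates for the distribution played. -/
theorem integral_play_bias_le (h : Regime P n K ι) (e : ℕ) {i : ℕ} (hi : i < n) (c : X) :
    ∫ ω, goodInd E P n ω ((e + 1) * n + i) * (∑ k,
        (idealState E P ω ((e + 1) * n + i)).ftrl E P c k * (E.pairLoss ((e + 1) * n + i) k c *
          (1 - freqRatio E P ω ((e + 1) * n + i) k))) ∂E.idealProb ≤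
      ∫ ω, ∑ k, 2 * (idealState E P ω ((e + 1) * n)).snap c k * biasCoeff E P n ω e k
        ∂E.idealProb := by
  have hγ := h.γ_pos
  have hn : (0 : ℝ) < n := by exact_mod_cast h.n_pos
  set j := (e + 1) * n + i with hj
  have hmem := fun ω => goodInd_mem (P := P) (n := n) E ω j
  have hr := fun ω => freqRatio_mem E h ω j
  have hf0 := fun ω => (valid_idealState E P ω ((e + 1) * n)).trueFreq_nonneg
  have hs := fun ω => (valid_idealState E P ω ((e + 1) * n)).snap_mem c
  have hmp : ∀ k, Measurable fun ω => (idealState E P ω j).ftrl E P c k := fun k =>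
    (measurable_idealFtrl E P j k).comp (f := fun ω => (ω, c)) (by fun_prop)
  have hms : ∀ k, Measurable fun ω => (idealState E P ω ((e + 1) * n)).snap c k := fun k =>
    ((measurableFamily_idealState E P ((e + 1) * n)).snap k).comp (f := fun ω => (ω, c))
      (by fun_prop)
  have hint : Integrable (fun ω => goodInd E P n ω j * (∑ k,
        (idealState E P ω j).ftrl E P c k * (E.pairLoss j k c *
          (1 - freqRatio E P ω j k)))) E.idealProb := by
    refine Integrable.of_bound ((measurable_goodInd E j).mul (Finset.measurable_sum _ fun k _ =>
      (hmp k).mul (((measurable_freqRatio E P j k).const_sub 1).const_mul _))).aestronglyMeasurable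
      (1 * (∑ _k : Fin K, 1 * (2 * (1 / (3 * P.γ) + 1)))) (ae_of_all _ fun ω => ?_)
    rw [Real.norm_eq_abs, abs_mul, abs_of_nonneg (hmem ω).1]
    refine mul_le_mul (hmem ω).2 ?_ (abs_nonneg _) zero_le_one
    refine (Finset.abs_sum_le_sum_abs _ _).trans (Finset.sum_le_sum fun k _ => ?_)
    have hp := ftrl_mem (P := P) E ω j c
    obtain ⟨hg0, hg2⟩ := pairLoss_mem E j k c
    rw [abs_mul, abs_mul, abs_of_nonneg (hp.1 k), abs_of_nonneg hg0]
    have h1 : |1 - freqRatio E P ω j k| ≤ 1 / (3 * P.γ) + 1 := by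
      have := hr ω k
      have : 0 < 1 / (3 * P.γ) := by positivity
      rw [abs_le]; constructor <;> linarith
    exact mul_le_mul (le_one_of_mem_simplexOn hp k)
      (mul_le_mul hg2 h1 (abs_nonneg _) zero_le_two) (mul_nonneg hg0 (abs_nonneg _)) zero_le_one
  have hcoeff0 : ∀ ω k, 0 ≤ biasCoeff E P n ω e k := fun ω k => by
    have := hf0 ω k
    unfold biasCoeff; positivity
  have hcoeff1 : ∀ ω k, biasCoeff E P n ω e k ≤ P.γ / 4 + (3 / n + 27 / 2 * P.γ) /
      (3 / 2 * P.γ) := fun ω k => by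
    have := hf0 ω k
    unfold biasCoeff
    gcongr
    linarith
  have hcm : ∀ k, Measurable fun ω => biasCoeff E P n ω e k := fun k => by
    have := measurable_trueFreq E P ((e + 1) * n) k
    unfold biasCoeff; fun_prop
  rw [integral_goodInd_mul E h e hi hint]
  refine integral_mono_of_nonneg_right ?_ (fun ω => Finset.sum_nonneg fun k _ =>
    mul_nonneg (mul_nonneg zero_le_two ((hs ω).1 k)) (hcoeff0 ω k)) fun ω => ?_
  · refine integrable_finsetSum _ fun k _ => ?_
    refine integrable_of_mem_Icc (a := 0) (b := 2 * 1 * (P.γ / 4 + (3 / n + 27 / 2 * P.γ) /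
      (3 / 2 * P.γ))) (((hms k).const_mul 2).mul (hcm k)) fun ω =>
      ⟨mul_nonneg (mul_nonneg zero_le_two ((hs ω).1 k)) (hcoeff0 ω k), ?_⟩
    exact mul_le_mul (mul_le_mul_of_nonneg_left (le_one_of_mem_simplexOn (hs ω) k) zero_le_two)
      (hcoeff1 ω k) (hcoeff0 ω k) (by norm_num)
  · have hR : 0 ≤ ∑ k, 2 * (idealState E P ω ((e + 1) * n)).snap c k * biasCoeff E P n ω e k :=
      Finset.sum_nonneg fun k _ =>
        mul_nonneg (mul_nonneg zero_le_two ((hs ω).1 k)) (hcoeff0 ω k)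
    -- Off this event the integrand vanishes. On it the selection counts bound the numerators.
    by_cases hg : RestGood E P n ω e i
    swap
    · rw [restInd, if_neg hg, zero_mul]; exact hR
    rw [restInd, if_pos hg, one_mul]
    simp only [hj, freqRatio_withContexts E h ω e hi, ftrl_withContexts E h ω e hi]
    have hsel := sum_selLoss_div_le h ω e hi (hg.2 i le_rfl) c
    have hD : ∀ k, (∑ m ∈ Finset.Ico ((e + 1) * n) ((e + 1) * n + i), selLoss E P ω m c k) /
        (trueFreq E (idealState E P ω ((e + 1) * n)).snap k + 3 / 2 * P.γ) ≤
          1303 / 1000 * (2 * n) := fun k => hsel k (by linarith [hf0 ω k])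
    have hN := fun k => sum_selLoss_nonneg (E := E) (P := P) ω ((e + 1) * n) ((e + 1) * n + i) c k
    refine ((frequencyEstimate_epoch E h ω e).setIntegral_ftrl_bias_le h.η_pos hγ (by positivity)
      (E.active_nonempty c) hN (fun k => ?_) (fun k => (pairLoss_mem E _ k c).1)
      fun k => (pairLoss_mem E _ k c).2).trans ?_
    -- Here `η * (1.303 * 2 * n) ≤ 2.606 / 8 < 1 / 3`.
    · have := mul_le_mul_of_nonneg_left (hD k) h.η_pos.le
      have := h.η_le
      linarith
    · refine Finset.sum_le_sum fun k _ => ?_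
      -- The FTRL distribution with `φ` replaced by the true frequency is still at most twice the
      -- snapshot, and it no longer depends on the redrawn contexts.
      have hcomp := (ftrlDist_comparable h ω e hg.1 c (D := fun k =>
        (∑ m ∈ Finset.Ico ((e + 1) * n) ((e + 1) * n + i), selLoss E P ω m c k) /
        (trueFreq E (idealState E P ω ((e + 1) * n)).snap k + 3 / 2 * P.γ))
        (fun k => div_nonneg (hN k) (by linarith [hf0 ω k])) hD k).2
      have hcoef : 2 * (K * Real.exp (-ι)) + (6 * (1 / (2 * n)) + 27 / 2 * P.γ) /
          (trueFreq E (idealState E P ω ((e + 1) * n)).snap k + 3 / 2 * P.γ) ≤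
          biasCoeff E P n ω e k := by
        have h3 : (6 * (1 / (2 * n)) + 27 / 2 * P.γ : ℝ) = 3 / n + 27 / 2 * P.γ := by
          field_simp; ring
        unfold biasCoeff
        rw [h3]
        linarith [h.union]
      have hcoef0 : 0 ≤ 2 * (K * Real.exp (-ι)) + (6 * (1 / (2 * n)) + 27 / 2 * P.γ) /
          (trueFreq E (idealState E P ω ((e + 1) * n)).snap k + 3 / 2 * P.γ) := by
        have := hf0 ω k
        positivity
      exact mul_le_mul hcomp hcoef hcoef0 (mul_nonneg zero_le_two ((hs ω).1 k))

/-- The bias of the loss estimates for the distribution played, on average over the contexts. -/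
theorem integral_integral_play_bias_le (h : Regime P n K ι) {j : ℕ} (hj : n ≤ j) :
    ∫ c, ∫ ω, goodInd E P n ω j * (∑ k, (idealState E P ω j).ftrl E P c k *
        (E.pairLoss j k c * (1 - freqRatio E P ω j k))) ∂E.idealProb ∂E.contextLaw ≤
      56 * K * P.γ := by
  obtain ⟨e, i, hi, rfl⟩ := exists_epoch h.n_pos hj
  have hγ := h.γ_pos
  have hn : (0 : ℝ) < n := by exact_mod_cast h.n_pos
  have hf0 := fun ω => (valid_idealState E P ω ((e + 1) * n)).trueFreq_nonneg
  have hs := fun ω c => (valid_idealState E P ω ((e + 1) * n)).snap_mem c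
  have hcoeff0 : ∀ ω k, 0 ≤ biasCoeff E P n ω e k := fun ω k => by
    have := hf0 ω k
    unfold biasCoeff; positivity
  have hcoeff1 : ∀ ω k, biasCoeff E P n ω e k ≤ P.γ / 4 + (3 / n + 27 / 2 * P.γ) /
      (3 / 2 * P.γ) := fun ω k => by
    have := hf0 ω k
    unfold biasCoeff
    gcongr
    linarith
  have hcm : ∀ k, Measurable fun ω => biasCoeff E P n ω e k := fun k => by
    have := measurable_trueFreq E P ((e + 1) * n) k
    unfold biasCoeff; fun_prop
  have hint : Integrable (fun z : X × IdealData X => ∑ k,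
      2 * (idealState E P z.2 ((e + 1) * n)).snap z.1 k * biasCoeff E P n z.2 e k)
      (E.contextLaw.prod E.idealProb) := by
    refine integrable_finsetSum _ fun k _ => ?_
    have hsm : Measurable fun z : X × IdealData X =>
        (idealState E P z.2 ((e + 1) * n)).snap z.1 k :=
      ((measurableFamily_idealState E P ((e + 1) * n)).snap k).comp measurable_swap
    refine integrable_of_mem_Icc (a := 0) (b := 2 * 1 * (P.γ / 4 + (3 / n + 27 / 2 * P.γ) /
      (3 / 2 * P.γ))) ((hsm.const_mul 2).mul ((hcm k).comp measurable_snd)) fun z =>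
      ⟨mul_nonneg (mul_nonneg zero_le_two ((hs z.2 z.1).1 k)) (hcoeff0 z.2 k), ?_⟩
    exact mul_le_mul (mul_le_mul_of_nonneg_left (le_one_of_mem_simplexOn (hs z.2 z.1) k) zero_le_two)
      (hcoeff1 z.2 k) (hcoeff0 z.2 k) (by norm_num)
  refine (integral_mono_of_nonneg_right hint.integral_prod_left (fun c => integral_nonneg fun ω =>
    Finset.sum_nonneg fun k _ => mul_nonneg (mul_nonneg zero_le_two ((hs ω c).1 k)) (hcoeff0 ω k))
    fun c => integral_play_bias_le E h e hi c).trans ?_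
  rw [integral_integral_swap hint]
  refine integral_le_of_le_const (by positivity) fun ω => ?_
  have hsi : ∀ k, Integrable (fun c => (idealState E P ω ((e + 1) * n)).snap c k) E.contextLaw :=
    fun k => integrable_of_mem_Icc (measurable_snap E P ω _ k) fun c =>
      ⟨(hs ω c).1 k, le_one_of_mem_simplexOn (hs ω c) k⟩
  dsimp only
  rw [integral_finsetSum _ fun k _ => ((hsi k).const_mul 2).mul_const _]
  have hK : 56 * K * P.γ = ∑ _k : Fin K, 56 * P.γ := by simp; ring
  rw [hK]
  refine Finset.sum_le_sum fun k _ => ?_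
  rw [integral_mul_const, integral_const_mul]
  -- Averaging over contexts turns the snapshot into `2 * f`, which cancels the denominator `f + 3 /
  -- 2 * γ`. Each arm then costs O(γ), independently of the contexts.
  have hf : ∫ c, (idealState E P ω ((e + 1) * n)).snap c k ∂E.contextLaw =
    2 * trueFreq E (idealState E P ω ((e + 1) * n)).snap k := by unfold trueFreq; ring
  rw [hf]
  have h0 := hf0 ω k
  have h1 := trueFreq_le_half E (valid_idealState E P ω ((e + 1) * n)) k
  unfold biasCoeff
  set f := trueFreq E (idealState E P ω ((e + 1) * n)).snap k
  have h2 : f * ((3 / n + 27 / 2 * P.γ) / (f + 3 / 2 * P.γ)) ≤ 3 / n + 27 / 2 * P.γ := by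
    rw [← mul_div_assoc, div_le_iff₀ (by positivity)]
    have : (0 : ℝ) ≤ 3 / n + 27 / 2 * P.γ := by positivity
    nlinarith
  have h3 : (3 : ℝ) / n ≤ 6 / 32 * P.γ := by
    have := h.variance_le
    have e3 : (3 : ℝ) / n = 6 * (1 / (2 * n)) := by field_simp; norm_num
    rw [e3]; linarith
  -- Sum of the constants: at most 1/2 from the term `γ / 4`, 3/4 from `3 / n`, and 54 from `27 / 2
  -- * γ`, hence below 56.
  nlinarith

end Bias

/-! ### The expected regret of one pair of rounds. -/

section ExpectedRegret

variable {X : Type u} [MeasurableSpace X] {K : ℕ} [NeZero K] (E : Environment X K) {P : Params}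
  {n : ℕ} {ι : ℝ}

theorem abs_sum_simplex_mul_le {A : Finset (Fin K)} {x v : Fin K → ℝ} (hx : x ∈ simplexOn A)
    {B : ℝ} (hv : ∀ k, |v k| ≤ B) : |∑ k, x k * v k| ≤ B := by
  refine (Finset.abs_sum_le_sum_abs _ _).trans ?_
  calc ∑ k, |x k * v k| ≤ ∑ k, x k * B := Finset.sum_le_sum fun k _ => by
        rw [abs_mul, abs_of_nonneg (hx.1 k)]
        exact mul_le_mul_of_nonneg_left (hv k) (hx.1 k)
    _ = B := by rw [← Finset.sum_mul, hx.2.1, one_mul]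

theorem abs_goodInd_mul_le (ω : IdealData X) (j : ℕ) {x B : ℝ} (h : |x| ≤ B) :
    |goodInd E P n ω j * x| ≤ B := by
  obtain ⟨h0, h1⟩ := goodInd_mem (P := P) (n := n) E ω j
  rw [abs_mul, abs_of_nonneg h0]
  exact (mul_le_of_le_one_left (abs_nonneg x) h1).trans h

theorem integrable_of_abs_le {Ω : Type*} [MeasurableSpace Ω] {Q : Measure Ω} [IsProbabilityMeasure Q]
    {f : Ω → ℝ} (hf : Measurable f) {B : ℝ} (h : ∀ x, |f x| ≤ B) : Integrable f Q :=
  Integrable.of_bound hf.aestronglyMeasurable B (ae_of_all _ h)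

theorem measurable_pairLoss (j : ℕ) (k : Fin K) : Measurable fun c => E.pairLoss j k c :=
  (E.measurable_loss (2 * j) k).add (E.measurable_loss (2 * j + 1) k)

theorem abs_pairLoss_le (j : ℕ) (k : Fin K) (c : X) : |E.pairLoss j k c| ≤ 2 := by
  have := pairLoss_mem E j k c
  rw [abs_le]; constructor <;> linarith

theorem abs_freqRatio_sub_one_le (h : Regime P n K ι) (ω : IdealData X) (j : ℕ) (k : Fin K) :
    |freqRatio E P ω j k - 1| ≤ 1 / (3 * P.γ) + 1 := by
  have hγ := h.γ_pos
  have := freqRatio_mem E h ω j k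
  have : 0 < 1 / (3 * P.γ) := by positivity
  rw [abs_le]; constructor <;> linarith

theorem abs_lossEst_le (h : Regime P n K ι) (ω : IdealData X) (j : ℕ) (c : X) (k : Fin K) :
    |lossEst E P ω j c k| ≤ 4 / (3 * P.γ) := by
  rw [abs_of_nonneg (lossEst_nonneg E h.L_eq h.n_pos h.γ_pos ω j c k)]
  exact lossEst_le E h.L_eq h.n_pos h.γ_pos ω j c k

theorem measurable_idealFtrl_left (P : Params) (j : ℕ) (c : X) (k : Fin K) :
    Measurable fun ω => (idealState E P ω j).ftrl E P c k :=
  (measurable_idealFtrl E P j k).comp (f := fun ω => (ω, c)) (by fun_prop)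

theorem measurable_lossEst_left (P : Params) (j : ℕ) (c : X) (k : Fin K) :
    Measurable fun ω => lossEst E P ω j c k :=
  (measurable_lossEst E P j k).comp (f := fun ω => (ω, c)) (by fun_prop)

/-- The regret of the FTRL distribution for the loss estimates, in expectation. -/
theorem integral_ftrl_lossEst (h : Regime P n K ι) {j : ℕ} (hj : n ≤ j) (c : X) (m : Fin K) :
    ∫ ω, goodInd E P n ω j * (∑ k, (idealState E P ω j).ftrl E P c k * lossEst E P ω j c k
        - lossEst E P ω j c m) ∂E.idealProb =
      ∫ ω, goodInd E P n ω j * (∑ k, (idealState E P ω j).ftrl E P c k *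
        (E.pairLoss j k c * freqRatio E P ω j k) - E.pairLoss j m c * freqRatio E P ω j m)
        ∂E.idealProb := by
  have hγ := h.γ_pos
  have hmg := measurable_goodInd (P := P) (n := n) E j
  have hmp := measurable_idealFtrl_left E P j c
  have hml := measurable_lossEst_left E P j c
  have hmr := measurable_freqRatio E P j
  have hp := fun ω => ftrl_mem (P := P) E ω j c
  have hp1 : ∀ ω k, |(idealState E P ω j).ftrl E P c k| ≤ 1 := fun ω k => by
    rw [abs_of_nonneg ((hp ω).1 k)]; exact le_one_of_mem_simplexOn (hp ω) k
  have hgp : ∀ ω k, |goodInd E P n ω j * (idealState E P ω j).ftrl E P c k| ≤ 1 := fun ω k =>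
    abs_goodInd_mul_le E ω j (hp1 ω k)
  have hg1 : ∀ ω, |goodInd E P n ω j| ≤ 1 := fun ω => by
    obtain ⟨h0, h1⟩ := goodInd_mem (P := P) (n := n) E ω j
    rwa [abs_of_nonneg h0]
  have hgr : ∀ ω k, |E.pairLoss j k c * freqRatio E P ω j k| ≤ 2 * (1 / (3 * P.γ)) :=
    fun ω k => by
      rw [abs_mul, abs_of_nonneg (freqRatio_mem E h ω j k).1]
      exact mul_le_mul (abs_pairLoss_le E j k c) (freqRatio_mem E h ω j k).2
        (freqRatio_mem E h ω j k).1 zero_le_two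
  have key : ∀ F : IdealData X → Fin K → ℝ, (∀ k, Measurable fun ω => F ω k) →
      ∀ B, (∀ ω k, |F ω k| ≤ B) →
      ∫ ω, goodInd E P n ω j * (∑ k, (idealState E P ω j).ftrl E P c k * F ω k - F ω m)
        ∂E.idealProb = ∑ k, ∫ ω, goodInd E P n ω j * (idealState E P ω j).ftrl E P c k * F ω k
        ∂E.idealProb - ∫ ω, goodInd E P n ω j * F ω m ∂E.idealProb := by
    intro F hF B hB
    have hi : ∀ k, Integrable (fun ω => goodInd E P n ω j * (idealState E P ω j).ftrl E P c k *
        F ω k) E.idealProb := fun k =>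
      integrable_of_abs_le ((hmg.mul (hmp k)).mul (hF k)) (B := 1 * B) fun ω => by
        rw [abs_mul]
        exact mul_le_mul (hgp ω k) (hB ω k) (abs_nonneg _) zero_le_one
    have hi' : Integrable (fun ω => goodInd E P n ω j * F ω m) E.idealProb :=
      integrable_of_abs_le (hmg.mul (hF m)) fun ω => abs_goodInd_mul_le E ω j (hB ω m)
    rw [← integral_finsetSum _ fun k _ => hi k,
      ← integral_sub (integrable_finsetSum _ fun k _ => hi k) hi']
    refine integral_congr_ae (ae_of_all _ fun ω => ?_)
    dsimp only
    rw [mul_sub, Finset.mul_sum]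
    simp only [mul_assoc]
  rw [key (fun ω k => lossEst E P ω j c k) hml _ (fun ω k => abs_lossEst_le E h ω j c k),
    key (fun ω k => E.pairLoss j k c * freqRatio E P ω j k) (fun k => (hmr k).const_mul _) _ hgr]
  have hpg := predictable_goodInd E P n j
  have hpp : ∀ k, Predictable (fun ω => goodInd E P n ω j *
      (idealState E P ω j).ftrl E P c k) j := fun k =>
    hpg.mul (predictable_state E P j fun st => st.ftrl E P c k)
  congr 1
  · exact Finset.sum_congr rfl fun k _ =>
      integral_lossEst E h hj c k (hpp k) (hmg.mul (hmp k)) fun ω => hgp ω k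
  · exact integral_lossEst E h hj c m hpg hmg hg1

theorem integrable_pairRegret (P : Params) (π : E.Policy) (j : ℕ) :
    Integrable (fun z : X × IdealData X => (idealState E P z.2 j).pairRegret E P π j z.1)
      (E.contextLaw.prod E.idealProb) := by
  refine integrable_of_abs_le (B := 2 + 2) ?_ fun z => ?_
  · refine Measurable.sub (Finset.measurable_sum _ fun k _ => Measurable.mul ?_
      ((measurable_pairLoss E j k).comp measurable_fst)) ?_
    · exact ((measurableFamily_idealState E P j).play (2 * j) k).comp measurable_swap
    · exact (measurable_at_arm (measurable_pairLoss E j) π.2.1).comp measurable_fst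
  · exact (abs_sub _ _).trans (add_le_add (abs_sum_simplex_mul_le
      ((valid_idealState E P z.2 j).play_mem P (2 * j) z.1) fun k => abs_pairLoss_le E j k z.1)
      (abs_pairLoss_le E j _ z.1))

theorem pairRegret_le_two (P : Params) (π : E.Policy) (ω : IdealData X) (j : ℕ) (c : X) :
    (idealState E P ω j).pairRegret E P π j c ≤ 2 := by
  have h1 := (abs_le.1 (abs_sum_simplex_mul_le
    ((valid_idealState E P ω j).play_mem P (2 * j) c) fun k => abs_pairLoss_le E j k c)).2
  have h2 := (pairLoss_mem E j (π.1 c) c).1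
  unfold State.pairRegret
  linarith

theorem integral_one_sub_goodInd (j : ℕ) :
    ∫ ω, (1 - goodInd E P n ω j) ∂E.idealProb = E.idealProb.real {ω | Good E P n ω j}ᶜ := by
  have h : (fun ω => 1 - goodInd E P n ω j) = {ω | Good E P n ω j}ᶜ.indicator fun _ => 1 := by
    funext ω
    unfold goodInd
    by_cases hg : Good E P n ω j <;> simp [hg]
  rw [h, integral_indicator_const _ (measurableSet_good E P j).compl]
  simp

/-- The expected regret in a pair of rounds that does not belong to the first epoch. -/
theorem integral_pairRegret_le (h : Regime P n K ι) {j : ℕ} (hj : n ≤ j) (π : E.Policy) (c : X) :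
    ∫ ω, (idealState E P ω j).pairRegret E P π j c ∂E.idealProb ≤
      2 * E.idealProb.real {ω | Good E P n ω j}ᶜ +
      ∫ ω, goodInd E P n ω j * (∑ k, (idealState E P ω j).ftrl E P c k * lossEst E P ω j c k
        - lossEst E P ω j c (π.1 c)) ∂E.idealProb +
      ∫ ω, goodInd E P n ω j * (∑ k, (idealState E P ω j).ftrl E P c k *
        (E.pairLoss j k c * (1 - freqRatio E P ω j k))) ∂E.idealProb := by
  have hγ := h.γ_pos
  have hmg := measurable_goodInd (P := P) (n := n) E j
  have hmp := measurable_idealFtrl_left E P j c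
  have hmr := measurable_freqRatio E P j
  have hp := fun ω => ftrl_mem (P := P) E ω j c
  have hB0 : 0 < 1 / (3 * P.γ) := by positivity
  have hgr : ∀ ω k, |E.pairLoss j k c * freqRatio E P ω j k| ≤ 2 * (1 / (3 * P.γ)) :=
    fun ω k => by
      rw [abs_mul, abs_of_nonneg (freqRatio_mem E h ω j k).1]
      exact mul_le_mul (abs_pairLoss_le E j k c) (freqRatio_mem E h ω j k).2
        (freqRatio_mem E h ω j k).1 zero_le_two
  have hg1r : ∀ ω k, |E.pairLoss j k c * (freqRatio E P ω j k - 1)| ≤ 2 * (1 / (3 * P.γ) + 1) :=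
    fun ω k => by
      rw [abs_mul]
      exact mul_le_mul (abs_pairLoss_le E j k c) (abs_freqRatio_sub_one_le E h ω j k)
        (abs_nonneg _) zero_le_two
  have hg1r' : ∀ ω k, |E.pairLoss j k c * (1 - freqRatio E P ω j k)| ≤ 2 * (1 / (3 * P.γ) + 1) :=
    fun ω k => by
      rw [← neg_sub (freqRatio E P ω j k) 1, mul_neg, abs_neg]
      exact hg1r ω k
  have iU : Integrable (fun ω => goodInd E P n ω j * (∑ k, (idealState E P ω j).ftrl E P c k *
      (E.pairLoss j k c * freqRatio E P ω j k) -
      E.pairLoss j (π.1 c) c * freqRatio E P ω j (π.1 c))) E.idealProb := by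
    refine integrable_of_abs_le (hmg.mul ((Finset.measurable_sum _ fun k _ =>
      (hmp k).mul ((hmr k).const_mul _)).sub ((hmr _).const_mul _)))
      (B := 2 * (1 / (3 * P.γ)) + 2 * (1 / (3 * P.γ))) fun ω => abs_goodInd_mul_le E ω j ?_
    exact (abs_sub _ _).trans (add_le_add (abs_sum_simplex_mul_le (hp ω) (hgr ω)) (hgr ω _))
  have iA : Integrable (fun ω => goodInd E P n ω j * (∑ k, (idealState E P ω j).ftrl E P c k *
        (E.pairLoss j k c * (1 - freqRatio E P ω j k)))) E.idealProb :=
    integrable_of_abs_le (hmg.mul (Finset.measurable_sum _ fun k _ =>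
      (hmp k).mul (((hmr k).const_sub 1).const_mul _))) (B := 2 * (1 / (3 * P.γ) + 1)) fun ω =>
      abs_goodInd_mul_le E ω j (abs_sum_simplex_mul_le (hp ω) (hg1r' ω))
  have iB : Integrable (fun ω => goodInd E P n ω j * (E.pairLoss j (π.1 c) c *
      (freqRatio E P ω j (π.1 c) - 1))) E.idealProb :=
    integrable_of_abs_le (hmg.mul (((hmr _).sub_const 1).const_mul _))
      (B := 2 * (1 / (3 * P.γ) + 1)) fun ω => abs_goodInd_mul_le E ω j (hg1r ω _)
  have iG : Integrable (fun ω => 1 - goodInd E P n ω j) E.idealProb :=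
    integrable_of_mem_Icc (a := 0) (b := 1) (hmg.const_sub 1) fun ω => by
      have := goodInd_mem (P := P) (n := n) E ω j
      constructor <;> linarith
  have hB := integral_policy_bias_nonpos E h hj (π.1 c) (pairLoss_mem E j (π.1 c) c).1
  have hsum : ∀ {g U A B : IdealData X → ℝ}, Integrable g E.idealProb →
      Integrable U E.idealProb → Integrable A E.idealProb → Integrable B E.idealProb →
      ∫ ω, (2 * g ω + (U ω + A ω + B ω)) ∂E.idealProb = 2 * ∫ ω, g ω ∂E.idealProb +
        (∫ ω, U ω ∂E.idealProb + ∫ ω, A ω ∂E.idealProb + ∫ ω, B ω ∂E.idealProb) := by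
    intro g U A B hg hU hA hB
    have h1 : Integrable (fun ω => U ω + A ω) E.idealProb := hU.add hA
    have h2 : Integrable (fun ω => U ω + A ω + B ω) E.idealProb := h1.add hB
    rw [integral_add (hg.const_mul 2) h2, integral_add h1 hB, integral_add hU hA,
      integral_const_mul]
  -- On the good event FTRL is played. With r = `freqRatio` and ℓ = `pairLoss`, `p·ℓ - ℓ_π` equals
  -- `(p·(ℓ r) - ℓ_π r_π) + p·(ℓ (1 - r)) + ℓ_π (r_π - 1)`. Off the good event the regret of a pair
  -- is at most 2.
  calc ∫ ω, (idealState E P ω j).pairRegret E P π j c ∂E.idealProb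
      ≤ ∫ ω, (2 * (1 - goodInd E P n ω j) + (goodInd E P n ω j *
          (∑ k, (idealState E P ω j).ftrl E P c k *
            (E.pairLoss j k c * freqRatio E P ω j k) -
            E.pairLoss j (π.1 c) c * freqRatio E P ω j (π.1 c)) +
          goodInd E P n ω j * (∑ k, (idealState E P ω j).ftrl E P c k *
            (E.pairLoss j k c * (1 - freqRatio E P ω j k))) +
          goodInd E P n ω j * (E.pairLoss j (π.1 c) c *
            (freqRatio E P ω j (π.1 c) - 1)))) ∂E.idealProb := by
        refine integral_mono ?_ ((iG.const_mul 2).add ((iU.add iA).add iB)) fun ω => ?_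
        · refine integrable_of_abs_le (B := 2 + 2) ?_ fun ω => ?_
          · refine Measurable.sub_const (Finset.measurable_sum _ fun k _ =>
              Measurable.mul_const ?_ _) _
            exact ((measurableFamily_idealState E P j).play (2 * j) k).comp (f := fun ω => (ω, c))
              (by fun_prop)
          · exact (abs_sub _ _).trans (add_le_add (abs_sum_simplex_mul_le
              ((valid_idealState E P ω j).play_mem P (2 * j) c) fun k => abs_pairLoss_le E j k c)
              (abs_pairLoss_le E j _ c))
        · by_cases hg : Good E P n ω j
          · have h1 : goodInd E P n ω j = 1 := by rw [goodInd, if_pos hg]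
            simp only [h1, State.pairRegret, hg.play_eq h hj c]
            refine le_of_eq ?_
            simp only [mul_sub, mul_one, Finset.sum_sub_distrib]
            ring
          · have h0 : goodInd E P n ω j = 0 := by rw [goodInd, if_neg hg]
            simp only [h0]
            have := pairRegret_le_two E P π ω j c
            linarith
    _ = 2 * E.idealProb.real {ω | Good E P n ω j}ᶜ + (
          ∫ ω, goodInd E P n ω j * (∑ k, (idealState E P ω j).ftrl E P c k *
            (E.pairLoss j k c * freqRatio E P ω j k) -
            E.pairLoss j (π.1 c) c * freqRatio E P ω j (π.1 c)) ∂E.idealProb +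
          ∫ ω, goodInd E P n ω j * (∑ k, (idealState E P ω j).ftrl E P c k *
            (E.pairLoss j k c * (1 - freqRatio E P ω j k))) ∂E.idealProb +
          ∫ ω, goodInd E P n ω j * (E.pairLoss j (π.1 c) c *
            (freqRatio E P ω j (π.1 c) - 1)) ∂E.idealProb) := by
        rw [hsum iG iU iA iB, integral_one_sub_goodInd]
    _ ≤ _ := by
        -- The first part is the expected regret for the estimates. The last part is nonpositive by
        -- `hB` and is dropped.
        rw [integral_ftrl_lossEst E h hj]
        linarith

theorem measurable_secondMoment (P : Params) (n j : ℕ) :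
    Measurable fun z : X × IdealData X => goodInd E P n z.2 j *
      ∑ k, (idealState E P z.2 j).ftrl E P z.1 k * lossEst E P z.2 j z.1 k ^ 2 := by
  refine ((measurable_goodInd E j).comp measurable_snd).mul (Finset.measurable_sum _ fun k _ => ?_)
  exact ((measurable_idealFtrl E P j k).comp measurable_swap).mul
    (((measurable_lossEst E P j k).comp measurable_swap).pow_const 2)

theorem abs_secondMoment_le (h : Regime P n K ι) (ω : IdealData X) (j : ℕ) (c : X) :
    |goodInd E P n ω j * ∑ k, (idealState E P ω j).ftrl E P c k * lossEst E P ω j c k ^ 2| ≤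
      (4 / (3 * P.γ)) ^ 2 :=
  abs_goodInd_mul_le E ω j (abs_sum_simplex_mul_le (ftrl_mem E ω j c) fun k => by
    rw [abs_pow]
    exact pow_le_pow_left₀ (abs_nonneg _) (abs_lossEst_le E h ω j c k) 2)

/-- The second moments of the loss estimates, on average over the contexts. -/
theorem integral_integral_secondMoment_le (h : Regime P n K ι) (j : ℕ) :
    ∫ c, ∫ ω, goodInd E P n ω j * ∑ k, (idealState E P ω j).ftrl E P c k *
      lossEst E P ω j c k ^ 2 ∂E.idealProb ∂E.contextLaw ≤ 21 * K := by
  have hγ := h.γ_pos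
  -- In the first epoch all loss estimates are zero.
  rcases Nat.lt_or_ge j n with hj | hj
  · have hl : ∀ ω c k, lossEst E P ω j c k = 0 := fun ω c k => by
      rw [lossEst, if_pos (by rw [h.L_eq]; omega)]
    simp only [hl]
    simp
  have hmg := measurable_goodInd (P := P) (n := n) E j
  have hg := fun ω => goodInd_mem (P := P) (n := n) E ω j
  have hs := fun ω c => (valid_idealState E P ω j).snap_mem c
  have hf0 := fun ω => (valid_idealState E P ω j).trueFreq_nonneg
  have hf1 := fun ω => trueFreq_le_half E (valid_idealState E P ω j)
  have hx := fun ω k => freq_nonneg E h.L_eq h.n_pos ω j k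
  set v : IdealData X → Fin K → ℝ := fun ω k => 4 * trueFreq E (idealState E P ω j).snap k /
        ((idealState E P ω j).freq k + 3 / 2 * P.γ) ^ 2 with hv
  have hvm : ∀ k, Measurable fun ω => v ω k := fun k =>
    ((measurable_trueFreq E P j k).const_mul 4).div
      ((((measurableFamily_idealState E P j).freq k).add_const _).pow_const 2)
  have hv0 : ∀ ω k, 0 ≤ v ω k := fun ω k => by
    have := hf0 ω k
    simp only [hv]; positivity
  have hv1 : ∀ ω k, v ω k ≤ 2 / (3 / 2 * P.γ) ^ 2 := fun ω k => by
    have h1 := hf0 ω k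
    have h2 := hf1 ω k
    have h3 := hx ω k
    simp only [hv]
    refine div_le_div₀ zero_le_two (by linarith) (by positivity) ?_
    gcongr
    linarith
  have hfix : ∀ c, ∫ ω, goodInd E P n ω j * ∑ k, (idealState E P ω j).ftrl E P c k *
      lossEst E P ω j c k ^ 2 ∂E.idealProb ≤
      ∫ ω, ∑ k, goodInd E P n ω j * (2 * (idealState E P ω j).snap c k) * v ω k
        ∂E.idealProb := by
    intro c
    have hmp := measurable_idealFtrl_left E P j c
    have hp := fun ω => ftrl_mem (P := P) E ω j c
    have hms : ∀ k, Measurable fun ω => (idealState E P ω j).snap c k := fun k =>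
      ((measurableFamily_idealState E P j).snap k).comp (f := fun ω => (ω, c)) (by fun_prop)
    have hgp0 : ∀ ω k, 0 ≤ goodInd E P n ω j * (idealState E P ω j).ftrl E P c k := fun ω k =>
      mul_nonneg (hg ω).1 ((hp ω).1 k)
    have hgp1 : ∀ ω k, goodInd E P n ω j * (idealState E P ω j).ftrl E P c k ≤ 1 := fun ω k =>
      mul_le_one₀ (hg ω).2 ((hp ω).1 k) (le_one_of_mem_simplexOn (hp ω) k)
    have hgs0 : ∀ ω k, 0 ≤ goodInd E P n ω j * (2 * (idealState E P ω j).snap c k) := fun ω k =>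
      mul_nonneg (hg ω).1 (mul_nonneg zero_le_two ((hs ω c).1 k))
    have hgs1 : ∀ ω k, goodInd E P n ω j * (2 * (idealState E P ω j).snap c k) ≤ 1 * 2 :=
      fun ω k => mul_le_mul (hg ω).2 (by linarith [le_one_of_mem_simplexOn (hs ω c) k])
        (mul_nonneg zero_le_two ((hs ω c).1 k)) zero_le_one
    have e : ∀ ω, goodInd E P n ω j * ∑ k, (idealState E P ω j).ftrl E P c k *
        lossEst E P ω j c k ^ 2 = ∑ k, goodInd E P n ω j * (idealState E P ω j).ftrl E P c k *
        lossEst E P ω j c k ^ 2 := fun ω => by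
      rw [Finset.mul_sum]; simp only [mul_assoc]
    simp only [e]
    rw [integral_finsetSum _ fun k _ => ?_, integral_finsetSum _ fun k _ => ?_]
    · refine Finset.sum_le_sum fun k _ => ?_
      have hpk : Predictable (fun ω => goodInd E P n ω j *
          (idealState E P ω j).ftrl E P c k) j :=
        (predictable_goodInd E P n j).mul (predictable_state E P j fun st => st.ftrl E P c k)
      refine (integral_lossEst_sq_le E h c k hpk (hmg.mul (hmp k)) (fun ω => hgp0 ω k)
        fun ω => hgp1 ω k).trans ?_
      refine integral_mono (integrable_of_mem_Icc (a := 0) (b := 1 * (2 / (3 / 2 * P.γ) ^ 2))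
        ((hmg.mul (hmp k)).mul (hvm k)) fun ω => ⟨mul_nonneg (hgp0 ω k) (hv0 ω k),
          mul_le_mul (hgp1 ω k) (hv1 ω k) (hv0 ω k) zero_le_one⟩)
        (integrable_of_mem_Icc (a := 0) (b := 1 * 2 * (2 / (3 / 2 * P.γ) ^ 2))
        ((hmg.mul ((hms k).const_mul 2)).mul (hvm k)) fun ω => ⟨mul_nonneg (hgs0 ω k) (hv0 ω k),
          mul_le_mul (hgs1 ω k) (hv1 ω k) (hv0 ω k) (by norm_num)⟩) fun ω => ?_
      refine mul_le_mul_of_nonneg_right ?_ (hv0 ω k)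
      by_cases hgd : Good E P n ω j
      · exact mul_le_mul_of_nonneg_left (hgd.ftrl_comparable h hj c k).2 (hg ω).1
      · have h0 : goodInd E P n ω j = 0 := by rw [goodInd, if_neg hgd]
        simp only [h0, zero_mul]; exact le_rfl
    · exact integrable_of_mem_Icc (a := 0) (b := 1 * 2 * (2 / (3 / 2 * P.γ) ^ 2))
        ((hmg.mul ((hms k).const_mul 2)).mul (hvm k)) fun ω => ⟨mul_nonneg (hgs0 ω k) (hv0 ω k),
          mul_le_mul (hgs1 ω k) (hv1 ω k) (hv0 ω k) (by norm_num)⟩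
    · refine integrable_of_mem_Icc (a := 0) (b := 1 * (4 / (3 * P.γ)) ^ 2)
        ((hmg.mul (hmp k)).mul ((measurable_lossEst_left E P j c k).pow_const 2)) fun ω =>
        ⟨mul_nonneg (hgp0 ω k) (sq_nonneg _), mul_le_mul (hgp1 ω k) ?_ (sq_nonneg _) zero_le_one⟩
      exact pow_le_pow_left₀ (lossEst_nonneg E h.L_eq h.n_pos hγ ω j c k)
        (lossEst_le E h.L_eq h.n_pos hγ ω j c k) 2
  have hint : Integrable (fun z : X × IdealData X => ∑ k, goodInd E P n z.2 j *
      (2 * (idealState E P z.2 j).snap z.1 k) * v z.2 k) (E.contextLaw.prod E.idealProb) := by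
    refine integrable_finsetSum _ fun k _ => ?_
    have hsm : Measurable fun z : X × IdealData X => (idealState E P z.2 j).snap z.1 k :=
      ((measurableFamily_idealState E P j).snap k).comp measurable_swap
    refine integrable_of_mem_Icc (a := 0) (b := 1 * 2 * (2 / (3 / 2 * P.γ) ^ 2))
      (((hmg.comp measurable_snd).mul (hsm.const_mul 2)).mul ((hvm k).comp measurable_snd))
      fun z => ⟨mul_nonneg (mul_nonneg (hg z.2).1 (mul_nonneg zero_le_two ((hs z.2 z.1).1 k)))
        (hv0 z.2 k), ?_⟩
    exact mul_le_mul (mul_le_mul (hg z.2).2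
      (by linarith [le_one_of_mem_simplexOn (hs z.2 z.1) k])
      (mul_nonneg zero_le_two ((hs z.2 z.1).1 k)) zero_le_one) (hv1 z.2 k) (hv0 z.2 k)
      (by norm_num)
  refine (integral_mono_of_nonneg_right hint.integral_prod_left (fun c => integral_nonneg fun ω =>
    Finset.sum_nonneg fun k _ => mul_nonneg (mul_nonneg (hg ω).1
      (mul_nonneg zero_le_two ((hs ω c).1 k))) (hv0 ω k)) hfix).trans ?_
  rw [integral_integral_swap hint]
  refine integral_le_of_le_const (by positivity) fun ω => ?_
  dsimp only
  have hsi : ∀ k, Integrable (fun c => (idealState E P ω j).snap c k) E.contextLaw :=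
    fun k => integrable_of_mem_Icc (measurable_snap E P ω _ k) fun c =>
      ⟨(hs ω c).1 k, le_one_of_mem_simplexOn (hs ω c) k⟩
  rw [integral_finsetSum _ fun k _ => (((hsi k).const_mul 2).const_mul _).mul_const _]
  have hK : (21 * K : ℝ) = ∑ _k : Fin K, 21 := by simp; ring
  rw [hK]
  refine Finset.sum_le_sum fun k _ => ?_
  rw [integral_mul_const, integral_const_mul, integral_const_mul]
  have hf : ∫ c, (idealState E P ω j).snap c k ∂E.contextLaw =
    2 * trueFreq E (idealState E P ω j).snap k := by unfold trueFreq; ring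
  rw [hf]
  by_cases hgd : Good E P n ω j
  · have h1 : goodInd E P n ω j = 1 := by rw [goodInd, if_pos hgd]
    have h2 := (hgd j le_rfl hj).1 k
    have h3 := hf0 ω k
    have h4 := hx ω k
    simp only [h1, hv]
    set f := trueFreq E (idealState E P ω j).snap k
    set x := (idealState E P ω j).freq k + 3 / 2 * P.γ with hxd
    have h5 : 7 / 8 * f ≤ x := by linarith
    have hx0 : 0 < x := by positivity
    -- The factors are `p ≤ 2 * snap`, the average `2 * f` of the snapshot, and the conditional
    -- second moment. Since `x ≥ 7 / 8 * f`, the result is at most 16·64/49 < 21.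
    have e : 1 * (2 * (2 * f)) * (4 * f / x ^ 2) = 16 * f ^ 2 / x ^ 2 := by ring
    rw [e, div_le_iff₀ (by positivity)]
    have h6 : (7 / 8 * f) ^ 2 ≤ x ^ 2 := pow_le_pow_left₀ (by positivity) h5 2
    nlinarith
  · have h0 : goodInd E P n ω j = 0 := by rw [goodInd, if_neg hgd]
    simp only [h0]; norm_num

end ExpectedRegret

/-! ### Summation over the rounds and the choice of parameters. -/

section RegretBound

variable {X : Type u} [MeasurableSpace X] {K : ℕ} [NeZero K] (E : Environment X K) {P : Params}
  {n : ℕ} {ι : ℝ}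

/-- The sum over pairs of rounds of the expected regret in a fixed context. -/
theorem sum_integral_pairRegret_le (h : Regime P n K ι) (π : E.Policy) (c : X) (J : ℕ) :
    ∑ j ∈ Finset.range J, ∫ ω, (idealState E P ω j).pairRegret E P π j c ∂E.idealProb ≤
      ∑ j ∈ Finset.range J, ((if j < n then 2 else 0) +
        2 * E.idealProb.real {ω | Good E P n ω j}ᶜ) + Real.log K / P.η +
      P.η / 2 * ∑ j ∈ Finset.range J, ∫ ω, goodInd E P n ω j *
        ∑ k, (idealState E P ω j).ftrl E P c k * lossEst E P ω j c k ^ 2 ∂E.idealProb +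
      ∑ j ∈ Finset.range J, if j < n then 0 else ∫ ω, goodInd E P n ω j *
        (∑ k, (idealState E P ω j).ftrl E P c k * (E.pairLoss j k c *
          (1 - freqRatio E P ω j k))) ∂E.idealProb := by
  have hmg := fun j => measurable_goodInd (P := P) (n := n) E j
  have iC : ∀ j, Integrable (fun ω => goodInd E P n ω j * (∑ k, (idealState E P ω j).ftrl E P c k *
      lossEst E P ω j c k - lossEst E P ω j c (π.1 c))) E.idealProb := fun j =>
    integrable_of_abs_le ((hmg j).mul ((Finset.measurable_sum _ fun k _ =>
      (measurable_idealFtrl_left E P j c k).mul (measurable_lossEst_left E P j c k)).sub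
      (measurable_lossEst_left E P j c _))) (B := 4 / (3 * P.γ) + 4 / (3 * P.γ)) fun ω =>
      abs_goodInd_mul_le E ω j ((abs_sub _ _).trans (add_le_add
        (abs_sum_simplex_mul_le (ftrl_mem E ω j c) fun k => abs_lossEst_le E h ω j c k)
        (abs_lossEst_le E h ω j c _)))
  have iD : ∀ j, Integrable (fun ω => goodInd E P n ω j * ∑ k, (idealState E P ω j).ftrl E P c k *
      lossEst E P ω j c k ^ 2) E.idealProb := fun j =>
    integrable_of_abs_le ((measurable_secondMoment E P n j).comp (f := fun ω => (c, ω))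
      (by fun_prop)) fun ω => abs_secondMoment_le E h ω j c
  have hC : ∑ j ∈ Finset.range J, ∫ ω, goodInd E P n ω j * (∑ k, (idealState E P ω j).ftrl E P c k *
      lossEst E P ω j c k - lossEst E P ω j c (π.1 c)) ∂E.idealProb ≤ Real.log K / P.η +
      P.η / 2 * ∑ j ∈ Finset.range J, ∫ ω, goodInd E P n ω j *
        ∑ k, (idealState E P ω j).ftrl E P c k * lossEst E P ω j c k ^ 2 ∂E.idealProb := by
    have iS := integrable_finsetSum (μ := E.idealProb) (Finset.range J) fun j _ => iD j
    rw [← integral_finsetSum _ fun j _ => iC j, ← integral_finsetSum _ fun j _ => iD j]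
    calc _ ≤ ∫ ω, (Real.log K / P.η + P.η / 2 * ∑ j ∈ Finset.range J, goodInd E P n ω j *
        ∑ k, (idealState E P ω j).ftrl E P c k * lossEst E P ω j c k ^ 2) ∂E.idealProb :=
          integral_mono (integrable_finsetSum _ fun j _ => iC j)
            ((integrable_const _).add (iS.const_mul _))
            fun ω => sum_goodInd_ftrl_regret E h ω c (π.2.2 c) J
      _ = _ := by
          rw [integral_add (integrable_const _) (iS.const_mul _), integral_const_mul]
          simp
  have hj : ∀ j ∈ Finset.range J, ∫ ω, (idealState E P ω j).pairRegret E P π j c ∂E.idealProb ≤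
      ((if j < n then 2 else 0) + 2 * E.idealProb.real {ω | Good E P n ω j}ᶜ) +
      ∫ ω, goodInd E P n ω j * (∑ k, (idealState E P ω j).ftrl E P c k *
        lossEst E P ω j c k - lossEst E P ω j c (π.1 c)) ∂E.idealProb +
      (if j < n then 0 else ∫ ω, goodInd E P n ω j *
        (∑ k, (idealState E P ω j).ftrl E P c k * (E.pairLoss j k c *
          (1 - freqRatio E P ω j k))) ∂E.idealProb) := by
    intro j _
    -- Pairs of the first epoch are charged 2 each. Their estimates vanish, so the FTRL sum may
    -- still start at `j = 0`.
    by_cases hjn : j < n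
    · have hl : ∀ ω k, lossEst E P ω j c k = 0 := fun ω k => by
        rw [lossEst, if_pos (by rw [h.L_eq]; omega)]
      have h1 := integral_le_of_le_const (P := E.idealProb) zero_le_two
        fun ω => pairRegret_le_two E P π ω j c
      have h2 : 0 ≤ E.idealProb.real {ω | Good E P n ω j}ᶜ := measureReal_nonneg
      simp only [hl, hjn, if_true]
      simp only [mul_zero, Finset.sum_const_zero, sub_zero, integral_zero, add_zero]
      linarith
    · have := integral_pairRegret_le E h (not_lt.1 hjn) π c
      simp only [hjn, if_false]
      linarith
  have hsum := Finset.sum_le_sum hj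
  rw [Finset.sum_add_distrib, Finset.sum_add_distrib] at hsum
  linarith

theorem sum_first_epoch_le (n J : ℕ) :
    ∑ j ∈ Finset.range J, (if j < n then (2 : ℝ) else 0) ≤ 2 * n := by
  rw [← Finset.sum_filter, Finset.sum_const, nsmul_eq_mul, mul_comm]
  have h1 : ((Finset.range J).filter fun j => j < n).card ≤ n := by
    calc _ ≤ (Finset.range n).card := Finset.card_le_card fun j hj => by
          simp only [Finset.mem_filter, Finset.mem_range] at hj ⊢
          exact hj.2
      _ = n := Finset.card_range n
  have h2 : (((Finset.range J).filter fun j => j < n).card : ℝ) ≤ n := by exact_mod_cast h1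
  linarith

/-- The expected regret against a policy. -/
theorem integral_realizedRegret_le_of_regime (h : Regime P n K ι) (T : ℕ) (π : E.Policy) :
    ∫ ω, realizedRegret E P T π ω ∂E.prob ≤ 1 + 2 * n + Real.log K / P.η +
      T / 2 * (4 * (T / (2 * n) * (K * Real.exp (-ι))) + 21 / 2 * (P.η * K) + 56 * K * P.γ) := by
  set ν := E.contextLaw with hν
  set J := T / 2 with hJ
  have hγ := h.γ_pos
  have hη := h.η_pos
  have hn : (0 : ℝ) < n := by exact_mod_cast h.n_pos
  have hmain := integral_realizedRegret_le E P (by rw [h.L_eq]; exact even_two_mul n) T π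
  have iPR := fun j => integrable_pairRegret E P π j
  have iD : ∀ j, Integrable (fun c => ∫ ω, goodInd E P n ω j *
      ∑ k, (idealState E P ω j).ftrl E P c k * lossEst E P ω j c k ^ 2 ∂E.idealProb) ν := fun j =>
    (integrable_of_abs_le (Q := ν.prod E.idealProb) (measurable_secondMoment E P n j)
      fun z => abs_secondMoment_le E h z.2 j z.1).integral_prod_left
  have iA : ∀ j, Integrable (fun c => if j < n then 0 else ∫ ω, goodInd E P n ω j *
        (∑ k, (idealState E P ω j).ftrl E P c k * (E.pairLoss j k c *
          (1 - freqRatio E P ω j k))) ∂E.idealProb) ν := by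
    intro j
    split_ifs
    · exact integrable_const 0
    · have hm : Measurable fun z : X × IdealData X => goodInd E P n z.2 j *
          (∑ k, (idealState E P z.2 j).ftrl E P z.1 k * (E.pairLoss j k z.1 *
          (1 - freqRatio E P z.2 j k))) := by
        refine ((measurable_goodInd E j).comp measurable_snd).mul
          (Finset.measurable_sum _ fun k _ => ?_)
        exact ((measurable_idealFtrl E P j k).comp measurable_swap).mul
          (((measurable_pairLoss E j k).comp measurable_fst).mul
          (((measurable_freqRatio E P j k).const_sub 1).comp measurable_snd))
      refine (integrable_of_abs_le (Q := ν.prod E.idealProb) hm (B := 2 * (1 / (3 * P.γ) + 1))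
        fun z => abs_goodInd_mul_le E z.2 j (abs_sum_simplex_mul_le (ftrl_mem E z.2 j z.1)
          fun k => ?_)).integral_prod_left
      rw [abs_mul, abs_sub_comm]
      exact mul_le_mul (abs_pairLoss_le E j k z.1) (abs_freqRatio_sub_one_le E h z.2 j k)
        (abs_nonneg _) zero_le_two
  -- The FTRL bound holds for each fixed context, while the moment and bias bounds hold only on
  -- average over contexts. So the context integral is taken last.
  have hswap : ∀ j, ∫ ω, ∫ c, (idealState E P ω j).pairRegret E P π j c ∂ν ∂E.idealProb =
      ∫ c, ∫ ω, (idealState E P ω j).pairRegret E P π j c ∂E.idealProb ∂ν := fun j =>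
    (integral_integral_swap (f := fun c ω => (idealState E P ω j).pairRegret E P π j c)
      (iPR j)).symm
  have hbad : ∑ j ∈ Finset.range J, 2 * E.idealProb.real {ω | Good E P n ω j}ᶜ ≤
      T / 2 * (4 * (T / (2 * n) * (K * Real.exp (-ι)))) := by
    have hJT : (J : ℝ) ≤ T / 2 := by
      rw [hJ]; exact_mod_cast Nat.cast_div_le (α := ℝ)
    have h1 : ∀ j ∈ Finset.range J, 2 * E.idealProb.real {ω | Good E P n ω j}ᶜ ≤
        4 * (T / (2 * n) * (K * Real.exp (-ι))) := by
      intro j hj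
      have hjT : (j : ℝ) ≤ T / 2 := le_trans (by exact_mod_cast (Finset.mem_range.1 hj).le) hJT
      have h2 : ((j / n : ℕ) : ℝ) ≤ T / (2 * n) := by
        refine Nat.cast_div_le.trans ?_
        rw [← div_div]
        exact div_le_div_of_nonneg_right hjT hn.le
      have h3 := measure_not_good_le E h j
      have h4 : (0 : ℝ) ≤ 2 * (K * Real.exp (-ι)) := by positivity
      have h5 := mul_le_mul_of_nonneg_right h2 h4
      linarith
    refine (Finset.sum_le_card_nsmul _ _ _ h1).trans ?_
    rw [Finset.card_range, nsmul_eq_mul]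
    exact mul_le_mul_of_nonneg_right hJT (by positivity)
  have hJT : (J : ℝ) ≤ T / 2 := by
    rw [hJ]; exact_mod_cast Nat.cast_div_le (α := ℝ)
  have hD : ∑ j ∈ Finset.range J, ∫ c, ∫ ω, goodInd E P n ω j *
      ∑ k, (idealState E P ω j).ftrl E P c k * lossEst E P ω j c k ^ 2 ∂E.idealProb ∂ν ≤
      T / 2 * (21 * K) := by
    refine (Finset.sum_le_card_nsmul _ _ _ fun j _ =>
      integral_integral_secondMoment_le E h j).trans ?_
    rw [Finset.card_range, nsmul_eq_mul]
    exact mul_le_mul_of_nonneg_right hJT (by positivity)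
  have hA : ∑ j ∈ Finset.range J, ∫ c, (if j < n then 0 else ∫ ω, goodInd E P n ω j *
        (∑ k, (idealState E P ω j).ftrl E P c k * (E.pairLoss j k c *
          (1 - freqRatio E P ω j k))) ∂E.idealProb) ∂ν ≤ T / 2 * (56 * K * P.γ) := by
    refine (Finset.sum_le_card_nsmul _ _ (56 * K * P.γ) fun j _ => ?_).trans ?_
    · split_ifs with hj
      · rw [integral_zero]; positivity
      · exact integral_integral_play_bias_le E h (not_lt.1 hj)
    rw [Finset.card_range, nsmul_eq_mul]
    exact mul_le_mul_of_nonneg_right hJT (by positivity)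
  have hfirst := sum_first_epoch_le n J
  have hint : ∑ j ∈ Finset.range J, ∫ ω, ∫ c, (idealState E P ω j).pairRegret E P π j c
      ∂ν ∂E.idealProb ≤ (∑ j ∈ Finset.range J, ((if j < n then 2 else 0) +
        2 * E.idealProb.real {ω | Good E P n ω j}ᶜ) + Real.log K / P.η) +
      P.η / 2 * ∑ j ∈ Finset.range J, ∫ c, ∫ ω, goodInd E P n ω j *
        ∑ k, (idealState E P ω j).ftrl E P c k * lossEst E P ω j c k ^ 2 ∂E.idealProb ∂ν +
      ∑ j ∈ Finset.range J, ∫ c, (if j < n then 0 else ∫ ω, goodInd E P n ω j *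
        (∑ k, (idealState E P ω j).ftrl E P c k * (E.pairLoss j k c *
          (1 - freqRatio E P ω j k))) ∂E.idealProb) ∂ν := by
    have iSD := integrable_finsetSum (μ := ν) (Finset.range J) fun j _ => iD j
    have iSA := integrable_finsetSum (μ := ν) (Finset.range J) fun j _ => iA j
    simp only [hswap]
    rw [← integral_finsetSum _ fun j _ => (iPR j).integral_prod_left,
      ← integral_finsetSum _ fun j _ => iD j, ← integral_finsetSum _ fun j _ => iA j]
    refine (integral_mono (integrable_finsetSum _ fun j _ => (iPR j).integral_prod_left)
      (((integrable_const _).add (iSD.const_mul _)).add iSA)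
      fun c => sum_integral_pairRegret_le E h π c J).trans (le_of_eq ?_)
    have h1 : Integrable (fun c => (∑ j ∈ Finset.range J, ((if j < n then 2 else 0) +
        2 * E.idealProb.real {ω | Good E P n ω j}ᶜ) + Real.log K / P.η) +
      P.η / 2 * ∑ j ∈ Finset.range J, ∫ ω, goodInd E P n ω j *
        ∑ k, (idealState E P ω j).ftrl E P c k * lossEst E P ω j c k ^ 2 ∂E.idealProb) ν :=
      (integrable_const _).add (iSD.const_mul _)
    refine (integral_add h1 iSA).trans ?_
    rw [integral_add (integrable_const _) (iSD.const_mul _), integral_const_mul]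
    simp
  rw [Finset.sum_add_distrib] at hint
  have hD' := mul_le_mul_of_nonneg_left hD (show 0 ≤ P.η / 2 by positivity)
  linarith

theorem regret_le_rounds (P : Params) (T : ℕ) : regret E P T ≤ T := by
  have := nonempty_policy E
  exact ciSup_le fun π => integral_le_of_le_const (Nat.cast_nonneg T) fun ω =>
    (le_abs_self _).trans (abs_realizedRegret_le E P T π ω)

/-- The regret bound for general parameters. -/
theorem regret_le (T L : ℕ) (η γ ι : ℝ) (hL : 0 < L) (heven : Even L) (hη : 0 < η) (hγ : 0 < γ)
    (hι : 0 < ι) (h1 : η ≤ γ / (2 * (2 * L * γ + ι))) (h2 : 16 * ι / L ≤ γ)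
    (h3 : Real.log (8 * K / γ) ≤ ι) :
    regret E ⟨η, γ, L⟩ T ≤
      28 * ((γ + ι / L + γ ^ 2 * L / ι + η + Real.exp (-ι) * (T / L)) * (K * T)
        + Real.log K / η + L) := by
  have hK : (1 : ℝ) ≤ K := by exact_mod_cast NeZero.one_le
  have hL0 : (0 : ℝ) < L := by exact_mod_cast hL
  have hlog : 0 ≤ Real.log K := Real.log_nonneg hK
  have hT : (0 : ℝ) ≤ T := Nat.cast_nonneg T
  have hle : γ + η + Real.exp (-ι) * (T / L) ≤
      γ + ι / L + γ ^ 2 * L / ι + η + Real.exp (-ι) * (T / L) := by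
    have : 0 ≤ ι / L := by positivity
    have : 0 ≤ γ ^ 2 * L / ι := by positivity
    linarith
  have hle2 := mul_le_mul_of_nonneg_right hle (show (0 : ℝ) ≤ K * T by positivity)
  have hlη : 0 ≤ Real.log K / η := by positivity
  -- For `γ ≥ 1` the claimed bound exceeds the trivial bound `T`.
  rcases le_or_gt 1 γ with hγ1 | hγ1
  · have hreg := regret_le_rounds E ⟨η, γ, L⟩ T
    have hKT : (T : ℝ) ≤ K * T := le_mul_of_one_le_left hT hK
    have h4 : 1 * (T : ℝ) ≤ (γ + η + Real.exp (-ι) * (T / L)) * (K * T) := by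
      refine mul_le_mul ?_ hKT hT (by positivity)
      have : 0 ≤ Real.exp (-ι) * (T / L) := by positivity
      linarith
    linarith
  · obtain ⟨n, hn⟩ := heven
    have hLn : L = 2 * n := by omega
    have hLn' : (L : ℝ) = 2 * n := by exact_mod_cast hLn
    have hn0 : 0 < n := by omega
    have hn0' : (0 : ℝ) < n := by exact_mod_cast hn0
    have hLγ : 16 * ι ≤ L * γ := by rw [div_le_iff₀ hL0] at h2; linarith
    -- For `γ < 1` the lower bound on `ι` is at least log 8, which is just above 33/16. Together
    -- with `L * γ ≥ 16 * ι` this gives the 33 of the regime.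
    have hι2 : 33 / 16 ≤ ι := by
      refine le_trans ?_ h3
      have h8 : (8 : ℝ) ≤ 8 * K / γ := by
        rw [le_div_iff₀ hγ]; nlinarith
      refine le_trans ?_ (Real.log_le_log (by norm_num) h8)
      have : Real.log 8 = 3 * Real.log 2 := by
        rw [show (8 : ℝ) = 2 ^ 3 by norm_num, Real.log_pow]; norm_num
      rw [this]
      have := Real.log_two_gt_d9
      linarith
    have hreg : Regime ⟨η, γ, L⟩ n K ι := by
      constructor
      · exact hLn
      · exact hn0
      · exact hη
      · exact hγ
      · exact hγ1.le
      -- Dropping `ι` from the denominator leaves `4 * L * η ≤ 1`, and `4 * L = 8 * n`.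
      · change η * (8 * n) ≤ 1
        rw [le_div_iff₀ (by positivity)] at h1
        have h5 : η * (8 * n) * γ ≤ γ := by
          have : 0 ≤ η * ι := by positivity
          rw [hLn'] at h1
          nlinarith
        exact le_of_mul_le_mul_right (by linarith) hγ
      · change 33 ≤ 2 * n * γ
        rw [← hLn']; linarith
      · change ι ≤ n * γ / 8
        rw [hLn'] at hLγ; linarith
      · change K * Real.exp (-ι) ≤ γ / 8
        have h5 : Real.exp (-ι) ≤ γ / (8 * K) := by
          rw [Real.exp_neg, ← inv_div]
          refine inv_anti₀ (by positivity) ?_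
          rwa [← Real.log_le_iff_le_exp (by positivity)]
        have h6 := mul_le_mul_of_nonneg_left h5 (show (0 : ℝ) ≤ K by positivity)
        refine h6.trans (le_of_eq ?_)
        field_simp
    have := nonempty_policy E
    refine (ciSup_le fun π => integral_realizedRegret_le_of_regime E hreg T π).trans ?_
    rw [← hLn']
    have hL1 : (1 : ℝ) ≤ L := by exact_mod_cast hL
    -- The largest coefficient, 28 for `γ`, becomes the constant of the theorem. The terms `ι / L`
    -- and `γ ^ 2 * L / ι` on the right are only slack.
    have e : (T : ℝ) / 2 * (4 * (T / L * (K * Real.exp (-ι))) + 21 / 2 * (η * K) + 56 * K * γ) =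
      (28 * γ + 21 / 4 * η + 2 * (Real.exp (-ι) * (T / L))) * (K * T) := by ring
    have h7 : (28 * γ + 21 / 4 * η + 2 * (Real.exp (-ι) * (T / L))) * (K * T) ≤
        28 * (γ + η + Real.exp (-ι) * (T / L)) * (K * T) := by
      refine mul_le_mul_of_nonneg_right ?_ (by positivity)
      have : 0 ≤ Real.exp (-ι) * (T / L) := by positivity
      linarith
    simp only [e]
    linarith

set_option maxHeartbeats 1000000 in
/-- The regret bound for the tuned parameters. -/
theorem regret_le_of_tuned (T L : ℕ) (η γ ι : ℝ) (hK : 2 ≤ K) (hT : 1 ≤ T)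
    (hι : ι = 2 * Real.log (8 * K * T))
    (hL : L = 2 * ⌈Real.sqrt (ι * K * T / Real.log K) / 2⌉₊) (hγ : γ = 16 * ι / L)
    (hη : η = γ / (2 * (2 * L * γ + ι))) :
    regret E ⟨η, γ, L⟩ T ≤ 25200 * Real.sqrt (K * T) * Real.log (K * T) ^ 1 := by
  have hK2 : (2 : ℝ) ≤ K := by exact_mod_cast hK
  have hT1 : (1 : ℝ) ≤ T := by exact_mod_cast hT
  have hKT : (2 : ℝ) ≤ K * T := by nlinarith
  have hlog2 : 1 / 2 ≤ Real.log 2 := by have := Real.log_two_gt_d9; linarith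
  have hlogK : Real.log 2 ≤ Real.log K := Real.log_le_log two_pos hK2
  have hlogK0 : 0 < Real.log K := by linarith
  have hlam : Real.log K ≤ Real.log (K * T) :=
    Real.log_le_log (by positivity) (le_mul_of_one_le_right (by positivity) hT1)
  set lam := Real.log (K * T) with hlamd
  have h8 : Real.log (8 * K * T) = 3 * Real.log 2 + lam := by
    rw [mul_assoc, Real.log_mul (by norm_num) (by positivity),
      show (8 : ℝ) = 2 ^ 3 by norm_num, Real.log_pow, hlamd]
    norm_num
  have hι1 : 1 ≤ ι := by rw [hι, h8]; linarith
  have hι8 : ι ≤ 8 * lam := by rw [hι, h8]; linarith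
  have hι0 : 0 < ι := by linarith
  set S := Real.sqrt (ι * K * T / Real.log K) with hS
  have hSpos : 0 < S := Real.sqrt_pos.2 (by positivity)
  have hSsq : S ^ 2 * Real.log K = ι * (K * T) := by
    rw [hS, Real.sq_sqrt (by positivity)]; field_simp
  have hSL : S ≤ L := by
    have := Nat.le_ceil (S / 2)
    rw [hL]; push_cast; linarith
  have hLS : (L : ℝ) ≤ S + 2 := by
    have := (Nat.ceil_lt_add_one (show 0 ≤ S / 2 by positivity)).le
    rw [hL]; push_cast; linarith
  have hL0 : (0 : ℝ) < L := lt_of_lt_of_le hSpos hSL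
  have hLpos : 0 < L := by exact_mod_cast hL0
  have hγ0 : 0 < γ := by rw [hγ]; positivity
  have hγL : L * γ = 16 * ι := by rw [hγ]; field_simp
  -- Because `L * γ = 16 * ι`, the bracket `2 * L * γ + ι` equals `33 * ι`.
  have hηL : η = 8 / (33 * L) := by
    have e : 2 * (2 * L * γ + ι) = 66 * ι := by linarith
    rw [hη, e, hγ]; field_simp; norm_num
  have hη0 : 0 < η := by rw [hηL]; positivity
  have hexp : Real.exp ι = (8 * K * T) ^ 2 := by
    rw [hι, mul_comm, Real.exp_mul, Real.exp_log (by positivity)]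
    norm_num
  -- A crude polynomial bound on `L` is enough, since `exp ι` is of order `(K * T) ^ 2`.
  have hSle : S ≤ 2 * ι * (K * T) := by
    have h1 : S ^ 2 ≤ (2 * ι * (K * T)) ^ 2 := by
      have h2 : S ^ 2 ≤ 2 * ι * (K * T) := by nlinarith [sq_nonneg S]
      have h3 : 1 ≤ 2 * ι * (K * T) := by nlinarith
      nlinarith
    exact (sq_le_sq₀ hSpos.le (by positivity)).1 h1
  have hcond : Real.log (8 * K / γ) ≤ ι := by
    rw [Real.log_le_iff_le_exp (by positivity), hexp, div_le_iff₀ hγ0]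
    have h1 : (L : ℝ) ≤ 4 * ι * (K * T) := by nlinarith
    have h2 : L * (8 * K) ≤ L * ((8 * K * T) ^ 2 * γ) := by
      have e : L * ((8 * K * T) ^ 2 * γ) = 1024 * ι * (K * T) ^ 2 := by
        rw [mul_left_comm, hγL]; ring
      rw [e]
      have h3 : (L : ℝ) * (8 * K) ≤ 4 * ι * (K * T) * (8 * K) :=
        mul_le_mul_of_nonneg_right h1 (by positivity)
      have h4 : (K : ℝ) ≤ K * T := le_mul_of_one_le_right (by positivity) hT1
      have h5 : 4 * ι * (K * T) * (8 * K) ≤ 4 * ι * (K * T) * (8 * (K * T)) :=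
        mul_le_mul_of_nonneg_left (by linarith) (by positivity)
      have h6 : 0 ≤ ι * (K * T) ^ 2 := by positivity
      nlinarith
    exact le_of_mul_le_mul_left h2 hL0
  refine (regret_le E T L η γ ι hLpos (by rw [hL]; exact even_two_mul _) hη0 hγ0 hι0 hη.le
    hγ.ge hcond).trans ?_
  -- In units of `ι / L` the five terms are at most 16, 1, 256, 1 and 1.
  have hrate : γ + ι / L + γ ^ 2 * L / ι + η + Real.exp (-ι) * (T / L) ≤ 275 * (ι / S) := by
    have hdiv : ι / L ≤ ι / S := div_le_div_of_nonneg_left hι0.le hSpos hSL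
    have e1 : γ = 16 * (ι / L) := by rw [hγ]; ring
    have e2 : γ ^ 2 * L / ι = 256 * (ι / L) := by rw [hγ]; field_simp; norm_num
    have e3 : η ≤ ι / L := by
      rw [hηL, div_le_div_iff₀ (by positivity) hL0]
      have := mul_le_mul_of_nonneg_right hι1 hL0.le
      linarith
    have e4 : Real.exp (-ι) * (T / L) ≤ ι / L := by
      rw [Real.exp_neg, hexp, ← mul_div_assoc]
      refine div_le_div_of_nonneg_right ?_ hL0.le
      rw [inv_mul_le_iff₀ (by positivity)]
      have h1 : (T : ℝ) ≤ K * T := le_mul_of_one_le_left (by positivity) (by linarith)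
      have h2 : K * T ≤ (8 * K * T : ℝ) ^ 2 := by
        have h3 : (8 * K * T : ℝ) ^ 2 = 64 * (K * T) * (K * T) := by ring
        rw [h3]
        exact le_mul_of_one_le_left (by linarith) (by linarith)
      exact h1.trans (h2.trans (le_mul_of_one_le_right (sq_nonneg _) hι1))
    linarith
  have hSlog : ι / S * (K * T) = S * Real.log K := by
    rw [div_mul_eq_mul_div, ← hSsq]; field_simp
  have hroot : 1 ≤ Real.sqrt (K * T) := Real.one_le_sqrt.2 (by linarith)
  -- Squaring removes the roots: `S ^ 2 * log K ^ 2 = ι * log K * (K * T)`, and `ι * log K ≤ 8 * lam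
  -- ^ 2`.
  have hSl : S * Real.log K ≤ 3 * lam * Real.sqrt (K * T) := by
    have hlam0 : 0 ≤ lam := by linarith
    refine (sq_le_sq₀ (by positivity) (by positivity)).1 ?_
    rw [mul_pow, mul_pow (3 * lam), Real.sq_sqrt (show (0 : ℝ) ≤ K * T by positivity)]
    have e : S ^ 2 * Real.log K ^ 2 = ι * Real.log K * (K * T) := by
      rw [pow_two (Real.log K), ← mul_assoc, hSsq]; ring
    rw [e]
    refine mul_le_mul_of_nonneg_right ?_ (by positivity)
    have h1 : ι * Real.log K ≤ 8 * lam * lam := mul_le_mul hι8 hlam hlogK0.le (by linarith)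
    have h2 : 0 ≤ lam ^ 2 := sq_nonneg lam
    linarith [show (3 * lam) ^ 2 = 8 * lam * lam + lam ^ 2 by ring]
  have hlr : lam ≤ lam * Real.sqrt (K * T) := le_mul_of_one_le_right (by linarith) hroot
  have hS2 : S ≤ 2 * (S * Real.log K) := by
    have := mul_le_mul_of_nonneg_left (hlog2.trans hlogK) hSpos.le
    linarith
  have hηlog : Real.log K / η = 33 / 8 * (L * Real.log K) := by
    rw [hηL]; field_simp
  have h9 := mul_le_mul_of_nonneg_right hrate (show (0 : ℝ) ≤ K * T by positivity)
  have h10 : L * Real.log K ≤ S * Real.log K + 2 * Real.log K := by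
    have := mul_le_mul_of_nonneg_right hLS hlogK0.le
    linarith
  rw [mul_assoc (275 : ℝ), hSlog] at h9
  rw [hηlog, pow_one]
  -- Here 25200 = 28·900. The bracket is at most 825 + (33/8)·5 + 6 + 4 < 900 times `lam * √(K *
  -- T)`, where `lam ≥ 1 / 2` absorbs the rounding constant 2 in `L ≤ S + 2`.
  linarith

end RegretBound

end CrossLearning

end


theorem theorem1 :
    (∃ C : ℝ, 0 < C ∧
      ∀ (X : Type u) [MeasurableSpace X] (K : ℕ) [NeZero K]
        (E : CrossLearning.Environment X K) (T L : ℕ) (η γ ι : ℝ),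
        0 < L → Even L → 0 < η → 0 < γ → 0 < ι →
        η ≤ γ / (2 * (2 * L * γ + ι)) → 16 * ι / L ≤ γ → Real.log (8 * K / γ) ≤ ι →
        CrossLearning.regret E ⟨η, γ, L⟩ T ≤
          C * ((γ + ι / L + γ ^ 2 * L / ι + η + Real.exp (-ι) * (T / L)) * (K * T)
            + Real.log K / η + L)) ∧
    (∃ (C : ℝ) (m : ℕ), 0 < C ∧
      ∀ (X : Type u) [MeasurableSpace X] (K : ℕ) [NeZero K]
        (E : CrossLearning.Environment X K) (T L : ℕ) (η γ ι : ℝ),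
        2 ≤ K → 1 ≤ T →
        ι = 2 * Real.log (8 * K * T) →
        L = 2 * ⌈Real.sqrt (ι * K * T / Real.log K) / 2⌉₊ →
        γ = 16 * ι / L →
        η = γ / (2 * (2 * L * γ + ι)) →
        CrossLearning.regret E ⟨η, γ, L⟩ T ≤
          C * Real.sqrt (K * T) * Real.log (K * T) ^ m) := by
  refine ⟨⟨28, by norm_num, ?_⟩, 25200, 1, by norm_num, ?_⟩
  · intro X _ K _ E T L η γ ι hL he hη hγ hι h1 h2 h3
    exact CrossLearning.regret_le E T L η γ ι hL he hη hγ hι h1 h2 h3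
  · intro X _ K _ E T L η γ ι hK hT hι hL hγ hη
    exact CrossLearning.regret_le_of_tuned E T L η γ ι hK hT hι hL hγ hη
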